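/- **Definitions.** A *complex space* is a Hausdorff reduced complex analytic space, i.e. locally isomorphic to an analytic subset of an open set of some $\mathbb C^N$ with the restrictions of ambient holomorphic functions. $X^{reg}$ denotes the open set of points at which $X$ is locally biholomorphic to an open subset of $\mathbb C^n$, and $S=\mathrm{Sing}(X)=X\setminus X^{reg}$. The Riemannian metric of a $(1,1)$-form $\omega=i\sum g_{j\bar k}\,dz_j\wedge d\bar z_k$ is $g=\mathrm{Re}\sum g_{j\bar k}\,dz_j\otimes d\bar z_k$. A *Calabi–Yau (CY) cone* of dimension $n\ge 1$ is a normal complex space $Y$ with a point $o$ (the apex) such that $Y^*=Y\setminus\{o\}$ is an $n$-dimensional complex manifold, together with a Kähler form $\omega_Y$ on $Y^*$, such that: (i) $(Y^*,\omega_Y)$ is isometric to a Riemannian cone $(\mathbb R^+\times L,\ dr^2+r^2g_L)$ over a non-empty compact Riemannian manifold $(L,g_L)$ of real dimension $2n-1$; with $r(o)=0$, the sets $\{r<\delta\}$, $\delta>0$, form a neighbourhood basis of $o$; and $\omega_Y=i\partial\bar\partial r^2$; (ii) there are a nowhere vanishing section $\Omega$ of $K_Y$ (a nowhere vanishing holomorphic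 $n$-form on $Y^{reg}$) and a constant $c\neq 0$ (depending on the normalization of $\Omega$) such that $\omega_Y^n=c\,\Omega\wedge\bar\Omega$ on $Y^*$. A Kähler form $\omega$ on $X^{reg}$ is *smoothly Kähler* if every $p\in S$ has an open neighbourhood $U\subseteq X$ with a holomorphic embedding $\iota$ into an open subset of some $\mathbb C^N$ carrying a smooth Kähler form $\eta$ with $\omega=\iota^*\eta$ on $U\cap X^{reg}$. **Proposition.** Let $X$ be a compact complex space and let $n\geq 0$. Suppose that for each $p\in S$ we are given an $n$-dimensional CY cone $(Y_p,o_p,\omega_{Y_p})$ such that there is a biholomorphism from an open neighbourhood of $o_p$ in $Y_p$ onto an open neighbourhood of $p$ in $X$ that takes $o_p$ to $p$. 1. Let $\omega$ be a smoothly Kähler metric on $X$. Then there is a Kähler form $\omega'$ on $X^{reg}$ such that (a) for every $p\in S$ there is a biholomorphism $\varphi_p$ from an open neighbourhood $V_p$ of $o_p$ in $Y_p$ onto an open neighbourhood of $p$ in $X$ with $\varphi_p(o_p)=p$ and $\varphi_p^*\omega'=\omega_{Y_p}$ on $V_p\setminus\{o_p\}$ (that is, $\omega'$ is exactly conical near the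 singularities); (b) $[\omega']=[\omega]$ in $H^{1,1}(X^{reg};\mathbb R)$, the real closed $(1,1)$-forms modulo $i\partial\bar\partial C^\infty(X^{reg};\mathbb R)$: there is $f\in C^\infty(X^{reg};\mathbb R)$ with $\omega'=\omega+i\partial\bar\partial f$ on $X^{reg}$. 2. In particular, if $X\subseteq\mathbb P^N$ is the zero set of finitely many homogeneous polynomials, with the reduced induced structure, then the restriction $\omega$ to $X^{reg}$ of the Fubini–Study form $i\partial\bar\partial\log|Z|^2$ is smoothly Kähler, and there is a Kähler form $\omega'$ on $X^{reg}$ satisfying (a) and (b) for this $\omega$. -/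

import Mathlib

open scoped Manifold Topology

universe u v w

namespace ConicalKahler

noncomputable section

/-! ### Forms on `ℂⁿ` -/

/-- Complex Euclidean space `ℂⁿ`. -/
abbrev Cn (n : ℕ) : Type := EuclideanSpace ℂ (Fin n)

/-- Real `2`-covectors on `ℂⁿ`. -/
abbrev TwoCovector (n : ℕ) : Type := Cn n [⋀^Fin 2]→L[ℝ] ℝ

/-- The standard complex structure `J` (multiplication by `i`) as a real linear map. -/
def stdJ (n : ℕ) : Cn n →L[ℝ] Cn n := Complex.I • ContinuousLinearMap.id ℝ (Cn n)

/-- The real `1`-form `dᶜ f = -df ∘ J = i(∂̄ - ∂) f`. -/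
def dc {n : ℕ} (f : Cn n → ℝ) (z : Cn n) : Cn n [⋀^Fin 1]→L[ℝ] ℝ :=
  ContinuousAlternatingMap.ofSubsingleton ℝ (Cn n) ℝ (0 : Fin 1)
    (-((fderiv ℝ f z).comp (stdJ n)))

/-- The real `(1,1)`-form `i∂∂̄ f = ½ d dᶜ f`. -/
def ddbar {n : ℕ} (f : Cn n → ℝ) (z : Cn n) : TwoCovector n :=
  (1 / 2 : ℝ) • extDeriv (dc f) z

/-- `η` is a Kähler form near `z`, tested at `z`: it is smooth at `z`, and at `z` it is closed,
of type `(1,1)` and positive. -/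
structure IsKahlerAt {n : ℕ} (η : Cn n → TwoCovector n) (z : Cn n) : Prop where
  smooth : ContDiffAt ℝ ((⊤ : ℕ∞) : WithTop ℕ∞) η z
  closed : extDeriv η z = 0
  type_one_one : ∀ a b : Cn n, η z ![Complex.I • a, Complex.I • b] = η z ![a, b]
  pos : ∀ a : Cn n, a ≠ 0 → 0 < η z ![a, Complex.I • a]

/-- `A` is an analytic subset of the open set `Ω ⊆ ℂᴺ`: near each point of `Ω` it is the zero set
of finitely many holomorphic functions. -/
def IsAnalyticSubset {N : ℕ} (Ω A : Set (Cn N)) : Prop :=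
  A ⊆ Ω ∧ ∀ z ∈ Ω, ∃ (k : ℕ) (F : Cn N → Fin k → ℂ), AnalyticAt ℂ F z ∧
    ∀ᶠ y in 𝓝 z, (y ∈ A ↔ F y = 0)

/-! ### Reduced complex spaces -/

/-- For a notion `H f x` ("the germ of `f` at `x` is holomorphic") on `X`, the map `ι` is a
holomorphic embedding of the open set `U` into `ℂᴺ`: it is a topological embedding, and the
holomorphic germs on `U` are exactly the restrictions of ambient holomorphic germs. -/
structure IsEmbeddingFor {X : Type u} [TopologicalSpace X] (H : (X → ℂ) → X → Prop) {N : ℕ}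
    (U : Set X) (ι : X → Cn N) : Prop where
  isOpen : IsOpen U
  isEmbedding : Topology.IsEmbedding (U.domRestrict ι)
  germ_iff : ∀ y ∈ U, ∀ f : X → ℂ,
    H f y ↔ ∃ g : Cn N → ℂ, AnalyticAt ℂ g (ι y) ∧ f =ᶠ[𝓝 y] g ∘ ι

/-- A reduced complex analytic space: a topological space with a sheaf of holomorphic functions
(given by the predicate "`f` is holomorphic at `x`"), locally isomorphic to an analytic subset of
an open subset of some `ℂᴺ` with the restrictions of ambient holomorphic functions. -/
class ComplexSpace (X : Type u) [TopologicalSpace X] where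
  HolAt : (X → ℂ) → X → Prop
  exists_model : ∀ x : X, ∃ (N : ℕ) (U : Set X) (ι : X → Cn N) (Ω : Set (Cn N)),
    x ∈ U ∧ IsEmbeddingFor HolAt U ι ∧ IsOpen Ω ∧ IsAnalyticSubset Ω (ι '' U)

section Space

variable {X : Type u} [TopologicalSpace X] [ComplexSpace X]

/-- `ι` is a holomorphic embedding of the open set `U ⊆ X` into `ℂᴺ`. -/
def IsHolEmbedding {N : ℕ} (U : Set X) (ι : X → Cn N) : Prop :=
  IsEmbeddingFor (ComplexSpace.HolAt (X := X)) U ι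

/-- `e` is a biholomorphism from an open subset of `X` onto an open subset of `ℂⁿ`. -/
def IsHolChart {n : ℕ} (e : OpenPartialHomeomorph X (Cn n)) : Prop :=
  ∀ y ∈ e.source, ∀ f : X → ℂ, ComplexSpace.HolAt f y ↔ AnalyticAt ℂ (f ∘ e.symm) (e y)

/-- `φ` is a biholomorphism between an open subset of `Y` and an open subset of `X`. -/
def IsBiholomorphism {Y : Type v} [TopologicalSpace Y] [ComplexSpace Y]
    (φ : OpenPartialHomeomorph Y X) : Prop :=
  ∀ y ∈ φ.source, ∀ f : X → ℂ, ComplexSpace.HolAt f (φ y) ↔ ComplexSpace.HolAt (f ∘ φ) y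

end Space

section Regular

variable (n : ℕ) (X : Type u) [TopologicalSpace X] [ComplexSpace X]

/-- The regular locus `X^reg` of an `n`-dimensional complex space. -/
def regularSet : Set X := {x | ∃ e : OpenPartialHomeomorph X (Cn n), IsHolChart e ∧ x ∈ e.source}

/-- The singular set `S = Sing(X) = X ∖ X^reg` of an `n`-dimensional complex space. -/
def singularSet : Set X := (regularSet n X)ᶜ

/-- Normality of an `n`-dimensional reduced complex space: every germ of a bounded function that is
holomorphic on the regular locus extends to a holomorphic germ. -/
def IsNormal : Prop :=
  ∀ (x : X) (f : X → ℂ), (∀ᶠ y in 𝓝 x, y ∈ regularSet n X → ComplexSpace.HolAt f y) →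
    (∃ B : ℝ, ∀ᶠ y in 𝓝 x, y ∈ regularSet n X → ‖f y‖ ≤ B) →
    ∃ g : X → ℂ, ComplexSpace.HolAt g x ∧ ∀ᶠ y in 𝓝 x, y ∈ regularSet n X → f y = g y

end Regular

/-- A (not yet compatible) `2`-form on part of `X^reg`: an expression in each holomorphic chart.
The values at partial homeomorphisms that are not holomorphic charts, and outside the target of a
chart, are never used. -/
abbrev FormFamily (n : ℕ) (X : Type u) [TopologicalSpace X] : Type u :=
  OpenPartialHomeomorph X (Cn n) → Cn n → TwoCovector n

section Forms

variable {X : Type u} [TopologicalSpace X] [ComplexSpace X] {n : ℕ}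

/-- `ω` is a Kähler form on the open set `W ⊆ X^reg`: its expressions in holomorphic charts
transform by pull-back under changes of charts, and each of them is a Kähler form. -/
structure IsKahlerOn (W : Set X) (ω : FormFamily n X) : Prop where
  compat : ∀ e e' : OpenPartialHomeomorph X (Cn n), IsHolChart e → IsHolChart e' →
    ∀ y ∈ W, y ∈ e.source → y ∈ e'.source →
      ω e (e y) = (ω e' (e' y)).compContinuousLinearMap (fderiv ℝ (e' ∘ e.symm) (e y))
  kahler : ∀ e : OpenPartialHomeomorph X (Cn n), IsHolChart e →
    ∀ y ∈ W, y ∈ e.source → IsKahlerAt (ω e) (e y)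

/-- On the regular points of `U`, the form `ω` is the pull-back `ι^* η` of the form `η` on
(a part of) `ℂᴺ`. -/
def IsRestrictionOn {N : ℕ} (U : Set X) (ι : X → Cn N) (η : Cn N → TwoCovector N)
    (ω : FormFamily n X) : Prop :=
  ∀ e : OpenPartialHomeomorph X (Cn n), IsHolChart e → ∀ y ∈ U, y ∈ e.source →
    ω e (e y) = (η (ι y)).compContinuousLinearMap (fderiv ℝ (ι ∘ e.symm) (e y))

/-- `ω` is a smoothly Kähler metric on `X`: a Kähler form on `X^reg` that near each singular point
is the restriction of an ambient Kähler form under a local holomorphic embedding. (As the condition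
is local, the ambient Kähler manifold may be taken to be an open subset of some `ℂᴺ`.) -/
structure IsSmoothlyKahler (ω : FormFamily n X) : Prop where
  kahler : IsKahlerOn (regularSet n X) ω
  local_restriction : ∀ p ∈ singularSet n X,
    ∃ (N : ℕ) (U : Set X) (ι : X → Cn N) (Ω : Set (Cn N)) (η : Cn N → TwoCovector N),
      p ∈ U ∧ IsHolEmbedding U ι ∧ IsOpen Ω ∧ Set.MapsTo ι U Ω ∧
      (∀ z ∈ Ω, IsKahlerAt η z) ∧ IsRestrictionOn U ι η ω

/-- `[ω'] = [ω]` in `H^{1,1}(X^reg; ℝ)`, the real closed `(1,1)`-forms modulo `i∂∂̄` of smooth real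
functions: `ω' = ω + i∂∂̄ f` on `X^reg` for some `f ∈ C^∞(X^reg; ℝ)`. -/
def SameClass (ω' ω : FormFamily n X) : Prop :=
  ∃ f : X → ℝ, ∀ e : OpenPartialHomeomorph X (Cn n), IsHolChart e → ∀ z ∈ e.target,
    ContDiffAt ℝ ((⊤ : ℕ∞) : WithTop ℕ∞) (f ∘ e.symm) z ∧ ω' e z = ω e z + ddbar (f ∘ e.symm) z

/-- `φ^* ω = η` on `W ⊆ Y^reg`, for a biholomorphism `φ` between open subsets of `Y` and `X`. -/
def IsPullbackOn {Y : Type v} [TopologicalSpace Y] [ComplexSpace Y]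
    (φ : OpenPartialHomeomorph Y X) (W : Set Y) (ω : FormFamily n X) (η : FormFamily n Y) : Prop :=
  ∀ (e : OpenPartialHomeomorph Y (Cn n)) (e' : OpenPartialHomeomorph X (Cn n)),
    IsHolChart e → IsHolChart e' → ∀ y ∈ W, y ∈ e.source → φ y ∈ e'.source →
      η e (e y) = (ω e' (e' (φ y))).compContinuousLinearMap
        (fderiv ℝ (e' ∘ φ ∘ e.symm) (e y))

/-- The family `h` represents a nowhere vanishing section `Ω` of the canonical bundle over
`X^reg` (for normal `X`: a nowhere vanishing section of `K_X`), where `Ω = h_e dz₁ ∧ ⋯ ∧ dzₙ` in the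
chart `e`. -/
structure IsNonvanishingVolumeForm (h : OpenPartialHomeomorph X (Cn n) → Cn n → ℂ) : Prop where
  analytic : ∀ e : OpenPartialHomeomorph X (Cn n), IsHolChart e → ∀ z ∈ e.target,
    AnalyticAt ℂ (h e) z
  ne_zero : ∀ e : OpenPartialHomeomorph X (Cn n), IsHolChart e → ∀ z ∈ e.target, h e z ≠ 0
  compat : ∀ e e' : OpenPartialHomeomorph X (Cn n), IsHolChart e → IsHolChart e' →
    ∀ y ∈ e.source, y ∈ e'.source →
      h e (e y) = h e' (e' y) * (fderiv ℂ (e' ∘ e.symm) (e y)).det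

end Forms

/-- The matrix `(g_{j k̄})` of a real `(1,1)`-covector `η = i ∑ g_{j k̄} dz_j ∧ dz̄_k`. -/
def hermMatrix {n : ℕ} (η : TwoCovector n) : Matrix (Fin n) (Fin n) ℂ := fun j k =>
  let b : Fin n → Cn n := fun i => EuclideanSpace.single i (1 : ℂ)
  ((η ![b j, Complex.I • b k] : ℝ) - Complex.I * (η ![b j, b k] : ℝ)) / 2

/-! ### Calabi–Yau cones -/

/-- A Calabi–Yau cone of complex dimension `n`. The Riemannian metric of a form
`ω = i ∑ g_{j k̄} dz_j ∧ dz̄_k` is `g = Re ∑ g_{j k̄} dz_j ⊗ dz̄_k = ½ ω(·, J ·)`; this is the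
normalization in which a Kähler cone metric `g = dr² + r² g_L` has the Kähler form `i∂∂̄ r²`. -/
structure CYCone (n : ℕ) where
  /-- the underlying normal analytic variety -/
  Y : Type v
  [topY : TopologicalSpace Y]
  [t2Y : T2Space Y]
  [spaceY : ComplexSpace Y]
  /-- the apex -/
  o : Y
  n_pos : 0 < n
  normal : IsNormal n Y
  regular : ∀ y : Y, y ≠ o → y ∈ regularSet n Y
  /-- the link, a closed manifold of real dimension `2n - 1` -/
  L : Type w
  [topL : TopologicalSpace L]
  [t2L : T2Space L]
  [compactL : CompactSpace L]
  [nonemptyL : Nonempty L]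
  [chartedL : ChartedSpace (EuclideanSpace ℝ (Fin (2 * n - 1))) L]
  [manifoldL : IsManifold (𝓡 (2 * n - 1)) ((⊤ : ℕ∞) : WithTop ℕ∞) L]
  /-- the Riemannian metric of the link -/
  gL : Bundle.ContMDiffRiemannianMetric (𝓡 (2 * n - 1)) ((⊤ : ℕ∞) : WithTop ℕ∞)
    (EuclideanSpace ℝ (Fin (2 * n - 1))) (fun x : L => TangentSpace (𝓡 (2 * n - 1)) x)
  /-- the identification of `(0, ∞) × L` with `Y ∖ {o}` -/
  param : OpenPartialHomeomorph (ℝ × L) Y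
  param_source : param.source = Set.Ioi 0 ×ˢ Set.univ
  param_target : param.target = {o}ᶜ
  /-- the distance from the apex -/
  r : Y → ℝ
  r_apex : r o = 0
  r_param : ∀ (t : ℝ) (x : L), 0 < t → r (param (t, x)) = t
  /-- the apex is the tip of the cone: its neighbourhoods are given by the distance `r` -/
  apex_nhds : (𝓝 o).HasBasis (fun δ : ℝ => 0 < δ) (fun δ => {y | r y < δ})
  /-- the Calabi–Yau cone metric -/
  ω : FormFamily n Y
  kahler : IsKahlerOn {o}ᶜ ω
  potential : ∀ e : OpenPartialHomeomorph Y (Cn n), IsHolChart e → ∀ y ∈ e.source, y ≠ o →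
    ω e (e y) = ddbar (fun z => r (e.symm z) ^ 2) (e y)
  param_smooth : ∀ e : OpenPartialHomeomorph Y (Cn n), IsHolChart e →
    ∀ (t : ℝ) (x : L), 0 < t → param (t, x) ∈ e.source →
      ContMDiffAt (𝓘(ℝ, ℝ).prod (𝓡 (2 * n - 1))) 𝓘(ℝ, Cn n) ((⊤ : ℕ∞) : WithTop ℕ∞) (e ∘ param) (t, x)
  /-- in the coordinates `(t, x) ∈ (0, ∞) × L` the metric is `dt² + t² g_L` -/
  param_isometry : ∀ e : OpenPartialHomeomorph Y (Cn n), IsHolChart e →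
    ∀ (t : ℝ) (x : L), 0 < t → param (t, x) ∈ e.source →
      ∀ (a b : ℝ) (ξ ζ : TangentSpace (𝓡 (2 * n - 1)) x),
        let D : ℝ × TangentSpace (𝓡 (2 * n - 1)) x → Cn n :=
          mfderiv (𝓘(ℝ, ℝ).prod (𝓡 (2 * n - 1))) 𝓘(ℝ, Cn n) (e ∘ param) (t, x)
        (1 / 2 : ℝ) * ω e (e (param (t, x))) ![D (a, ξ), Complex.I • D (b, ζ)] =
          a * b + t ^ 2 * gL.inner x ξ ζ
  /-- the Calabi–Yau equation `ω^n = c Ω ∧ Ω̄` on `Y ∖ {o}`, that is, `det (g_{j k̄}) = c |h|²` in each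
  chart, with `c > 0` a constant and `Ω = h dz₁ ∧ ⋯ ∧ dzₙ` a nowhere vanishing section of `K_Y` -/
  calabiYau : ∃ (h : OpenPartialHomeomorph Y (Cn n) → Cn n → ℂ) (c : ℝ),
    IsNonvanishingVolumeForm h ∧ 0 < c ∧
    ∀ e : OpenPartialHomeomorph Y (Cn n), IsHolChart e → ∀ y ∈ e.source, y ≠ o →
      (hermMatrix (ω e (e y))).det = ((c * ‖h e (e y)‖ ^ 2 : ℝ) : ℂ)

attribute [instance] CYCone.topY CYCone.t2Y CYCone.spaceY

section Models

variable {X : Type u} [TopologicalSpace X] [ComplexSpace X] {n : ℕ}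

/-- `φ` is a local biholomorphism from a neighbourhood of the apex of `C` onto a neighbourhood of
`p`, taking the apex to `p`. -/
structure IsConeChart (C : CYCone.{v, w} n) (p : X) (φ : OpenPartialHomeomorph C.Y X) : Prop where
  biholomorphism : IsBiholomorphism φ
  apex_mem : C.o ∈ φ.source
  map_apex : φ C.o = p

/-- Near `p`, the form `ω` is exactly the cone metric of `C` in a suitable cone chart. -/
def IsConicalAt (C : CYCone.{v, w} n) (p : X) (ω : FormFamily n X) : Prop :=
  ∃ φ : OpenPartialHomeomorph C.Y X, IsConeChart C p φ ∧
    IsPullbackOn φ (φ.source \ {C.o}) ω C.ω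

end Models

/-! ### Projective varieties -/

/-- The standard representative `Z / Z_i` of a point of `{Z_i ≠ 0} ⊆ ℙᴺ`. -/
def affineRep {N : ℕ} (i : Fin (N + 1)) (P : Projectivization ℂ (Cn (N + 1))) : Cn (N + 1) :=
  (P.rep i)⁻¹ • P.rep

/-- `j` embeds the complex space `X` in `ℙᴺ` as an algebraic variety, with its reduced induced
structure: the image is the zero set of finitely many homogeneous polynomials, and in each standard
affine chart `{Z_i ≠ 0} ≅ {Z ∈ ℂᴺ⁺¹ | Z_i = 1}` the map is a holomorphic embedding. -/
structure IsProjectiveVariety {X : Type u} [TopologicalSpace X] [ComplexSpace X] {N : ℕ}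
    (j : X → Projectivization ℂ (Cn (N + 1))) : Prop where
  algebraic : ∃ (k : ℕ) (d : Fin k → ℕ) (F : Fin k → MvPolynomial (Fin (N + 1)) ℂ),
    (∀ l, (F l).IsHomogeneous (d l)) ∧
    Set.range j = {P | ∀ l, MvPolynomial.eval (fun i => P.rep i) (F l) = 0}
  embedding : ∀ i : Fin (N + 1), IsHolEmbedding {x | (j x).rep i ≠ 0} (fun x => affineRep i (j x))

/-- `ω` is the restriction to `X^reg` of the Fubini–Study form, the form on `ℙᴺ` whose pull-back to
`ℂᴺ⁺¹ ∖ {0}` is `i∂∂̄ log |Z|²`. -/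
def IsFubiniStudyRestriction {X : Type u} [TopologicalSpace X] [ComplexSpace X] {n N : ℕ}
    (j : X → Projectivization ℂ (Cn (N + 1))) (ω : FormFamily n X) : Prop :=
  ∀ i : Fin (N + 1), IsRestrictionOn {x | (j x).rep i ≠ 0} (fun x => affineRep i (j x))
    (ddbar fun Z => Real.log (‖Z‖ ^ 2)) ω

end

end ConicalKahler

open ConicalKahler

-- The proof glues potentials by a regularized maximum near each singular point p. By the local
-- `i∂∂̄`-lemma an ambient Kähler form has a potential ϕ near p. Subtracting the real part of a
-- holomorphic quadratic polynomial makes ϕ vanish at p and be strictly positive at all other nearby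
-- points (`exists_local_potential`). Let m > 0 be a lower bound for ϕ on the annulus δ/2 ≤ r ≤ δ of
-- the cone.
--
-- The competitor is h(r²) + m/4, where h(t) = t near 0 but h grows so slowly that h(r²) ≤ m/4 for 0
-- < r ≤ δ (`exists_slow_potential`). Slowing down makes h concave in places. Strict
-- plurisubharmonicity survives because r has gradient of length one on a Riemannian cone, so that
-- h' > 0 and h' + t h'' > 0 suffice (`CYCone.smooth_and_gradient`, `CYCone.ddbar_comp_r_sq_pos`). A
-- bound like √t is still compatible with these inequalities.
--
-- With k from `exists_regularized_max`, the function ϕ + k(ϕ - h(r²) - m/4) is a smoothed maximum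
-- of the two potentials. On the annulus ϕ wins by a margin, so the correction f = k(...) vanishes
-- there and extends by zero. Near the apex ϕ is close to 0, the competitor wins, and the potential
-- is r² plus a constant, so the new form is exactly the cone metric. In between, its Levi form is a
-- convex combination of two positive ones plus a nonnegative k''-term. Thus ω + i∂∂̄f is Kähler
-- (`exists_local_modification`).
--
-- Only the apex of a cone chart can be singular, so the singular set is discrete in a compact
-- space, hence finite, and the corrections are placed in disjoint neighbourhoods
-- (`exists_conical_metric`).
--
-- For projective varieties it remains to see that the Fubini–Study form is smoothly Kähler. On
-- affine space i∂∂̄ log |Z|² degenerates along the complex line through Z. Adding |Z_i|², which is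
-- constant on the slice Z_i = 1, removes the degeneracy without changing the restriction
-- (`isKahlerAt_fs_ambient`).
--
-- The `i∂∂̄`-lemma itself is built from the Poincaré homotopy formula and the
-- Dolbeault–Grothendieck lemma for (0,1)-forms. The latter rests on the Cauchy–Pompeiu formula.

local notation "∞" => ((⊤ : ℕ∞) : WithTop ℕ∞)

namespace ConicalKahler

/-! ### Calculus of `dᶜ` and `i∂∂̄` on ℂⁿ -/

section DdbarCalculus

variable {n m : ℕ}

lemma two_le_infty : (2 : WithTop ℕ∞) ≤ ∞ := by
  exact WithTop.coe_le_coe.2 (le_top : (2 : ℕ∞) ≤ ⊤)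

lemma minSmoothness_two_le_infty : minSmoothness ℝ 2 ≤ (∞ : WithTop ℕ∞) := by
  simpa using two_le_infty

@[simp] lemma stdJ_apply (v : Cn n) : stdJ n v = Complex.I • v := rfl

/-- The linear map taking `df` to `dᶜ f`. -/
noncomputable def dcCLM (n : ℕ) : (Cn n →L[ℝ] ℝ) →L[ℝ] (Cn n [⋀^Fin 1]→L[ℝ] ℝ) :=
  -(((ContinuousAlternatingMap.ofSubsingletonLIE (𝕜 := ℝ) (E := Cn n) (F := ℝ)
    (0 : Fin 1)).toContinuousLinearEquiv : _ →L[ℝ] _).comp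
      ((ContinuousLinearMap.compL ℝ (Cn n) (Cn n) ℝ).flip (stdJ n)))

lemma dc_eq_dcCLM (f : Cn n → ℝ) (z : Cn n) : dc f z = dcCLM n (fderiv ℝ f z) := by
  ext v
  simp [dc, dcCLM]

lemma dcCLM_apply (L : Cn n →L[ℝ] ℝ) (v : Fin 1 → Cn n) :
    dcCLM n L v = -L (Complex.I • v 0) := by
  simp [dcCLM]

lemma dc_contDiffAt {f : Cn n → ℝ} {z : Cn n} {k l : WithTop ℕ∞} (hf : ContDiffAt ℝ l f z)
    (hkl : k + 1 ≤ l) : ContDiffAt ℝ k (dc f) z := by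
  have : dc f = fun z => dcCLM n (fderiv ℝ f z) := funext (dc_eq_dcCLM f)
  rw [this]
  exact (dcCLM n).contDiff.contDiffAt.comp z (hf.fderiv_right hkl)

lemma extDeriv_one_apply {E : Type*} [NormedAddCommGroup E] [NormedSpace ℝ E]
    (α : E → E [⋀^Fin 1]→L[ℝ] ℝ) (z v w : E) :
    extDeriv α z ![v, w] = fderiv ℝ α z v ![w] - fderiv ℝ α z w ![v] := by
  rw [extDeriv, ContinuousAlternatingMap.alternatizeUncurryFin_apply, Fin.sum_univ_two]
  have h0 : (0 : Fin 2).removeNth ![v, w] = ![w] := by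
    ext i; fin_cases i; rfl
  have h1 : (1 : Fin 2).removeNth ![v, w] = ![v] := by
    ext i; fin_cases i; rfl
  rw [h0, h1]
  simp [sub_eq_add_neg]

lemma fderiv_dc_apply {f : Cn n → ℝ} {z : Cn n} (hf : ContDiffAt ℝ 2 f z) (v : Cn n)
    (w : Fin 1 → Cn n) :
    fderiv ℝ (dc f) z v w = -fderiv ℝ (fderiv ℝ f) z v (Complex.I • w 0) := by
  have h1 : dc f = fun z => dcCLM n (fderiv ℝ f z) := funext (dc_eq_dcCLM f)
  have h2 : DifferentiableAt ℝ (fderiv ℝ f) z :=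
    (hf.fderiv_right (m := 1) (by norm_num)).differentiableAt (by norm_num)
  have h3 : HasFDerivAt (dc f) ((dcCLM n).comp (fderiv ℝ (fderiv ℝ f) z)) z := by
    rw [h1]; exact (dcCLM n).hasFDerivAt.comp z h2.hasFDerivAt
  rw [h3.fderiv, ContinuousLinearMap.comp_apply, dcCLM_apply]

lemma ddbar_apply {f : Cn n → ℝ} {z : Cn n} (hf : ContDiffAt ℝ 2 f z) (v w : Cn n) :
    ddbar f z ![v, w] = (1 / 2 : ℝ) * (fderiv ℝ (fderiv ℝ f) z w (Complex.I • v)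
      - fderiv ℝ (fderiv ℝ f) z v (Complex.I • w)) := by
  rw [ddbar, ContinuousAlternatingMap.smul_apply, extDeriv_one_apply, fderiv_dc_apply hf,
    fderiv_dc_apply hf]
  simp only [Matrix.cons_val_zero, smul_eq_mul]
  ring

lemma I_smul_I_smul (v : Cn n) : Complex.I • Complex.I • v = -v := by
  rw [smul_smul, Complex.I_mul_I, neg_one_smul]

lemma snd_symm {f : Cn n → ℝ} {z : Cn n} (hf : ContDiffAt ℝ 2 f z) (v w : Cn n) :
    fderiv ℝ (fderiv ℝ f) z v w = fderiv ℝ (fderiv ℝ f) z w v :=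
  (hf.isSymmSndFDerivAt (by simp)).eq v w

/-- `i∂∂̄ f (v, Jv)` is half the sum of the second derivatives in the directions `v` and `Jv`. -/
lemma ddbar_apply_I {f : Cn n → ℝ} {z : Cn n} (hf : ContDiffAt ℝ 2 f z) (v : Cn n) :
    ddbar f z ![v, Complex.I • v] = (1 / 2 : ℝ) * (fderiv ℝ (fderiv ℝ f) z v v
      + fderiv ℝ (fderiv ℝ f) z (Complex.I • v) (Complex.I • v)) := by
  rw [ddbar_apply hf, I_smul_I_smul, map_neg]
  ring

lemma ddbar_type {f : Cn n → ℝ} {z : Cn n} (hf : ContDiffAt ℝ 2 f z) (v w : Cn n) :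
    ddbar f z ![Complex.I • v, Complex.I • w] = ddbar f z ![v, w] := by
  rw [ddbar_apply hf, ddbar_apply hf, I_smul_I_smul, I_smul_I_smul, map_neg, map_neg,
    snd_symm hf (Complex.I • w), snd_symm hf (Complex.I • v)]
  ring

lemma ddbar_contDiffAt {f : Cn n → ℝ} {z : Cn n} (hf : ContDiffAt ℝ ∞ f z) :
    ContDiffAt ℝ ∞ (ddbar f) z := by
  have h1 : ContDiffAt ℝ ∞ (fderiv ℝ (dc f)) z :=
    ((dc_contDiffAt (k := ∞) hf (by simp)).fderiv_right (m := ∞) (by simp))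
  have h2 : ddbar f = fun z => (1 / 2 : ℝ) •
      ContinuousAlternatingMap.alternatizeUncurryFinCLM ℝ (Cn n) ℝ (fderiv ℝ (dc f) z) := by
    funext z; simp [ddbar, extDeriv]
  rw [h2]
  have h3 := ((ContinuousAlternatingMap.alternatizeUncurryFinCLM ℝ (Cn n)
    ℝ (n := 1)).contDiff.contDiffAt (n := ∞)).comp z h1
  exact (((1 / 2 : ℝ) • ContinuousLinearMap.id ℝ (TwoCovector n)).contDiff.contDiffAt
    (n := ∞)).comp z h3

lemma extDeriv_ddbar {f : Cn n → ℝ} {z : Cn n} (hf : ContDiffAt ℝ ∞ f z) :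
    extDeriv (ddbar f) z = 0 := by
  have h : ddbar f = (1 / 2 : ℝ) • extDeriv (dc f) := rfl
  rw [h, extDeriv_smul, extDeriv_extDeriv_apply (dc_contDiffAt (k := ∞) hf (by simp))
    minSmoothness_two_le_infty, smul_zero]

lemma ddbar_congr {f g : Cn n → ℝ} {z : Cn n} (h : f =ᶠ[𝓝 z] g) : ddbar f z = ddbar g z := by
  have : dc f =ᶠ[𝓝 z] dc g := by
    filter_upwards [h.fderiv (𝕜 := ℝ)] with y hy
    rw [dc, dc, hy]
  rw [ddbar, ddbar, this.extDeriv_eq]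

lemma ddbar_add {f g : Cn n → ℝ} {z : Cn n} (hf : ContDiffAt ℝ 2 f z) (hg : ContDiffAt ℝ 2 g z) :
    ddbar (fun y => f y + g y) z = ddbar f z + ddbar g z := by
  have h : dc (fun y => f y + g y) =ᶠ[𝓝 z] dc f + dc g := by
    filter_upwards [hf.eventually (by simp), hg.eventually (by simp)] with y hfy hgy
    rw [dc_eq_dcCLM, fderiv_fun_add (hfy.differentiableAt (by norm_num))
      (hgy.differentiableAt (by norm_num)), map_add, Pi.add_apply, dc_eq_dcCLM, dc_eq_dcCLM]
  rw [ddbar, h.extDeriv_eq, extDeriv_add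
    ((dc_contDiffAt (k := 1) hf (by norm_num)).differentiableAt (by norm_num))
    ((dc_contDiffAt (k := 1) hg (by norm_num)).differentiableAt (by norm_num)), smul_add]
  rfl

lemma ddbar_const_mul {f : Cn n → ℝ} (c : ℝ) {z : Cn n} (hf : ContDiffAt ℝ 2 f z) :
    ddbar (fun y => c * f y) z = c • ddbar f z := by
  have h : dc (fun y => c * f y) =ᶠ[𝓝 z] c • dc f := by
    filter_upwards [hf.eventually (by simp)] with y hfy
    rw [dc_eq_dcCLM, fderiv_const_mul (hfy.differentiableAt (by norm_num)), map_smul,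
      Pi.smul_apply, dc_eq_dcCLM]
  rw [ddbar, h.extDeriv_eq, extDeriv_smul, smul_comm]
  rfl

lemma ddbar_neg {f : Cn n → ℝ} {z : Cn n} (hf : ContDiffAt ℝ 2 f z) :
    ddbar (fun y => -f y) z = -ddbar f z := by
  have := ddbar_const_mul (-1) hf
  simp only [neg_mul, one_mul] at this
  rw [this]
  ext v
  simp

lemma ddbar_sub {f g : Cn n → ℝ} {z : Cn n} (hf : ContDiffAt ℝ 2 f z) (hg : ContDiffAt ℝ 2 g z) :
    ddbar (fun y => f y - g y) z = ddbar f z - ddbar g z := by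
  simp only [sub_eq_add_neg]
  rw [ddbar_add hf hg.neg, ddbar_neg hg]

lemma ddbar_const (c : ℝ) (z : Cn n) : ddbar (fun _ => c) z = 0 := by
  have h0 := ddbar_const_mul (f := fun _ : Cn n => (0 : ℝ)) (z := z) 0 contDiffAt_const
  have hc : dc (fun _ : Cn n => c) = dc (fun _ => (0 : ℝ)) := by
    funext y; rw [dc_eq_dcCLM, dc_eq_dcCLM]; simp
  rw [zero_smul] at h0
  simp only [mul_zero] at h0
  rw [ddbar, hc]
  exact h0

lemma extDeriv_two_covector_add {α β : Cn n → TwoCovector n} {z : Cn n}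
    (hα : ContDiffAt ℝ ∞ α z) (hβ : ContDiffAt ℝ ∞ β z) :
    extDeriv (fun y => α y + β y) z = extDeriv α z + extDeriv β z :=
  extDeriv_fun_add (hα.differentiableAt (by simp)) (hβ.differentiableAt (by simp))

/-! Holomorphic maps. -/

lemma fderiv_real_I_smul {F : Cn n → Cn m} {z : Cn n} (hF : DifferentiableAt ℂ F z) (v : Cn n) :
    fderiv ℝ F z (Complex.I • v) = Complex.I • fderiv ℝ F z v := by
  rw [hF.fderiv_restrictScalars ℝ]
  simp

lemma analyticAt_contDiffAt_real {E F : Type*} [NormedAddCommGroup E] [NormedSpace ℂ E]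
    [NormedAddCommGroup F] [NormedSpace ℂ F] [CompleteSpace F] {f : E → F} {z : E}
    (hf : AnalyticAt ℂ f z) : ContDiffAt ℝ ∞ f z :=
  (hf.contDiffAt (n := ∞)).restrict_scalars ℝ

/-- `i∂∂̄` commutes with pull-back by holomorphic maps. -/
lemma ddbar_comp_holomorphic {φ : Cn m → ℝ} {F : Cn n → Cn m} {z : Cn n} (hF : AnalyticAt ℂ F z)
    (hφ : ContDiffAt ℝ 2 φ (F z)) :
    ddbar (φ ∘ F) z = (ddbar φ (F z)).compContinuousLinearMap (fderiv ℝ F z) := by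
  have hFc : ContDiffAt ℝ ∞ F z := analyticAt_contDiffAt_real hF
  have h : dc (φ ∘ F) =ᶠ[𝓝 z]
      fun y => (dc φ (F y)).compContinuousLinearMap (fderiv ℝ F y) := by
    filter_upwards [hF.eventually_analyticAt,
      hF.continuousAt.eventually (hφ.eventually (by simp))] with y hy hφy
    have hFy : DifferentiableAt ℝ F y := hy.differentiableAt.restrictScalars ℝ
    ext v
    rw [dc_eq_dcCLM, dcCLM_apply, ContinuousAlternatingMap.compContinuousLinearMap_apply,
      dc_eq_dcCLM, dcCLM_apply, fderiv_comp y (hφy.differentiableAt (by norm_num)) hFy,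
      ContinuousLinearMap.comp_apply, fderiv_real_I_smul hy.differentiableAt]
    rfl
  rw [ddbar, h.extDeriv_eq, extDeriv_pullback
    ((dc_contDiffAt (k := 1) hφ (by norm_num)).differentiableAt (by norm_num)) hFc
    minSmoothness_two_le_infty]
  rfl

/-- The real part of a holomorphic function is pluriharmonic. -/
lemma ddbar_re_of_analyticAt {F : Cn n → ℂ} {z : Cn n} (hF : AnalyticAt ℂ F z) :
    ddbar (fun y => (F y).re) z = 0 := by
  have hFc : ContDiffAt ℝ ∞ F z := analyticAt_contDiffAt_real hF
  have him : ContDiffAt ℝ ∞ (fun y => (F y).im) z :=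
    Complex.imCLM.contDiff.contDiffAt.comp z hFc
  -- The Cauchy–Riemann equations say dᶜ(Re F) = d(Im F), so that d dᶜ(Re F) = 0 follows from d² =
  -- 0.
  have h : dc (fun y => (F y).re) =ᶠ[𝓝 z]
      extDeriv (fun y => ContinuousAlternatingMap.constOfIsEmpty ℝ (Cn n) (Fin 0) (F y).im) := by
    filter_upwards [hF.eventually_analyticAt] with y hy
    have hFy : HasFDerivAt F (fderiv ℝ F y) y :=
      (hy.differentiableAt.restrictScalars ℝ).hasFDerivAt
    have hre : fderiv ℝ (fun y => (F y).re) y = Complex.reCLM.comp (fderiv ℝ F y) :=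
      (Complex.reCLM.hasFDerivAt.comp y hFy).fderiv
    have himd : fderiv ℝ (fun y => (F y).im) y = Complex.imCLM.comp (fderiv ℝ F y) :=
      (Complex.imCLM.hasFDerivAt.comp y hFy).fderiv
    rw [extDeriv_constOfIsEmpty, himd, dc_eq_dcCLM, hre]
    ext v
    rw [dcCLM_apply]
    simp [hy.differentiableAt.fderiv_restrictScalars ℝ]
  rw [ddbar, h.extDeriv_eq, extDeriv_extDeriv_apply (r := ∞) _ minSmoothness_two_le_infty, smul_zero]
  exact (ContinuousAlternatingMap.constOfIsEmptyLIE ℝ (Cn n) ℝ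
    (Fin 0)).toContinuousLinearEquiv.contDiff.contDiffAt.comp z him

/-- Second derivative of a composition with a function of one real variable. -/
lemma fderiv_fderiv_comp_real {u : Cn n → ℝ} {h : ℝ → ℝ} {z : Cn n}
    (hu : ContDiffAt ℝ 2 u z) (hh : ContDiffAt ℝ 2 h (u z)) (v : Cn n) :
    fderiv ℝ (fderiv ℝ (fun y => h (u y))) z v v =
      deriv h (u z) * fderiv ℝ (fderiv ℝ u) z v v
        + deriv (deriv h) (u z) * (fderiv ℝ u z v) ^ 2 := by
  have h1 : fderiv ℝ (fun y => h (u y)) =ᶠ[𝓝 z] fun y => deriv h (u y) • fderiv ℝ u y := by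
    filter_upwards [hu.eventually (by simp),
      hu.continuousAt.eventually (hh.eventually (by simp))] with y huy hhy
    exact ((hhy.differentiableAt (by norm_num)).hasDerivAt.comp_hasFDerivAt y
      (huy.differentiableAt (by norm_num)).hasFDerivAt).fderiv
  have hd : HasDerivAt (deriv h) (deriv (deriv h) (u z)) (u z) := by
    have : ContDiffAt ℝ 1 (deriv h) (u z) := by
      have := (hh.fderiv_right (m := 1) (by norm_num)).clm_apply
        (contDiffAt_const (c := (1 : ℝ)))
      exact this
    exact (this.differentiableAt (by norm_num)).hasDerivAt
  have hu' : HasFDerivAt u (fderiv ℝ u z) z := (hu.differentiableAt (by norm_num)).hasFDerivAt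
  have hu'' : HasFDerivAt (fderiv ℝ u) (fderiv ℝ (fderiv ℝ u) z) z :=
    ((hu.fderiv_right (m := 1) (by norm_num)).differentiableAt (by norm_num)).hasFDerivAt
  rw [h1.fderiv_eq]
  have := (hd.comp_hasFDerivAt z hu').smul hu''
  have h3 : HasFDerivAt (fun y => deriv h (u y) • fderiv ℝ u y) _ z := this
  rw [h3.fderiv]
  simp
  ring

/-- The chain rule i∂∂̄ h(u) = h'(u) i∂∂̄u + h''(u) i∂u ∧ ∂̄u, evaluated only on pairs (v, Jv),
since positivity of a (1,1)-form is tested there. The h''-term then carries a sum of two squares. -/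
lemma ddbar_comp_real_apply_I {u : Cn n → ℝ} {h : ℝ → ℝ} {z : Cn n}
    (hu : ContDiffAt ℝ 2 u z) (hh : ContDiffAt ℝ 2 h (u z)) (v : Cn n) :
    ddbar (fun y => h (u y)) z ![v, Complex.I • v] =
      deriv h (u z) * ddbar u z ![v, Complex.I • v] + (1 / 2 : ℝ) * deriv (deriv h) (u z) *
        ((fderiv ℝ u z v) ^ 2 + (fderiv ℝ u z (Complex.I • v)) ^ 2) := by
  have hc : ContDiffAt ℝ 2 (fun y => h (u y)) z := hh.comp z hu
  rw [ddbar_apply_I hc, ddbar_apply_I hu,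
    fderiv_fderiv_comp_real hu hh, fderiv_fderiv_comp_real hu hh]
  ring

end DdbarCalculus

end ConicalKahler

namespace ConicalKahler

/-! ### The Cauchy kernel and the Cauchy–Pompeiu formula in one variable -/

section CauchyTransform

open MeasureTheory Set

/-- In polar coordinates the Jacobian r cancels |ζ|⁻¹, leaving the area of a bounded rectangle. -/
lemma locallyIntegrable_inv_complex : LocallyIntegrable (fun ζ : ℂ => ζ⁻¹) := by
  rw [locallyIntegrable_iff]
  intro K hK
  obtain ⟨R, hR⟩ := hK.isBounded.subset_closedBall (0 : ℂ)
  refine IntegrableOn.mono_set ?_ hR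
  refine ⟨(measurable_id.inv (G := ℂ)).aestronglyMeasurable, ?_⟩
  rw [hasFiniteIntegral_iff_enorm, ← lintegral_indicator Metric.isClosed_closedBall.measurableSet,
    ← Complex.lintegral_comp_polarCoord_symm]
  refine lt_of_le_of_lt (setLIntegral_mono (g := (Ioc 0 R ×ˢ univ).indicator (fun _ => 1)) ?_ ?_) ?_
  · exact measurable_const.indicator (measurableSet_Ioc.prod MeasurableSet.univ)
  · rintro ⟨r, θ⟩ hp
    rw [polarCoord_target] at hp
    have hr : 0 < r := hp.1
    by_cases hrR : r ≤ R
    · have hmem : Complex.polarCoord.symm (r, θ) ∈ Metric.closedBall (0 : ℂ) R := by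
        simpa [Complex.norm_polarCoord_symm, abs_of_pos hr] using hrR
      rw [indicator_of_mem hmem, indicator_of_mem (by exact ⟨⟨hr, hrR⟩, trivial⟩)]
      rw [← ofReal_norm, norm_inv, Complex.norm_polarCoord_symm, smul_eq_mul,
        ← ENNReal.ofReal_mul hr.le, abs_of_pos hr]
      simp [hr.ne']
    · have hmem : Complex.polarCoord.symm (r, θ) ∉ Metric.closedBall (0 : ℂ) R := by
        simpa [Complex.norm_polarCoord_symm, abs_of_pos hr] using hrR
      rw [indicator_of_notMem hmem]
      simp
  · rw [lintegral_indicator (measurableSet_Ioc.prod MeasurableSet.univ), lintegral_const, one_mul,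
      Measure.restrict_restrict (measurableSet_Ioc.prod MeasurableSet.univ), polarCoord_target,
      Measure.restrict_apply_univ, prod_inter_prod]
    refine (measure_mono (t := Ioc 0 R ×ˢ Ioo (-Real.pi) Real.pi) (by
      rintro ⟨a, b⟩ ⟨h1, h2⟩; exact ⟨h1.1, h2.2⟩)).trans_lt ?_
    rw [Measure.volume_eq_prod, Measure.prod_prod]
    exact ENNReal.mul_lt_top measure_Ioc_lt_top measure_Ioo_lt_top

/-- The Wirtinger derivative `∂/∂z̄` in one variable. -/
noncomputable def dbarOne (w : ℂ → ℂ) (ζ : ℂ) : ℂ :=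
  (1 / 2 : ℂ) * (fderiv ℝ w ζ 1 + Complex.I * fderiv ℝ w ζ Complex.I)

/-- Dividing ∂w/∂z̄ by e^{iθ} turns it into half the radial derivative plus i/2 times the derivative
in the direction i e^{iθ}. Each of these can be integrated exactly in polar coordinates. -/
lemma dbarOne_polar (w : ℂ → ℂ) (ζ : ℂ) (θ : ℝ) :
    dbarOne w ζ * (Real.cos θ + Real.sin θ * Complex.I)⁻¹ =
      (1 / 2 : ℂ) * (fderiv ℝ w ζ (Real.cos θ + Real.sin θ * Complex.I)
        + Complex.I * fderiv ℝ w ζ (-Real.sin θ + Real.cos θ * Complex.I)) := by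
  have h1 : fderiv ℝ w ζ (Real.cos θ + Real.sin θ * Complex.I)
      = Real.cos θ * fderiv ℝ w ζ 1 + Real.sin θ * fderiv ℝ w ζ Complex.I := by
    have : ((Real.cos θ : ℂ) + Real.sin θ * Complex.I)
      = (Real.cos θ) • (1 : ℂ) + (Real.sin θ) • Complex.I := by simp
    rw [this, map_add, map_smul, map_smul]; simp
  have h2 : fderiv ℝ w ζ (-Real.sin θ + Real.cos θ * Complex.I)
      = -Real.sin θ * fderiv ℝ w ζ 1 + Real.cos θ * fderiv ℝ w ζ Complex.I := by
    have : (-(Real.sin θ : ℂ) + Real.cos θ * Complex.I)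
      = (-Real.sin θ) • (1 : ℂ) + (Real.cos θ) • Complex.I := by simp
    rw [this, map_add, map_smul, map_smul]; simp
  have hcs : ((Real.cos θ : ℂ) + Real.sin θ * Complex.I)
      * (Real.cos θ - Real.sin θ * Complex.I) = 1 := by
    have := Complex.cos_sq_add_sin_sq (θ : ℂ)
    push_cast
    linear_combination this - Complex.sin θ ^ 2 * Complex.I_sq
  rw [h1, h2, inv_eq_of_mul_eq_one_right hcs, dbarOne]
  linear_combination (1 / 2 : ℂ) * (-Real.sin θ * fderiv ℝ w ζ Complex.I) * Complex.I_sq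

/-- The unit vector `e^{iθ}`. -/
noncomputable def unitVec (θ : ℝ) : ℂ := Real.cos θ + Real.sin θ * Complex.I

/-- The unit vector `i e^{iθ}`. -/
noncomputable def unitVec' (θ : ℝ) : ℂ := -Real.sin θ + Real.cos θ * Complex.I

lemma hasDerivAt_unitVec (θ : ℝ) : HasDerivAt unitVec (unitVec' θ) θ := by
  have h1 := (Real.hasDerivAt_cos θ).ofReal_comp
  have h2 := ((Real.hasDerivAt_sin θ).ofReal_comp).mul_const Complex.I
  exact (h1.add h2).congr_deriv (by simp [unitVec'])

lemma continuous_unitVec : Continuous unitVec := by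
  unfold unitVec; fun_prop

lemma continuous_unitVec' : Continuous unitVec' := by
  unfold unitVec'; fun_prop

lemma norm_unitVec (θ : ℝ) : ‖unitVec θ‖ = 1 := by
  have : unitVec θ = Complex.exp (θ * Complex.I) := by
    rw [Complex.exp_mul_I, unitVec]; push_cast; rfl
  rw [this, Complex.norm_exp_ofReal_mul_I]

lemma integrableOn_polar_of_continuous {A : ℝ × ℝ → ℂ} (hA : Continuous A) {R : ℝ}
    (hR : ∀ r θ, R < r → A (r, θ) = 0) :
    IntegrableOn A (Ioi 0 ×ˢ Ioo (-Real.pi) Real.pi) := by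
  have h : IntegrableOn A (Icc 0 R ×ˢ Icc (-Real.pi) Real.pi) :=
    hA.continuousOn.integrableOn_compact (isCompact_Icc.prod isCompact_Icc)
  refine h.of_forall_sdiff_eq_zero (measurableSet_Ioi.prod measurableSet_Ioo) ?_
  rintro ⟨r, θ⟩ ⟨⟨h1, h2⟩, h3⟩
  apply hR
  by_contra hlt
  exact h3 ⟨⟨h1.le, not_lt.1 hlt⟩, ⟨h2.1.le, h2.2.le⟩⟩

/-- The Cauchy–Pompeiu formula for compactly supported functions. -/
theorem integral_inv_mul_dbarOne {w : ℂ → ℂ} (hw : ContDiff ℝ 1 w) (hc : HasCompactSupport w) :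
    ∫ ζ, ζ⁻¹ * dbarOne w ζ = -Real.pi * w 0 := by
  obtain ⟨R, hR⟩ := hc.isCompact.isBounded.subset_closedBall (0 : ℂ)
  have hw0 : ∀ ζ, R < ‖ζ‖ → w ζ = 0 := fun ζ hζ => by
    by_contra h
    have := hR (subset_tsupport w h)
    simp at this
    linarith
  have hdw0 : ∀ ζ, R < ‖ζ‖ → fderiv ℝ w ζ = 0 := fun ζ hζ => by
    by_contra h
    have := hR (tsupport_fderiv_subset ℝ (subset_tsupport (fderiv ℝ w) h))
    simp at this
    linarith
  have hdwc : Continuous (fderiv ℝ w) := hw.continuous_fderiv (by norm_num)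
  set A : ℝ × ℝ → ℂ := fun p => fderiv ℝ w (p.1 * unitVec p.2) (unitVec p.2) with hAdef
  set B : ℝ × ℝ → ℂ := fun p => fderiv ℝ w (p.1 * unitVec p.2) (unitVec' p.2) with hBdef
  have hpt : Continuous fun p : ℝ × ℝ => (p.1 : ℂ) * unitVec p.2 :=
    (Complex.continuous_ofReal.comp continuous_fst).mul (continuous_unitVec.comp continuous_snd)
  have hAc : Continuous A := (hdwc.comp hpt).clm_apply (continuous_unitVec.comp continuous_snd)
  have hBc : Continuous B := (hdwc.comp hpt).clm_apply (continuous_unitVec'.comp continuous_snd)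
  have hnorm : ∀ r θ : ℝ, R < r → R < ‖(r : ℂ) * unitVec θ‖ := fun r θ hr => by
    rw [norm_mul, norm_unitVec, mul_one, Complex.norm_real]
    exact hr.trans_le (le_abs_self r)
  have hA0 : ∀ r θ, R < r → A (r, θ) = 0 := fun r θ hr => by
    simp only [hAdef]; rw [hdw0 _ (hnorm r θ hr)]; rfl
  have hB0 : ∀ r θ, R < r → B (r, θ) = 0 := fun r θ hr => by
    simp only [hBdef]; rw [hdw0 _ (hnorm r θ hr)]; rfl
  have hAi := integrableOn_polar_of_continuous hAc hA0
  have hBi := integrableOn_polar_of_continuous hBc hB0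
  have hpi : -Real.pi ≤ Real.pi := by linarith [Real.pi_pos]
  -- The Jacobian absorbs the modulus of ζ⁻¹. A is the radial derivative of w, so it contributes
  -- -w(0) for every angle. B is 1/r times the angular derivative, so it integrates to zero by
  -- periodicity.
  have hmain : ∫ ζ, ζ⁻¹ * dbarOne w ζ =
      ∫ p in Ioi 0 ×ˢ Ioo (-Real.pi) Real.pi, (1 / 2 : ℂ) * (A p + Complex.I * B p) := by
    rw [← Complex.integral_comp_polarCoord_symm, polarCoord_target]
    refine setIntegral_congr_fun (measurableSet_Ioi.prod measurableSet_Ioo) ?_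
    rintro ⟨r, θ⟩ ⟨hr, -⟩
    have hr' : (r : ℂ) ≠ 0 := by exact_mod_cast (show (0 : ℝ) < r from hr).ne'
    have := dbarOne_polar w (r * unitVec θ) θ
    simp only [Complex.polarCoord_symm_apply, Complex.real_smul]
    simp only [hAdef, hBdef]
    unfold unitVec unitVec' at *
    rw [← this, mul_inv]
    field_simp
  have hIA : ∫ p in Ioi 0 ×ˢ Ioo (-Real.pi) Real.pi, A p = -(2 * Real.pi) * w 0 := by
    rw [Measure.volume_eq_prod, ← setIntegral_prod_swap, setIntegral_prod]
    · have : ∀ θ : ℝ, ∫ r in Ioi (0 : ℝ), A (Prod.swap (θ, r)) = 0 - w 0 := by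
        intro θ
        have hder : ∀ r : ℝ, HasDerivAt (fun r : ℝ => w (r * unitVec θ)) (A (r, θ)) r := by
          intro r
          have h1 : HasDerivAt (fun r : ℝ => (r : ℂ) * unitVec θ) (unitVec θ) r := by
            simpa using ((hasDerivAt_id r).ofReal_comp).mul_const (unitVec θ)
          exact (hw.differentiable (by norm_num) _).hasFDerivAt.comp_hasDerivAt r h1
        have h0 : w 0 = (fun r : ℝ => w (r * unitVec θ)) 0 := by simp
        rw [h0]
        refine integral_Ioi_of_hasDerivAt_of_tendsto (hder 0).continuousAt.continuousWithinAt
          (fun r _ => hder r) ?_ ?_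
        · have h : IntegrableOn (fun r => A (r, θ)) (Icc 0 R) :=
            (hAc.comp (by fun_prop : Continuous fun r : ℝ => (r, θ))).continuousOn.integrableOn_compact
              isCompact_Icc
          refine h.of_forall_sdiff_eq_zero measurableSet_Ioi ?_
          rintro r ⟨h1, h3⟩
          apply hA0
          by_contra hlt
          exact h3 ⟨le_of_lt h1, not_lt.1 hlt⟩
        · refine tendsto_const_nhds.congr' ?_
          filter_upwards [Filter.eventually_gt_atTop R] with r hr
          exact (hw0 _ (hnorm r θ hr)).symm
      simp only [this]
      rw [setIntegral_const]
      simp [measureReal_def, Real.volume_Ioo, ENNReal.toReal_ofReal (by linarith [Real.pi_pos] :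
        0 ≤ Real.pi + Real.pi)]
      exact Or.inl (by ring)
    · exact hAi.swap
  have hIB : ∫ p in Ioi 0 ×ˢ Ioo (-Real.pi) Real.pi, B p = 0 := by
    rw [Measure.volume_eq_prod, setIntegral_prod _ hBi]
    refine setIntegral_eq_zero_of_forall_eq_zero ?_
    intro r hr
    have hr' : (r : ℂ) ≠ 0 := by exact_mod_cast (show (0 : ℝ) < r from hr).ne'
    have hder : ∀ θ : ℝ, HasDerivAt (fun θ : ℝ => (r : ℂ)⁻¹ * w (r * unitVec θ)) (B (r, θ)) θ := by
      intro θ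
      have h1 : HasDerivAt (fun θ : ℝ => (r : ℂ) * unitVec θ) (r * unitVec' θ) θ :=
        (hasDerivAt_unitVec θ).const_mul _
      have h2 := ((hw.differentiable (by norm_num) _).hasFDerivAt.comp_hasDerivAt θ h1).const_mul
        (r : ℂ)⁻¹
      refine h2.congr_deriv ?_
      have : (r : ℂ) * unitVec' θ = r • unitVec' θ := by simp
      rw [this, map_smul, Complex.real_smul, inv_mul_cancel_left₀ hr']
    rw [← integral_Ioc_eq_integral_Ioo, ← intervalIntegral.integral_of_le hpi,
      intervalIntegral.integral_eq_sub_of_hasDerivAt (fun θ _ => hder θ)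
        ((hBc.comp (by fun_prop : Continuous fun θ : ℝ => (r, θ))).intervalIntegrable _ _)]
    simp [unitVec]
  rw [hmain, integral_const_mul, integral_add hAi (hBi.const_mul _), integral_const_mul, hIA, hIB]
  ring

end CauchyTransform

end ConicalKahler

namespace ConicalKahler

/-! ### The Dolbeault–Grothendieck lemma for (0,1)-forms -/

section Dolbeault

open MeasureTheory Set

variable {N : ℕ}

/-- The standard basis vectors of `ℂᴺ`. -/
noncomputable abbrev stdVec (j : Fin N) : Cn N := EuclideanSpace.single j (1 : ℂ)

/-- The Wirtinger derivative `∂/∂z̄_j`. -/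
noncomputable def dbar (g : Cn N → ℂ) (j : Fin N) (z : Cn N) : ℂ :=
  (1 / 2 : ℂ) * (fderiv ℝ g z (stdVec j) + Complex.I * fderiv ℝ g z (Complex.I • stdVec j))

/-- The coordinate functions as real linear maps. -/
noncomputable def coordCLM (k : Fin N) : Cn N →L[ℝ] ℂ :=
  (EuclideanSpace.proj k : Cn N →L[ℂ] ℂ).restrictScalars ℝ

@[simp] lemma coordCLM_apply (k : Fin N) (z : Cn N) : coordCLM k z = z k := rfl

/-- The inclusion of the `k`-th coordinate axis. -/
noncomputable def axisCLM (k : Fin N) : ℂ →L[ℝ] Cn N :=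
  (ContinuousLinearMap.toSpanSingleton ℂ (stdVec k)).restrictScalars ℝ

@[simp] lemma axisCLM_apply (k : Fin N) (ζ : ℂ) : axisCLM k ζ = ζ • stdVec k := rfl

/-- Replacing the `k`-th coordinate, as a linear map. -/
noncomputable def replaceCoord (k : Fin N) : Cn N × ℂ →L[ℝ] Cn N :=
  ContinuousLinearMap.fst ℝ (Cn N) ℂ + (axisCLM k).comp
    (ContinuousLinearMap.snd ℝ (Cn N) ℂ - (coordCLM k).comp (ContinuousLinearMap.fst ℝ (Cn N) ℂ))

lemma replaceCoord_apply (k : Fin N) (z : Cn N) (ζ : ℂ) :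
    replaceCoord k (z, ζ) = z + (ζ - z k) • stdVec k := by
  simp [replaceCoord, sub_smul]

lemma replaceCoord_coord (k : Fin N) (z : Cn N) (ζ : ℂ) : replaceCoord k (z, ζ) k = ζ := by
  simp [replaceCoord_apply]

/-- The solution is g(z) = π⁻¹ ∫ ζ⁻¹ U(z - ζ e_k) dζ, a convolution in the k-th coordinate with the
others as parameters. All derivatives fall on the smooth factor U, and bounded support is needed
only in the direction of integration. -/
lemma exists_cauchyTransform (k : Fin N) {U : Cn N → ℂ} (hU : ContDiff ℝ ∞ U) {R : ℝ}
    (hR : ∀ z, R < ‖z k‖ → U z = 0) :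
    ∃ g : Cn N → ℂ, ContDiff ℝ ∞ g ∧ ∀ z v,
      Integrable (fun ζ : ℂ => ((Real.pi : ℂ)⁻¹ * ζ⁻¹) * fderiv ℝ U (z - ζ • stdVec k) v) ∧
      fderiv ℝ g z v = ∫ ζ : ℂ, ((Real.pi : ℂ)⁻¹ * ζ⁻¹) * fderiv ℝ U (z - ζ • stdVec k) v := by
  set f : ℂ → ℂ := fun ζ => (Real.pi : ℂ)⁻¹ * ζ⁻¹ with hf
  have hfi : LocallyIntegrable f := by
    have := locallyIntegrable_inv_complex.smul ((Real.pi : ℂ)⁻¹)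
    exact this
  -- The parameter is the whole vector p, not just its other coordinates. Its k-th entry is
  -- overwritten by x, so this is harmless, and g is recovered by evaluating at (z, z k).
  set G : Cn N → ℂ → ℂ := fun p x => U (replaceCoord k (p, x)) with hG
  have hGc : ContDiff ℝ ∞ ↿G := hU.comp (replaceCoord k).contDiff
  have hG0 : ∀ p x, p ∈ (univ : Set (Cn N)) → x ∉ Metric.closedBall (0 : ℂ) R → G p x = 0 := by
    intro p x _ hx
    apply hR
    rw [replaceCoord_coord]
    simpa using hx
  let L := ContinuousLinearMap.mul ℝ ℂ
  set Q : Cn N × ℂ → ℂ := fun q => (convolution f (G q.1) L volume) q.2 with hQ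
  have hQc : ContDiff ℝ ∞ Q := by
    have := contDiffOn_convolution_right_with_param (n := ⊤) L isOpen_univ
      (isCompact_closedBall (0 : ℂ) R) hG0 hfi hGc.contDiffOn
    rwa [univ_prod_univ, contDiffOn_univ] at this
  let T : Cn N →L[ℝ] Cn N × ℂ := (ContinuousLinearMap.id ℝ (Cn N)).prod (coordCLM k)
  refine ⟨fun z => Q (T z), hQc.comp T.contDiff, ?_⟩
  intro z v
  have hder := hasFDerivAt_convolution_right_with_param (𝕜 := ℝ) L isOpen_univ
    (isCompact_closedBall (0 : ℂ) R) hG0 hfi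
    ((hGc.of_le (by simp)).contDiffOn) (T z) (mem_univ _)
  have hfd : ∀ x w, fderiv ℝ ↿G (z, x) (T w) = fderiv ℝ U (replaceCoord k (z, x)) w := by
    intro x w
    have h1 : HasFDerivAt ↿G ((fderiv ℝ U (replaceCoord k (z, x))).comp (replaceCoord k)) (z, x) :=
      (hU.differentiable (by simp) _).hasFDerivAt.comp (z, x) (replaceCoord k).hasFDerivAt
    rw [h1.fderiv, ContinuousLinearMap.comp_apply]
    congr 1
    change replaceCoord k (w, w k) = w
    rw [replaceCoord_apply]; simp
  have hcs : HasCompactSupport (fun x : ℂ => fderiv ℝ ↿G (z, x)) := by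
    refine HasCompactSupport.intro (isCompact_closedBall (0 : ℂ) R) ?_
    intro x hx
    have : ↿G =ᶠ[𝓝 (z, x)] fun _ => 0 := by
      have hopen : IsOpen {q : Cn N × ℂ | q.2 ∉ Metric.closedBall (0 : ℂ) R} :=
        Metric.isClosed_closedBall.isOpen_compl.preimage continuous_snd
      filter_upwards [hopen.mem_nhds hx] with q hq
      exact hG0 q.1 q.2 (mem_univ _) hq
    rw [this.fderiv_eq]; simp
  have hcont : Continuous (fun x : ℂ => fderiv ℝ ↿G (z, x)) :=
    (hGc.continuous_fderiv (by simp)).comp (by fun_prop)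
  have hconv := hcs.convolutionExists_right (L.precompR (Cn N × ℂ)) hfi hcont (z k)
  have hpt : ∀ ζ : ℂ, ((L.precompR (Cn N × ℂ)) (f ζ) (fderiv ℝ ↿G (z, z k - ζ))) (T v) =
      f ζ * fderiv ℝ U (z - ζ • stdVec k) v := by
    intro ζ
    rw [ContinuousLinearMap.precompR_apply]
    simp only [ContinuousLinearMap.compL_apply, ContinuousLinearMap.comp_apply]
    rw [hfd, replaceCoord_apply]
    simp only [L, ContinuousLinearMap.mul_apply']
    congr 3
    rw [sub_sub_cancel_left, neg_smul, sub_eq_add_neg]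
  constructor
  · have := (ContinuousLinearMap.apply ℝ ℂ (T v)).integrable_comp hconv
    refine this.congr (Filter.Eventually.of_forall fun ζ => ?_)
    exact hpt ζ
  · have h2 : HasFDerivAt (fun z => Q (T z)) _ z := hder.comp z T.hasFDerivAt
    rw [h2.fderiv, ContinuousLinearMap.comp_apply, convolution_def]
    have := ContinuousLinearMap.integral_apply hconv (T v)
    refine this.trans ?_
    exact integral_congr_ae (Filter.Eventually.of_forall hpt)

/-- ∂/∂z̄_j passes under the integral. For j = k the Cauchy–Pompeiu formula on the slice ξ ↦ U(z - ξ
e_k) returns U(z). For any j the result is zero if ∂U/∂z̄_j vanishes on the entire complex line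
through z along which one integrates. -/
lemma dbar_cauchyTransform (k : Fin N) {U : Cn N → ℂ} (hU : ContDiff ℝ ∞ U) {R : ℝ}
    (hR : ∀ z, R < ‖z k‖ → U z = 0) :
    ∃ g : Cn N → ℂ, ContDiff ℝ ∞ g ∧ (∀ z, dbar g k z = U z) ∧
      ∀ z j, (∀ ζ : ℂ, dbar U j (z - ζ • stdVec k) = 0) → dbar g j z = 0 := by
  obtain ⟨g, hg, hfd⟩ := exists_cauchyTransform k hU hR
  have key : ∀ z j, dbar g j z =
      ∫ ζ : ℂ, ((Real.pi : ℂ)⁻¹ * ζ⁻¹) * dbar U j (z - ζ • stdVec k) := by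
    intro z j
    obtain ⟨i1, e1⟩ := hfd z (stdVec j)
    obtain ⟨i2, e2⟩ := hfd z (Complex.I • stdVec j)
    rw [dbar, e1, e2, ← integral_const_mul, ← integral_add i1 (i2.const_mul _),
      ← integral_const_mul]
    congr 1
    ext ζ
    rw [dbar]
    ring
  refine ⟨g, hg, ?_, ?_⟩
  · intro z
    set w : ℂ → ℂ := fun ξ => U (z - ξ • stdVec k) with hw
    have hwd : ContDiff ℝ ∞ w := hU.comp (contDiff_const.sub (axisCLM k).contDiff)
    have hwc : HasCompactSupport w := by
      refine HasCompactSupport.intro (isCompact_closedBall (0 : ℂ) (‖z k‖ + R)) ?_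
      intro ξ hξ
      apply hR
      simp only [Metric.mem_closedBall, dist_zero_right, not_le] at hξ
      have : (z - ξ • stdVec k) k = z k - ξ := by simp
      rw [this]
      have := norm_sub_norm_le ξ (z k)
      rw [norm_sub_rev] at this
      linarith
    have hdb : ∀ ζ, dbar U k (z - ζ • stdVec k) = -dbarOne w ζ := by
      intro ζ
      have h1 : HasFDerivAt w ((fderiv ℝ U (z - ζ • stdVec k)).comp (-(axisCLM k))) ζ := by
        refine (hU.differentiable (by simp) _).hasFDerivAt.comp ζ ?_
        exact (axisCLM k).hasFDerivAt.const_sub z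
      rw [dbar, dbarOne, h1.fderiv]
      simp
      ring
    rw [key]
    have h3 := integral_inv_mul_dbarOne (hwd.of_le (by simp)) hwc
    have h4 : ∫ ζ : ℂ, ((Real.pi : ℂ)⁻¹ * ζ⁻¹) * dbar U k (z - ζ • stdVec k) =
        ∫ ζ : ℂ, -(Real.pi : ℂ)⁻¹ * (ζ⁻¹ * dbarOne w ζ) := by
      congr 1
      ext ζ
      rw [hdb]; ring
    rw [h4, integral_const_mul, h3]
    have : (Real.pi : ℂ) ≠ 0 := by exact_mod_cast Real.pi_ne_zero
    simp only [hw, zero_smul, sub_zero]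
    field_simp
  · intro z j h
    rw [key]
    simp [h]

lemma dbar_congr {g g' : Cn N → ℂ} {z : Cn N} (h : g =ᶠ[𝓝 z] g') (j : Fin N) :
    dbar g j z = dbar g' j z := by
  rw [dbar, dbar, h.fderiv_eq]

lemma dbar_add {g g' : Cn N → ℂ} {z : Cn N} (h : DifferentiableAt ℝ g z)
    (h' : DifferentiableAt ℝ g' z) (j : Fin N) :
    dbar (fun y => g y + g' y) j z = dbar g j z + dbar g' j z := by
  simp only [dbar, fderiv_fun_add h h', add_apply]
  ring

lemma dbar_sub {g g' : Cn N → ℂ} {z : Cn N} (h : DifferentiableAt ℝ g z)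
    (h' : DifferentiableAt ℝ g' z) (j : Fin N) :
    dbar (fun y => g y - g' y) j z = dbar g j z - dbar g' j z := by
  simp only [dbar, fderiv_fun_sub h h', sub_apply]
  ring

lemma contDiff_dbar {g : Cn N → ℂ} (hg : ContDiff ℝ ∞ g) (j : Fin N) :
    ContDiff ℝ ∞ (dbar g j) := by
  have h : ContDiff ℝ ∞ (fderiv ℝ g) := hg.fderiv_right (by simp)
  unfold dbar
  fun_prop

lemma fderiv_dbar {g : Cn N → ℂ} (hg : ContDiff ℝ ∞ g) (j : Fin N) (z v : Cn N) :
    fderiv ℝ (dbar g j) z v = (1 / 2 : ℂ) * (fderiv ℝ (fderiv ℝ g) z v (stdVec j)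
      + Complex.I * fderiv ℝ (fderiv ℝ g) z v (Complex.I • stdVec j)) := by
  have h : HasFDerivAt (fderiv ℝ g) (fderiv ℝ (fderiv ℝ g) z) z :=
    ((hg.fderiv_right (m := ∞) (by simp)).differentiable (by simp) z).hasFDerivAt
  have h1 := h.clm_apply (hasFDerivAt_const (stdVec j) z)
  have h2 := h.clm_apply (hasFDerivAt_const (Complex.I • stdVec j) z)
  have h3 : HasFDerivAt (dbar g j) _ z := ((h1.add (h2.const_mul Complex.I)).const_mul (1 / 2 : ℂ))
  rw [h3.fderiv]
  simp
  ring

lemma dbar_comm {g : Cn N → ℂ} (hg : ContDiff ℝ ∞ g) (i j : Fin N) (z : Cn N) :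
    dbar (dbar g j) i z = dbar (dbar g i) j z := by
  have hs : ∀ v w, fderiv ℝ (fderiv ℝ g) z v w = fderiv ℝ (fderiv ℝ g) z w v :=
    fun v w => ((hg.contDiffAt (x := z)).isSymmSndFDerivAt minSmoothness_two_le_infty).eq v w
  rw [dbar, dbar, fderiv_dbar hg, fderiv_dbar hg, fderiv_dbar hg, fderiv_dbar hg,
    hs (stdVec i) (stdVec j), hs (stdVec i) (Complex.I • stdVec j),
    hs (Complex.I • stdVec i) (stdVec j), hs (Complex.I • stdVec i) (Complex.I • stdVec j)]
  ring

/-- Solving `∂g/∂z̄_k = u` near the origin, keeping holomorphy in other variables. -/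
lemma exists_dbar_solution_coord (k : Fin N) (T : Set (Fin N)) (hk : k ∉ T) {u : Cn N → ℂ}
    (hu : ContDiff ℝ ∞ u) (h : ∀ᶠ z in 𝓝 (0 : Cn N), ∀ j ∈ T, dbar u j z = 0) :
    ∃ g : Cn N → ℂ, ContDiff ℝ ∞ g ∧ (∀ᶠ z in 𝓝 (0 : Cn N), dbar g k z = u z) ∧
      ∀ᶠ z in 𝓝 (0 : Cn N), ∀ j ∈ T, dbar g j z = 0 := by
  obtain ⟨ε, hε, hball⟩ := Metric.eventually_nhds_iff.1 h
  -- The cutoff depends on z_k alone, so it preserves holomorphy of u in the variables of T. If ‖z‖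
  -- < ε/4, a point y of the k-line through z with |y_k| ≤ ε/2 has norm below ε/4 + ε/2 + ε/4 = ε,
  -- where the hypothesis on u applies. On the rest of the line the cutoff vanishes.
  let χ : ContDiffBump (0 : ℂ) := ⟨ε / 4, ε / 2, by linarith, by linarith⟩
  set U : Cn N → ℂ := fun z => ((χ (z k) : ℝ) : ℂ) * u z with hUdef
  have hχ : ContDiff ℝ ∞ fun z : Cn N => ((χ (z k) : ℝ) : ℂ) :=
    Complex.ofRealCLM.contDiff.comp (χ.contDiff.comp (coordCLM k).contDiff)
  have hU : ContDiff ℝ ∞ U := hχ.mul hu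
  have hχ0 : ∀ x : ℂ, ε / 2 < ‖x‖ → χ x = 0 := fun x hx =>
    χ.zero_of_le_dist (by simpa using hx.le)
  obtain ⟨g, hg, hgk, hgj⟩ := dbar_cauchyTransform k hU (R := ε / 2) fun z hz => by
    simp [hUdef, hχ0 _ hz]
  have hev : ∀ᶠ z in 𝓝 (0 : Cn N), ‖z‖ < ε / 4 := by
    have := Metric.ball_mem_nhds (0 : Cn N) (by linarith : 0 < ε / 4)
    filter_upwards [this] with z hz
    simpa using hz
  refine ⟨g, hg, ?_, ?_⟩
  · filter_upwards [hev] with z hz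
    rw [hgk, hUdef]
    have : χ (z k) = 1 := χ.one_of_mem_closedBall (by
      simpa [χ] using (PiLp.norm_apply_le z k).trans hz.le)
    simp [this]
  · filter_upwards [hev] with z hz j hj
    apply hgj
    intro ζ
    set y := z - ζ • stdVec k with hy
    have hjk : k ≠ j := fun h => hk (h ▸ hj)
    have hd : ∀ v : Cn N, v k = 0 → fderiv ℝ U y v = (χ (y k) : ℝ) * fderiv ℝ u y v := by
      intro v hv
      have h1 : HasFDerivAt (fun z : Cn N => ((χ (z k) : ℝ) : ℂ))
          (Complex.ofRealCLM.comp ((fderiv ℝ χ (y k)).comp (coordCLM k))) y :=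
        Complex.ofRealCLM.hasFDerivAt.comp y
          (((χ.contDiff (n := ⊤)).differentiable (by simp) _).hasFDerivAt.comp y
            (coordCLM k).hasFDerivAt)
      have h2 : HasFDerivAt U _ y := h1.mul (hu.differentiable (by simp) y).hasFDerivAt
      rw [h2.fderiv]
      simp [hv]
    have hdb : dbar U j y = (χ (y k) : ℝ) * dbar u j y := by
      rw [dbar, dbar, hd _ (by simp [hjk]), hd _ (by simp [hjk])]
      ring
    rw [hdb]
    by_cases hyk : ‖y k‖ ≤ ε / 2
    · rw [hball _ j hj, mul_zero]
      have e1 : y = z + (y k - z k) • stdVec k := by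
        rw [hy]; simp [sub_eq_add_neg]
      have e2 : ‖z k‖ ≤ ‖z‖ := PiLp.norm_apply_le z k
      rw [dist_zero_right, e1]
      calc ‖z + (y k - z k) • stdVec k‖ ≤ ‖z‖ + ‖(y k - z k) • stdVec k‖ := norm_add_le _ _
        _ = ‖z‖ + ‖y k - z k‖ := by rw [norm_smul]; simp
        _ ≤ ‖z‖ + (‖y k‖ + ‖z k‖) := by gcongr; exact norm_sub_le _ _
        _ < ε := by linarith
    · rw [hχ0 _ (not_le.1 hyk)]; simp

/-- The Dolbeault–Grothendieck lemma for `(0,1)`-forms, near the origin. -/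
theorem exists_dbar_solution (β : Fin N → Cn N → ℂ) (hβ : ∀ j, ContDiff ℝ ∞ (β j))
    (hclosed : ∀ᶠ z in 𝓝 (0 : Cn N), ∀ i j, dbar (β j) i z = dbar (β i) j z) :
    ∃ g : Cn N → ℂ, ContDiff ℝ ∞ g ∧ ∀ᶠ z in 𝓝 (0 : Cn N), ∀ j, dbar g j z = β j z := by
  -- Induction on the set s of indices j for which β_j may be nonzero. When k is added, closedness
  -- makes β_k holomorphic in the variables outside `insert k s`. The solution g₀ of ∂g₀/∂z̄_k = β_k
  -- keeps this, so β - ∂̄g₀ is supported on the indices in s.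
  have main : ∀ s : Finset (Fin N), ∀ β : Fin N → Cn N → ℂ, (∀ j, ContDiff ℝ ∞ (β j)) →
      (∀ᶠ z in 𝓝 (0 : Cn N), ∀ i j, dbar (β j) i z = dbar (β i) j z) →
      (∀ᶠ z in 𝓝 (0 : Cn N), ∀ j ∉ s, β j z = 0) →
      ∃ g : Cn N → ℂ, ContDiff ℝ ∞ g ∧ ∀ᶠ z in 𝓝 (0 : Cn N), ∀ j, dbar g j z = β j z := by
    intro s
    induction s using Finset.induction_on with
    | empty =>
      intro β _ _ h0
      refine ⟨fun _ => 0, contDiff_const, ?_⟩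
      filter_upwards [h0] with z hz j
      rw [hz j (by simp)]
      simp [dbar]
    | insert k s hks ih =>
      intro β hβ hcl h0
      obtain ⟨g₀, hg₀, hg₀k, hg₀j⟩ := exists_dbar_solution_coord k {j | j ∉ insert k s}
        (by simp) (hβ k) (by
          filter_upwards [hcl, h0.eventually_nhds] with z hz hz0 j hj
          rw [hz j k]
          have : β j =ᶠ[𝓝 z] fun _ => 0 := by
            filter_upwards [hz0] with y hy using hy j hj
          rw [dbar_congr this]
          simp [dbar])
      obtain ⟨g₁, hg₁, hg₁e⟩ := ih (fun j z => β j z - dbar g₀ j z)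
        (fun j => (hβ j).sub (contDiff_dbar hg₀ j)) (by
          filter_upwards [hcl] with z hz i j
          rw [dbar_sub ((hβ j).differentiable (by simp) z)
              ((contDiff_dbar hg₀ j).differentiable (by simp) z),
            dbar_sub ((hβ i).differentiable (by simp) z)
              ((contDiff_dbar hg₀ i).differentiable (by simp) z), hz i j, dbar_comm hg₀]) (by
          filter_upwards [h0, hg₀k, hg₀j] with z h1 h2 h3 j hj
          by_cases hjk : j = k
          · rw [hjk, h2, sub_self]
          · rw [h1 j (by simp [hjk, hj]), h3 j (by simp [hjk, hj]), sub_zero])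
      refine ⟨fun z => g₀ z + g₁ z, hg₀.add hg₁, ?_⟩
      filter_upwards [hg₁e] with z hz j
      rw [dbar_add (hg₀.differentiable (by simp) z) (hg₁.differentiable (by simp) z), hz j]
      ring
  exact main Finset.univ β hβ hclosed (by simp)

end Dolbeault
end ConicalKahler

set_option maxSynthPendingDepth 3

namespace ConicalKahler

/-! ### The Poincaré lemma for 2-forms -/

section Poincare

open MeasureTheory Set

/-- The integral is the value at 1 of the convolution of the indicator of [0,1] with s ↦ F x s, cut
off outside a compact set. Smoothness in x is then that of a convolution with parameters. -/
lemma contDiff_intervalIntegral_param {E W : Type*} [NormedAddCommGroup E] [NormedSpace ℝ E]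
    [NormedAddCommGroup W] [NormedSpace ℝ W] {F : E → ℝ → W} (hF : ContDiff ℝ ∞ ↿F) :
    ContDiff ℝ ∞ (fun x => ∫ t in (0 : ℝ)..1, F x t) := by
  let χ : ContDiffBump (0 : ℝ) := ⟨1, 2, by norm_num, by norm_num⟩
  let f : ℝ → ℝ := (Icc (0 : ℝ) 1).indicator fun _ => 1
  have hf : LocallyIntegrable f :=
    ((integrable_indicator_iff measurableSet_Icc).2
      (integrableOn_const (by simp))).locallyIntegrable
  let g : E → ℝ → W := fun x s => χ s • F x s
  have hg : ContDiff ℝ ∞ ↿g := (χ.contDiff.comp contDiff_snd).smul hF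
  have hg0 : ∀ p s, p ∈ (univ : Set E) → s ∉ Metric.closedBall (0 : ℝ) 2 → g p s = 0 := by
    intro p s _ hs
    have : χ s = 0 := χ.zero_of_le_dist (by
      simp only [Metric.mem_closedBall, not_le] at hs
      exact hs.le)
    simp [g, this]
  have h := contDiffOn_convolution_right_with_param (μ := volume) (n := ⊤)
    (ContinuousLinearMap.lsmul ℝ ℝ) isOpen_univ
    (isCompact_closedBall (0 : ℝ) 2) hg0 hf hg.contDiffOn
  rw [univ_prod_univ, contDiffOn_univ] at h
  have h2 : ContDiff ℝ ∞ (fun x : E => (x, (1 : ℝ))) := by fun_prop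
  convert h.comp h2 using 1
  funext x
  have h3 : ∀ t ∈ Icc (0 : ℝ) 1, g x (1 - t) = F x (1 - t) := fun t ht => by
    have : χ (1 - t) = 1 := χ.one_of_mem_closedBall (by
      simp only [χ, Metric.mem_closedBall, dist_zero_right, Real.norm_eq_abs, abs_le]
      constructor <;> linarith [ht.1, ht.2])
    simp [g, this]
  have h4 : (convolution f (g x) (ContinuousLinearMap.lsmul ℝ ℝ) volume) 1 =
      ∫ t in Icc (0 : ℝ) 1, F x (1 - t) := by
    rw [convolution_def, ← integral_indicator measurableSet_Icc]
    congr 1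
    ext t
    by_cases ht : t ∈ Icc (0 : ℝ) 1
    · simp [f, ht, h3 t ht]
    · simp [f, ht]
  simp only [Function.comp_apply]
  rw [h4, integral_Icc_eq_integral_Ioc, ← intervalIntegral.integral_of_le zero_le_one,
    intervalIntegral.integral_comp_sub_left (fun t => F x t)]
  simp

/-- The dominating constant is a bound for the continuous F' on a closed unit ball times [0,1],
which is compact because E is finite-dimensional. -/
lemma hasFDerivAt_intervalIntegral_param {E W : Type*} [NormedAddCommGroup E] [NormedSpace ℝ E]
    [FiniteDimensional ℝ E] [NormedAddCommGroup W] [NormedSpace ℝ W]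
    {F : E → ℝ → W} (hF : ContDiff ℝ ∞ ↿F) {F' : E → ℝ → E →L[ℝ] W}
    (hFderiv : ∀ x t, HasFDerivAt (fun y => F y t) (F' x t) x) (hFderivc : Continuous ↿F') (x : E) :
    HasFDerivAt (fun x => ∫ t in (0 : ℝ)..1, F x t) (∫ t in (0 : ℝ)..1, F' x t) x := by
  have hc : IsCompact (Metric.closedBall x 1 ×ˢ Icc (0 : ℝ) 1) :=
    (isCompact_closedBall x 1).prod isCompact_Icc
  obtain ⟨M, hM⟩ := hc.exists_bound_of_continuousOn hFderivc.continuousOn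
  refine intervalIntegral.hasFDerivAt_integral_of_dominated_of_fderiv_le (𝕜 := ℝ)
    (bound := fun _ => M) (Metric.closedBall_mem_nhds x zero_lt_one) ?_ ?_ ?_ ?_ ?_ ?_
  · refine Filter.Eventually.of_forall fun y => Continuous.aestronglyMeasurable ?_
    exact hF.continuous.comp (by fun_prop : Continuous fun t : ℝ => (y, t))
  · exact Continuous.intervalIntegrable
      (hF.continuous.comp (by fun_prop : Continuous fun t : ℝ => (x, t))) _ _
  · exact (hFderivc.comp (by fun_prop : Continuous fun t : ℝ => (x, t))).aestronglyMeasurable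
  · refine Filter.Eventually.of_forall fun t ht y hy => ?_
    rw [uIoc_of_le zero_le_one] at ht
    exact hM (y, t) ⟨hy, ht.1.le, ht.2⟩
  · exact intervalIntegrable_const
  · exact Filter.Eventually.of_forall fun t _ y _ => hFderiv y t

/-- Poincaré's lemma for `2`-forms, near the origin. -/
lemma exists_primitive_two_form {E : Type*} [NormedAddCommGroup E] [NormedSpace ℝ E]
    [FiniteDimensional ℝ E] {B : E → E →L[ℝ] E →L[ℝ] ℝ} (hB : ContDiff ℝ ∞ B)
    (halt : ∀ z v w, B z v w = -B z w v) {ρ : ℝ}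
    (hcl : ∀ z ∈ Metric.ball (0 : E) ρ, ∀ u v w,
      fderiv ℝ B z u v w - fderiv ℝ B z v u w + fderiv ℝ B z w u v = 0) :
    ∃ α : E → E →L[ℝ] ℝ, ContDiff ℝ ∞ α ∧ ∀ z ∈ Metric.ball (0 : E) ρ, ∀ u v,
      fderiv ℝ α z u v - fderiv ℝ α z v u = B z u v := by
  -- The radial homotopy operator: α_x = ∫₀¹ t B_{tx}(x, ·) dt.
  set F : E → ℝ → E →L[ℝ] ℝ := fun x t => t • B (t • x) x with hFdef
  have hF : ContDiff ℝ ∞ ↿F := by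
    have h1 : ContDiff ℝ ∞ fun p : E × ℝ => B (p.2 • p.1) :=
      hB.comp (contDiff_snd.smul contDiff_fst)
    exact contDiff_snd.smul (h1.clm_apply contDiff_fst)
  have hBd : ∀ z, HasFDerivAt B (fderiv ℝ B z) z := fun z =>
    (hB.differentiable (by simp) z).hasFDerivAt
  have hfBc : Continuous (fderiv ℝ B) := hB.continuous_fderiv (by simp)
  set F' : E → ℝ → E →L[ℝ] E →L[ℝ] ℝ := fun x t =>
    t • (t • (fderiv ℝ B (t • x)).flip x + B (t • x)) with hFderivdef
  have hFderiv : ∀ x t, HasFDerivAt (fun y => F y t) (F' x t) x := by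
    intro x t
    have h1 : HasFDerivAt (fun y : E => t • y) (t • ContinuousLinearMap.id ℝ E) x :=
      (hasFDerivAt_id x).const_smul t
    have h2 : HasFDerivAt (fun y : E => B (t • y)) _ x := (hBd (t • x)).comp x h1
    have h3 := (h2.clm_apply (hasFDerivAt_id x)).const_smul t
    refine h3.congr_fderiv ?_
    ext u v
    simp [hFderivdef]
    ring
  have hFderivc : Continuous ↿F' := by
    have e1 : Continuous fun p : E × ℝ => B (p.2 • p.1) :=
      hB.continuous.comp (continuous_snd.smul continuous_fst)
    have e2 : Continuous fun p : E × ℝ => (fderiv ℝ B (p.2 • p.1)).flip p.1 := by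
      have e3 : Continuous fun p : E × ℝ => (fderiv ℝ B (p.2 • p.1)).flip :=
        (ContinuousLinearMap.flipₗᵢ ℝ E E (E →L[ℝ] ℝ)).continuous.comp
          (hfBc.comp (continuous_snd.smul continuous_fst))
      exact e3.clm_apply continuous_fst
    exact continuous_snd.smul ((continuous_snd.smul e2).add e1)
  refine ⟨fun x => ∫ t in (0 : ℝ)..1, F x t, contDiff_intervalIntegral_param hF, ?_⟩
  intro z hz u v
  rw [(hasFDerivAt_intervalIntegral_param hF hFderiv hFderivc z).fderiv]
  have hFderivz : Continuous fun t : ℝ => F' z t :=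
    hFderivc.comp (by fun_prop : Continuous fun t : ℝ => (z, t))
  have happ : ∀ a b, (∫ t in (0 : ℝ)..1, F' z t) a b = ∫ t in (0 : ℝ)..1, F' z t a b := by
    intro a b
    rw [ContinuousLinearMap.intervalIntegral_apply (hFderivz.intervalIntegrable _ _),
      ContinuousLinearMap.intervalIntegral_apply
        ((hFderivz.clm_apply continuous_const).intervalIntegrable _ _)]
  rw [happ, happ, ← intervalIntegral.integral_sub
    (((hFderivz.clm_apply continuous_const).clm_apply continuous_const).intervalIntegrable _ _)
    (((hFderivz.clm_apply continuous_const).clm_apply continuous_const).intervalIntegrable _ _)]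
  -- Closedness of B at tz turns the integrand of dα(u, v) into the derivative of t² B_{tz}(u, v),
  -- whose increment over [0,1] is B_z(u, v). The ball is star-shaped, so tz stays where B is
  -- closed.
  have hder : ∀ t ∈ uIcc (0 : ℝ) 1, HasDerivAt (fun t : ℝ => t ^ 2 * B (t • z) u v)
      (F' z t u v - F' z t v u) t := by
    intro t ht
    rw [uIcc_of_le zero_le_one] at ht
    have h1 : HasDerivAt (fun t : ℝ => t • z) z t := by
      simpa using (hasDerivAt_id t).smul_const z
    have h2 : HasDerivAt (fun t : ℝ => B (t • z)) (fderiv ℝ B (t • z) z) t :=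
      (hBd (t • z)).comp_hasDerivAt t h1
    have h3 : HasDerivAt (fun t : ℝ => B (t • z) u v) (fderiv ℝ B (t • z) z u v) t := by
      have h4 := h2.clm_apply (hasDerivAt_const t u)
      have h5 := h4.clm_apply (hasDerivAt_const t v)
      simpa using h5
    have h6 := (hasDerivAt_pow 2 t).mul h3
    refine h6.congr_deriv ?_
    have hmem : t • z ∈ Metric.ball (0 : E) ρ := by
      rw [mem_ball_zero_iff] at hz ⊢
      rw [norm_smul, Real.norm_eq_abs, abs_of_nonneg ht.1]
      exact (mul_le_of_le_one_left (norm_nonneg z) ht.2).trans_lt hz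
    have hc := hcl _ hmem z u v
    have ha := halt (t • z) v u
    simp [hFderivdef]
    rw [ha]
    linear_combination t ^ 2 * hc
  rw [intervalIntegral.integral_eq_sub_of_hasDerivAt hder
    ((((hFderivz.clm_apply continuous_const).clm_apply continuous_const).sub
      ((hFderivz.clm_apply continuous_const).clm_apply continuous_const)).intervalIntegrable _ _)]
  simp

end Poincare

/-! ### 2-covectors as alternating bilinear forms -/

section TwoCovectors

variable {n : ℕ}

/-- A `2`-covector as a bilinear form. -/
noncomputable def bilCLM (n : ℕ) : TwoCovector n →L[ℝ] (Cn n →L[ℝ] Cn n →L[ℝ] ℝ) :=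
  (ContinuousLinearMap.compL ℝ (Cn n) (Cn n [⋀^Fin 1]→L[ℝ] ℝ) (Cn n →L[ℝ] ℝ)
    ((ContinuousAlternatingMap.ofSubsingletonLIE (𝕜 := ℝ) (E := Cn n) (F := ℝ)
      (0 : Fin 1)).symm.toContinuousLinearEquiv : _ →L[ℝ] _)).comp
    (ContinuousAlternatingMap.curryLeftLI (𝕜 := ℝ) (E := Cn n) (F := ℝ)
      (n := 1)).toContinuousLinearMap

lemma bilCLM_apply (η : TwoCovector n) (v w : Cn n) : bilCLM n η v w = η ![v, w] := by
  have : ∀ A : Cn n [⋀^Fin 1]→L[ℝ] ℝ, (ContinuousAlternatingMap.ofSubsingletonLIE (𝕜 := ℝ)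
      (E := Cn n) (F := ℝ) (0 : Fin 1)).symm A w = A ![w] := by
    intro A
    obtain ⟨L, rfl⟩ := (ContinuousAlternatingMap.ofSubsingletonLIE (𝕜 := ℝ)
      (E := Cn n) (F := ℝ) (0 : Fin 1)).surjective A
    simp
  change (ContinuousAlternatingMap.ofSubsingletonLIE (𝕜 := ℝ)
      (E := Cn n) (F := ℝ) (0 : Fin 1)).symm _ w = _
  rw [this]
  rfl

lemma twoCovector_swap (η : TwoCovector n) (v w : Cn n) : η ![v, w] = -η ![w, v] := by
  have := η.map_swap ![w, v] (i := 0) (j := 1) (by simp)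
  refine Eq.trans ?_ this
  change η _ = η _
  congr 1
  ext i
  fin_cases i <;> rfl

lemma twoCovector_ext {η θ : TwoCovector n} (h : ∀ v w, η ![v, w] = θ ![v, w]) : η = θ := by
  ext x
  have : x = ![x 0, x 1] := by
    funext i; fin_cases i <;> rfl
  rw [this]
  exact h _ _

lemma extDeriv_two_apply {η : Cn n → TwoCovector n} {z : Cn n} (hη : DifferentiableAt ℝ η z)
    (u v w : Cn n) :
    extDeriv η z ![u, v, w] = fderiv ℝ (fun y => bilCLM n (η y)) z u v w
      - fderiv ℝ (fun y => bilCLM n (η y)) z v u w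
      + fderiv ℝ (fun y => bilCLM n (η y)) z w u v := by
  have h1 : HasFDerivAt (fun y => bilCLM n (η y)) ((bilCLM n).comp (fderiv ℝ η z)) z :=
    (bilCLM n).hasFDerivAt.comp z hη.hasFDerivAt
  rw [h1.fderiv, extDeriv, ContinuousAlternatingMap.alternatizeUncurryFin_apply,
    Fin.sum_univ_three]
  have h0 : (0 : Fin 3).removeNth ![u, v, w] = ![v, w] := by
    ext i; fin_cases i <;> rfl
  have h1 : (1 : Fin 3).removeNth ![u, v, w] = ![u, w] := by
    ext i; fin_cases i <;> rfl
  have h2 : (2 : Fin 3).removeNth ![u, v, w] = ![u, v] := by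
    ext i; fin_cases i <;> rfl
  rw [h0, h1, h2]
  simp only [ContinuousLinearMap.comp_apply, bilCLM_apply]
  simp
  ring

end TwoCovectors

end ConicalKahler

namespace ConicalKahler

/-! ### The local `i∂∂̄`-lemma and potentials with a strict minimum -/

section LocalPotential

open Set

variable {N : ℕ}

lemma clm_ext_stdVec {L M : Cn N →L[ℝ] ℝ} (h : ∀ j, L (stdVec j) = M (stdVec j))
    (hI : ∀ j, L (Complex.I • stdVec j) = M (Complex.I • stdVec j)) : L = M := by
  ext v
  have hv : v = ∑ j, ((v j).re • stdVec j + (v j).im • (Complex.I • stdVec j)) := by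
    ext i
    simp only [WithLp.ofLp_sum, WithLp.ofLp_add, WithLp.ofLp_smul, Finset.sum_apply, Pi.add_apply,
      Pi.smul_apply, PiLp.single_apply, Complex.real_smul, smul_eq_mul]
    simp [Finset.sum_add_distrib, Complex.re_add_im]
  rw [hv]
  simp only [map_sum, map_add, map_smul, h, hI]

/-- The local `i∂∂̄`-lemma at the origin, for closed real `(1,1)`-forms. -/
lemma exists_potential_zero {η : Cn N → TwoCovector N}
    (hη : ∀ᶠ z in 𝓝 (0 : Cn N), ContDiffAt ℝ ∞ η z ∧ extDeriv η z = 0 ∧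
      ∀ a b : Cn N, η z ![Complex.I • a, Complex.I • b] = η z ![a, b]) :
    ∃ φ : Cn N → ℝ, ContDiff ℝ ∞ φ ∧ ∀ᶠ z in 𝓝 (0 : Cn N), ddbar φ z = η z := by
  obtain ⟨ρ, hρ, hball⟩ := Metric.eventually_nhds_iff_ball.1 hη
  let χ : ContDiffBump (0 : Cn N) := ⟨ρ / 4, ρ / 2, by linarith, by linarith⟩
  -- The cutoff only provides a globally smooth form. B equals η, and hence is closed, on the ball
  -- of radius ρ/4.
  set B : Cn N → Cn N →L[ℝ] Cn N →L[ℝ] ℝ := fun z => χ z • bilCLM N (η z) with hBdef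
  have hB : ContDiff ℝ ∞ B := by
    rw [contDiff_iff_contDiffAt]
    intro z
    by_cases hz : z ∈ Metric.ball (0 : Cn N) ρ
    · exact χ.contDiff.contDiffAt.smul ((bilCLM N).contDiff.contDiffAt.comp z (hball z hz).1)
    · have : B =ᶠ[𝓝 z] fun _ => 0 := by
        have hop : IsOpen (Metric.closedBall (0 : Cn N) (ρ / 2))ᶜ :=
          Metric.isClosed_closedBall.isOpen_compl
        have hz' : z ∈ (Metric.closedBall (0 : Cn N) (ρ / 2))ᶜ := by
          simp only [Metric.mem_ball, dist_zero_right, not_lt, mem_compl_iff,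
            Metric.mem_closedBall, not_le] at hz ⊢
          linarith
        filter_upwards [hop.mem_nhds hz'] with y hy
        have : χ y = 0 := χ.zero_of_le_dist (by
          simp only [mem_compl_iff, Metric.mem_closedBall, not_le] at hy
          exact hy.le)
        simp [hBdef, this]
      exact contDiffAt_const.congr_of_eventuallyEq this
  have hBη : ∀ z ∈ Metric.ball (0 : Cn N) (ρ / 4), B z = bilCLM N (η z) := fun z hz => by
    have : χ z = 1 := χ.one_of_mem_closedBall (Metric.ball_subset_closedBall hz)
    simp [hBdef, this]
  have hsub : ∀ z ∈ Metric.ball (0 : Cn N) (ρ / 4), z ∈ Metric.ball (0 : Cn N) ρ := fun z hz =>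
    Metric.ball_subset_ball (by linarith) hz
  have halt : ∀ z v w, B z v w = -B z w v := by
    intro z v w
    simp only [hBdef, smul_apply, bilCLM_apply]
    rw [twoCovector_swap]
    simp
  obtain ⟨α, hα, hαB⟩ := exists_primitive_two_form hB halt (ρ := ρ / 4) (by
    intro z hz u v w
    have hee : B =ᶠ[𝓝 z] fun y => bilCLM N (η y) := by
      filter_upwards [Metric.isOpen_ball.mem_nhds hz] with y hy using hBη y hy
    rw [hee.fderiv_eq, ← extDeriv_two_apply ((hball z (hsub z hz)).1.differentiableAt (by simp)),
      (hball z (hsub z hz)).2.1]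
    rfl)
  have hαd : ∀ z, HasFDerivAt α (fderiv ℝ α z) z := fun z =>
    (hα.differentiable (by simp) z).hasFDerivAt
  -- The coefficients of the (0,1)-part of α. Its ∂̄-closedness is the vanishing of the (0,2)-part
  -- of dα = η, which holds because η is of type (1,1).
  set β : Fin N → Cn N → ℂ := fun j z =>
    (1 / 2 : ℂ) * ((α z (stdVec j) : ℝ) + Complex.I * (α z (Complex.I • stdVec j) : ℝ)) with hβdef
  have hαv : ∀ v, ContDiff ℝ ∞ fun z => ((α z v : ℝ) : ℂ) := fun v =>
    Complex.ofRealCLM.contDiff.comp (hα.clm_apply contDiff_const)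
  have hβ : ∀ j, ContDiff ℝ ∞ (β j) := fun j =>
    contDiff_const.mul ((hαv _).add (contDiff_const.mul (hαv _)))
  have hαvd : ∀ v z w, HasFDerivAt (fun z => ((α z v : ℝ) : ℂ))
      (Complex.ofRealCLM.comp ((fderiv ℝ α z).flip v)) z ∧
      (Complex.ofRealCLM.comp ((fderiv ℝ α z).flip v)) w = ((fderiv ℝ α z w v : ℝ) : ℂ) := by
    intro v z w
    refine ⟨Complex.ofRealCLM.hasFDerivAt.comp z ?_, rfl⟩
    refine ((hαd z).clm_apply (hasFDerivAt_const v z)).congr_fderiv ?_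
    ext; simp
  have hβd : ∀ j z w, fderiv ℝ (β j) z w = (1 / 2 : ℂ) * ((fderiv ℝ α z w (stdVec j) : ℝ)
      + Complex.I * (fderiv ℝ α z w (Complex.I • stdVec j) : ℝ)) := by
    intro j z w
    have h3 : HasFDerivAt (β j) _ z := ((hαvd (stdVec j) z w).1.add
      ((hαvd (Complex.I • stdVec j) z w).1.const_mul Complex.I)).const_mul (1 / 2 : ℂ)
    rw [h3.fderiv, ← (hαvd (stdVec j) z w).2, ← (hαvd (Complex.I • stdVec j) z w).2]
    simp
    ring
  have hnear : ∀ᶠ z in 𝓝 (0 : Cn N), z ∈ Metric.ball (0 : Cn N) (ρ / 4) :=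
    Metric.ball_mem_nhds _ (by linarith)
  obtain ⟨g, hg, hgβ⟩ := exists_dbar_solution β hβ (by
    filter_upwards [hnear] with z hz i j
    have hd : ∀ u v, fderiv ℝ α z u v = fderiv ℝ α z v u + η z ![u, v] := fun u v => by
      have := hαB z hz u v
      rw [hBη z hz, bilCLM_apply] at this
      linarith
    have ht := (hball z (hsub z hz)).2.2
    rw [dbar, dbar, hβd, hβd, hβd, hβd, hd (stdVec i) (stdVec j),
      hd (stdVec i) (Complex.I • stdVec j), hd (Complex.I • stdVec i) (stdVec j),
      hd (Complex.I • stdVec i) (Complex.I • stdVec j), ht]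
    have h4 : η z ![Complex.I • stdVec i, stdVec j] = -η z ![stdVec i, Complex.I • stdVec j] := by
      have h5 := ht (stdVec i) (Complex.I • stdVec j)
      rw [I_smul_I_smul] at h5
      rw [← h5, ← bilCLM_apply, ← bilCLM_apply, map_neg, neg_neg]
    rw [h4]
    push_cast
    linear_combination (1 / 4 : ℂ) * ((η z ![stdVec i, stdVec j] : ℝ) : ℂ) * Complex.I_sq)
  set a : Cn N → ℝ := fun z => (g z).re with ha
  set b : Cn N → ℝ := fun z => (g z).im with hb
  have hac : ContDiff ℝ ∞ a := Complex.reCLM.contDiff.comp hg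
  have hbc : ContDiff ℝ ∞ b := Complex.imCLM.contDiff.comp hg
  -- Let g = a + ib solve ∂̄g = α^{0,1}. As α is real, α is ∂̄g plus its conjugate, which is da +
  -- dᶜb. Hence η = dα = d dᶜ b = i∂∂̄(2b), and 2b is the potential.
  have hrel : ∀ᶠ z in 𝓝 (0 : Cn N),
      fderiv ℝ a z - (fderiv ℝ b z).comp (stdJ N) = α z := by
    filter_upwards [hgβ] with z hz
    have hgd : HasFDerivAt g (fderiv ℝ g z) z := (hg.differentiable (by simp) z).hasFDerivAt
    have h1 : fderiv ℝ a z = Complex.reCLM.comp (fderiv ℝ g z) :=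
      (Complex.reCLM.hasFDerivAt.comp z hgd).fderiv
    have h2 : fderiv ℝ b z = Complex.imCLM.comp (fderiv ℝ g z) :=
      (Complex.imCLM.hasFDerivAt.comp z hgd).fderiv
    have h3 : ∀ j, fderiv ℝ g z (stdVec j) + Complex.I * fderiv ℝ g z (Complex.I • stdVec j) =
        (α z (stdVec j) : ℝ) + Complex.I * (α z (Complex.I • stdVec j) : ℝ) := by
      intro j
      have := hz j
      rw [dbar, hβdef] at this
      exact mul_left_cancel₀ (by norm_num) this
    apply clm_ext_stdVec
    · intro j
      have := congrArg Complex.re (h3 j)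
      simp at this
      simp [h1, h2]
      linarith
    · intro j
      have := congrArg Complex.im (h3 j)
      simp at this
      simp only [h1, h2, sub_apply, ContinuousLinearMap.comp_apply,
        stdJ_apply, I_smul_I_smul, map_neg]
      simp
      linarith
  refine ⟨fun z => 2 * b z, contDiff_const.mul hbc, ?_⟩
  filter_upwards [hrel.eventually_nhds, hnear] with z hz hzb
  rw [ddbar_const_mul 2 (hbc.contDiffAt.of_le two_le_infty)]
  have ha2 : HasFDerivAt (fderiv ℝ a) (fderiv ℝ (fderiv ℝ a) z) z :=
    ((hac.fderiv_right (m := ∞) (by simp)).differentiable (by simp) z).hasFDerivAt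
  have hb2 : HasFDerivAt (fderiv ℝ b) (fderiv ℝ (fderiv ℝ b) z) z :=
    ((hbc.fderiv_right (m := ∞) (by simp)).differentiable (by simp) z).hasFDerivAt
  have hsec : ∀ u v, fderiv ℝ (fderiv ℝ b) z u (Complex.I • v) =
      fderiv ℝ (fderiv ℝ a) z u v - fderiv ℝ α z u v := by
    intro u v
    have h1 : HasFDerivAt (fun y => fderiv ℝ a y - (fderiv ℝ b y).comp (stdJ N))
        (fderiv ℝ (fderiv ℝ a) z -
          ((ContinuousLinearMap.compL ℝ (Cn N) (Cn N) ℝ).flip (stdJ N)).comp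
            (fderiv ℝ (fderiv ℝ b) z)) z :=
      ha2.sub (((ContinuousLinearMap.compL ℝ (Cn N) (Cn N) ℝ).flip (stdJ N)).hasFDerivAt.comp z hb2)
    have h2 := h1.fderiv
    have hee : (fun y => fderiv ℝ a y - (fderiv ℝ b y).comp (stdJ N)) =ᶠ[𝓝 z] α := hz
    rw [hee.fderiv_eq] at h2
    rw [h2]
    simp
  apply twoCovector_ext
  intro u v
  have h3 := hαB z hzb u v
  rw [hBη z hzb, bilCLM_apply] at h3
  rw [ContinuousAlternatingMap.smul_apply, ddbar_apply (hbc.contDiffAt.of_le two_le_infty), hsec,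
    hsec, ← h3, snd_symm (hac.contDiffAt.of_le two_le_infty) u v, smul_eq_mul]
  ring

/-- A smooth function with non-degenerate local minimum. -/
lemma eventually_pos_of_hessian_pos {ψ : Cn N → ℝ} (hψ : ContDiff ℝ ∞ ψ) (h0 : ψ 0 = 0)
    (h1 : fderiv ℝ ψ 0 = 0) (h2 : ∀ v : Cn N, v ≠ 0 → 0 < fderiv ℝ (fderiv ℝ ψ) 0 v v) :
    ∀ᶠ z in 𝓝 (0 : Cn N), z ≠ 0 → 0 < ψ z := by
  have hd1 : ContDiff ℝ ∞ (fderiv ℝ ψ) := hψ.fderiv_right (by simp)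
  have hc2 : Continuous (fderiv ℝ (fderiv ℝ ψ)) := hd1.continuous_fderiv (by simp)
  have hc : Continuous fun p : Cn N × Cn N => fderiv ℝ (fderiv ℝ ψ) p.1 p.2 p.2 :=
    ((hc2.comp continuous_fst).clm_apply continuous_snd).clm_apply continuous_snd
  have hev : ∀ᶠ z in 𝓝 (0 : Cn N), ∀ v ∈ Metric.sphere (0 : Cn N) 1,
      0 < fderiv ℝ (fderiv ℝ ψ) z v v := by
    refine (isCompact_sphere (0 : Cn N) 1).eventually_forall_of_forall_eventually ?_
    intro v hv
    have hv0 : v ≠ 0 := by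
      rintro rfl
      simp at hv
    exact hc.continuousAt.eventually (lt_mem_nhds (h2 v hv0))
  obtain ⟨ρ, hρ, hball⟩ := Metric.eventually_nhds_iff_ball.1 hev
  have hpos : ∀ z ∈ Metric.ball (0 : Cn N) ρ, ∀ v : Cn N, v ≠ 0 →
      0 < fderiv ℝ (fderiv ℝ ψ) z v v := by
    intro z hz v hv
    have hn : 0 < ‖v‖ := norm_pos_iff.2 hv
    have h3 := hball z hz ((‖v‖⁻¹ : ℝ) • v) (by
      rw [mem_sphere_zero_iff_norm, norm_smul, norm_inv, norm_norm, inv_mul_cancel₀ hn.ne'])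
    simp only [map_smul, smul_apply, smul_eq_mul] at h3
    have h4 : 0 < ‖v‖⁻¹ := inv_pos.2 hn
    exact pos_of_mul_pos_right (pos_of_mul_pos_right h3 h4.le) h4.le
  filter_upwards [Metric.ball_mem_nhds (0 : Cn N) hρ] with z hz hz0
  have hmem : ∀ t ∈ Icc (0 : ℝ) 1, t • z ∈ Metric.ball (0 : Cn N) ρ := by
    intro t ht
    rw [mem_ball_zero_iff] at hz ⊢
    rw [norm_smul, Real.norm_eq_abs, abs_of_nonneg ht.1]
    exact (mul_le_of_le_one_left (norm_nonneg z) ht.2).trans_lt hz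
  have hline : ∀ t : ℝ, HasDerivAt (fun t : ℝ => t • z) z t := fun t => by
    simpa using (hasDerivAt_id t).smul_const z
  have hder : ∀ t : ℝ, HasDerivAt (fun t : ℝ => ψ (t • z)) (fderiv ℝ ψ (t • z) z) t := fun t =>
    (hψ.differentiable (by simp) _).hasFDerivAt.comp_hasDerivAt t (hline t)
  have hder2 : ∀ t : ℝ, HasDerivAt (fun t : ℝ => fderiv ℝ ψ (t • z) z)
      (fderiv ℝ (fderiv ℝ ψ) (t • z) z z) t := fun t => by
    have h3 : HasDerivAt (fun t : ℝ => fderiv ℝ ψ (t • z)) (fderiv ℝ (fderiv ℝ ψ) (t • z) z) t :=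
      (hd1.differentiable (by simp) _).hasFDerivAt.comp_hasDerivAt t (hline t)
    simpa using h3.clm_apply (hasDerivAt_const t z)
  have hm2 : StrictMonoOn (fun t : ℝ => fderiv ℝ ψ (t • z) z) (Icc 0 1) := by
    refine strictMonoOn_of_deriv_pos (convex_Icc 0 1)
      (fun t _ => (hder2 t).continuousAt.continuousWithinAt) ?_
    intro t ht
    rw [interior_Icc] at ht
    rw [(hder2 t).deriv]
    exact hpos _ (hmem t ⟨ht.1.le, ht.2.le⟩) z hz0
  have hm1 : StrictMonoOn (fun t : ℝ => ψ (t • z)) (Icc 0 1) := by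
    refine strictMonoOn_of_deriv_pos (convex_Icc 0 1)
      (fun t _ => (hder t).continuousAt.continuousWithinAt) ?_
    intro t ht
    rw [interior_Icc] at ht
    rw [(hder t).deriv]
    have := hm2 (left_mem_Icc.2 zero_le_one) ⟨ht.1.le, ht.2.le⟩ ht.1
    simpa [h1] using this
  have := hm1 (left_mem_Icc.2 zero_le_one) (right_mem_Icc.2 zero_le_one) zero_lt_one
  simpa [h0] using this

/-- A strictly plurisubharmonic function can be changed by a pluriharmonic one so as to vanish at
the origin and be positive near it. -/
lemma exists_positive_normalization {φ : Cn N → ℝ} (hφ : ContDiff ℝ ∞ φ)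
    (hpos : ∀ v : Cn N, v ≠ 0 → 0 < ddbar φ 0 ![v, Complex.I • v]) :
    ∃ ψ : Cn N → ℝ, ContDiff ℝ ∞ ψ ∧ (∀ z, ddbar ψ z = ddbar φ z) ∧ ψ 0 = 0 ∧
      ∀ᶠ z in 𝓝 (0 : Cn N), z ≠ 0 → 0 < ψ z := by
  set H := fderiv ℝ (fderiv ℝ φ) 0 with hH
  have hsymm : ∀ v w, H v w = H w v := snd_symm (hφ.contDiffAt.of_le two_le_infty)
  -- T is the part of the Hessian H that changes sign under J, so the quadratic polynomial P below
  -- is pluriharmonic. Subtracting P kills the 1-jet and leaves the Hessian H - T, the J-invariant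
  -- part of H. On the diagonal this is i∂∂̄φ(v, Jv), which is positive.
  let T : Cn N →L[ℝ] Cn N →L[ℝ] ℝ := (1 / 2 : ℝ) •
    (H - ((ContinuousLinearMap.compL ℝ (Cn N) (Cn N) ℝ).flip (stdJ N)).comp (H.comp (stdJ N)))
  have hT : ∀ v w, T v w = (1 / 2 : ℝ) * (H v w - H (Complex.I • v) (Complex.I • w)) := by
    intro v w
    simp [T]
  set P : Cn N → ℝ := fun z => φ 0 + fderiv ℝ φ 0 z + (1 / 2 : ℝ) * T z z with hP
  have hPc : ContDiff ℝ ∞ P := (contDiff_const.add (fderiv ℝ φ 0).contDiff).add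
    (contDiff_const.mul (T.contDiff.clm_apply contDiff_id))
  have hPd : fderiv ℝ P = fun z => fderiv ℝ φ 0 + T z := by
    funext z
    have h1 := (T.hasFDerivAt (x := z)).clm_apply (hasFDerivAt_id z)
    have h2 : HasFDerivAt P _ z :=
      (((fderiv ℝ φ 0).hasFDerivAt (x := z)).const_add (φ 0)).add (h1.const_mul (1 / 2 : ℝ))
    rw [h2.fderiv]
    ext w
    simp [hT]
    rw [hsymm w z, hsymm (Complex.I • w)]
    ring
  have hPdd : ∀ z, fderiv ℝ (fderiv ℝ P) z = T := by
    intro z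
    rw [hPd]
    exact (T.hasFDerivAt.const_add _).fderiv
  have hPdb : ∀ z, ddbar P z = 0 := by
    intro z
    apply twoCovector_ext
    intro v w
    rw [ddbar_apply (hPc.contDiffAt.of_le two_le_infty), hPdd, hT, hT, I_smul_I_smul,
      I_smul_I_smul, map_neg, map_neg, hsymm w, hsymm (Complex.I • w)]
    simp
    ring
  refine ⟨fun z => φ z - P z, hφ.sub hPc, ?_, ?_, ?_⟩
  · intro z
    rw [ddbar_sub (hφ.contDiffAt.of_le two_le_infty) (hPc.contDiffAt.of_le two_le_infty), hPdb]
    exact sub_zero _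
  · simp [hP]
  · have hd : fderiv ℝ (fun z => φ z - P z) = fun z => fderiv ℝ φ z - fderiv ℝ P z := by
      funext z
      exact fderiv_fun_sub (hφ.differentiable (by simp) z) (hPc.differentiable (by simp) z)
    refine eventually_pos_of_hessian_pos (hφ.sub hPc) (by simp [hP]) ?_ ?_
    · rw [hd]; simp [hPd]
    · intro v hv
      have hdd : fderiv ℝ (fderiv ℝ (fun z => φ z - P z)) 0 = H - T := by
        rw [hd, fderiv_fun_sub
          ((hφ.fderiv_right (m := ∞) (by simp)).differentiable (by simp) 0)
          ((hPc.fderiv_right (m := ∞) (by simp)).differentiable (by simp) 0), hPdd]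
      rw [hdd]
      have := hpos v hv
      rw [ddbar_apply_I (hφ.contDiffAt.of_le two_le_infty)] at this
      simp only [sub_apply, hT]
      linarith

/-- Near each point a Kähler form has a potential with a strict local minimum at that point. -/
theorem exists_local_potential {η : Cn N → TwoCovector N} {z₀ : Cn N}
    (hη : ∀ᶠ z in 𝓝 z₀, IsKahlerAt η z) :
    ∃ φ : Cn N → ℝ, ContDiff ℝ ∞ φ ∧ φ z₀ = 0 ∧
      ∀ᶠ z in 𝓝 z₀, ddbar φ z = η z ∧ (z ≠ z₀ → 0 < φ z) := by
  have htend : Filter.Tendsto (fun z : Cn N => z + z₀) (𝓝 0) (𝓝 z₀) := by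
    have : Continuous fun z : Cn N => z + z₀ := by fun_prop
    simpa using this.tendsto 0
  have htend' : Filter.Tendsto (fun z : Cn N => z - z₀) (𝓝 z₀) (𝓝 0) := by
    have : Continuous fun z : Cn N => z - z₀ := by fun_prop
    simpa using this.tendsto z₀
  obtain ⟨φ, hφ, hφη⟩ := exists_potential_zero (η := fun z => η (z + z₀)) (by
    filter_upwards [htend.eventually hη] with z hz
    refine ⟨?_, ?_, hz.type_one_one⟩
    · exact ContDiffAt.comp z (f := fun z => z + z₀) hz.smooth (by fun_prop)
    · have := hz.closed
      unfold extDeriv at this ⊢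
      rwa [fderiv_comp_add_right])
  obtain ⟨ψ, hψ, hψφ, hψ0, hψp⟩ := exists_positive_normalization hφ (by
    intro v hv
    rw [hφη.self_of_nhds, zero_add]
    exact hη.self_of_nhds.pos v hv)
  refine ⟨fun z => ψ (z - z₀), hψ.comp (by fun_prop), by simpa using hψ0, ?_⟩
  filter_upwards [htend'.eventually hφη, htend'.eventually hψp] with z h1 h2
  refine ⟨?_, fun hz => h2 (sub_ne_zero.2 hz)⟩
  have han : AnalyticAt ℂ (fun z : Cn N => z - z₀) z := by fun_prop
  have h3 := ddbar_comp_holomorphic (φ := ψ) han (hψ.contDiffAt.of_le two_le_infty)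
  have h4 : fderiv ℝ (fun z : Cn N => z - z₀) z = ContinuousLinearMap.id ℝ (Cn N) := by
    rw [fderiv_sub_const]; exact fderiv_fun_id
  rw [h4, hψφ, h1, sub_add_cancel] at h3
  refine Eq.trans h3 ?_
  ext v
  rfl

end LocalPotential

end ConicalKahler

namespace ConicalKahler

/-! ### Auxiliary functions of one real variable -/

section OneVariable

open Set

lemma contDiff_integral_primitive {q : ℝ → ℝ} (hq : ContDiff ℝ ∞ q) (a : ℝ) :
    ContDiff ℝ ∞ (fun t => ∫ s in a..t, q s) ∧ ∀ t, HasDerivAt (fun t => ∫ s in a..t, q s) (q t) t := by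
  have h : ∀ t, HasDerivAt (fun t => ∫ s in a..t, q s) (q t) t := fun t =>
    intervalIntegral.integral_hasDerivAt_right (hq.continuous.intervalIntegrable _ _)
      (hq.continuous.stronglyMeasurableAtFilter _ _) hq.continuous.continuousAt
  refine ⟨?_, h⟩
  rw [contDiff_infty_iff_deriv]
  refine ⟨fun t => (h t).differentiableAt, ?_⟩
  have : deriv (fun t => ∫ s in a..t, q s) = q := funext fun t => (h t).deriv
  rwa [this]

/-- The function used for a regularized maximum: `x + k (x - y)` is a regularization of
`max x (y + const)`. -/
lemma exists_regularized_max {κ : ℝ} (hκ : 0 < κ) :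
    ∃ k : ℝ → ℝ, ContDiff ℝ ∞ k ∧ (∀ t, κ ≤ t → k t = 0) ∧ (∃ c, ∀ t, t ≤ 0 → k t = c - t) ∧
      (∀ t, -1 ≤ deriv k t ∧ deriv k t ≤ 0) ∧ ∀ t, 0 ≤ deriv (deriv k) t := by
  -- q is the derivative of k. It increases from -1 on s ≤ 0 to 0 on s ≥ κ, so in x + k(x - y) the
  -- weights 1 + k' and -k' of x and y are nonnegative and sum to 1. Integrating from κ makes k
  -- vanish beyond κ.
  set q : ℝ → ℝ := fun s => Real.smoothTransition (s / κ) - 1 with hq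
  have hqc : ContDiff ℝ ∞ q :=
    (Real.smoothTransition.contDiff.comp (contDiff_id.div_const κ)).sub contDiff_const
  obtain ⟨h1, h2⟩ := contDiff_integral_primitive hqc κ
  have hd : deriv (fun t => ∫ s in κ..t, q s) = q := funext fun t => (h2 t).deriv
  refine ⟨fun t => ∫ s in κ..t, q s, h1, ?_, ⟨∫ s in κ..0, q s, ?_⟩, ?_, ?_⟩
  · intro t ht
    change ∫ s in κ..t, q s = 0
    rw [intervalIntegral.integral_of_le ht]
    refine MeasureTheory.setIntegral_eq_zero_of_forall_eq_zero ?_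
    intro s hs
    simp only [hq]
    rw [Real.smoothTransition.one_of_one_le ((one_le_div hκ).2 hs.1.le), sub_self]
  · intro t ht
    change ∫ s in κ..t, q s = _
    rw [← intervalIntegral.integral_add_adjacent_intervals (b := 0) (c := t)
      (hqc.continuous.intervalIntegrable _ _) (hqc.continuous.intervalIntegrable _ _)]
    have : ∫ s in (0 : ℝ)..t, q s = ∫ s in (0 : ℝ)..t, (-1 : ℝ) := by
      refine intervalIntegral.integral_congr ?_
      intro s hs
      rw [uIcc_of_ge ht] at hs
      simp only [hq]
      rw [Real.smoothTransition.zero_of_nonpos (div_nonpos_of_nonpos_of_nonneg hs.2 hκ.le), zero_sub]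
    rw [this]
    simp
    ring
  · intro t
    rw [hd]
    constructor
    · simp only [hq]; linarith [Real.smoothTransition.nonneg (t / κ)]
    · simp only [hq]; linarith [Real.smoothTransition.le_one (t / κ)]
  · intro t
    rw [hd]
    refine Monotone.deriv_nonneg ?_
    intro a b hab
    simp only [hq]
    have := Real.smoothTransition.monotone (div_le_div_of_nonneg_right hab hκ.le)
    linarith

/-- A smooth positive function `q` on the line with `q = 1` on `(-∞, 1]`, `(t q)' > 0`, and
`q ≤ 4 / √t`. -/
lemma exists_slow_density :
    ∃ q : ℝ → ℝ, ContDiff ℝ ∞ q ∧ (∀ t ≤ 1, q t = 1) ∧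
      (∀ t, 0 < t → 0 < q t ∧ 0 < q t + t * deriv q t ∧ q t ≤ 4 / √t) := by
  set S := Real.smoothTransition with hS
  -- An interpolation from 1 to 4/√t over 1 ≤ t ≤ 2. With S and S' taken at t - 1, (t q)' = (1 - S)
  -- + 2S/√t + t S'(4/√t - 1). The constant 4 keeps the last bracket nonnegative up to t = 16, well
  -- beyond the place where S' can be nonzero.
  set q : ℝ → ℝ := fun t => 1 + S (t - 1) * (4 / √t - 1) with hq
  have hS1 : ContDiff ℝ ∞ fun t => S (t - 1) :=
    Real.smoothTransition.contDiff.comp (contDiff_id.sub contDiff_const)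
  have hq1 : ∀ t ≤ 1, q t = 1 := fun t ht => by
    simp only [hq, hS]
    rw [Real.smoothTransition.zero_of_nonpos (by linarith)]; ring
  have hqc : ContDiff ℝ ∞ q := by
    rw [contDiff_iff_contDiffAt]
    intro t
    rcases lt_or_ge t 1 with ht | ht
    · refine contDiffAt_const (c := (1 : ℝ)) |>.congr_of_eventuallyEq ?_
      filter_upwards [Iio_mem_nhds ht] with s hs using hq1 s (le_of_lt hs)
    · have h0 : t ≠ 0 := by linarith
      refine contDiffAt_const.add (hS1.contDiffAt.mul ((contDiffAt_const.div
        (Real.contDiffAt_sqrt h0) ?_).sub contDiffAt_const))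
      exact (Real.sqrt_pos.2 (by linarith)).ne'
  refine ⟨q, hqc, hq1, ?_⟩
  intro t ht
  have hsq : 0 < √t := Real.sqrt_pos.2 ht
  have hS0 := Real.smoothTransition.nonneg (t - 1)
  have hSle := Real.smoothTransition.le_one (t - 1)
  have hdiv : 0 < 4 / √t := by positivity
  have hqeq : q t = (1 - S (t - 1)) + S (t - 1) * (4 / √t) := by simp only [hq]; ring
  have hqpos : 0 < q t := by
    rw [hqeq]
    rcases eq_or_lt_of_le hS0 with h | h
    · rw [hS, ← h]; norm_num
    · have := mul_pos h hdiv
      rw [hS]; linarith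
  refine ⟨hqpos, ?_, ?_⟩
  · rcases lt_or_ge t 1 with ht1 | ht1
    · have : deriv q t = 0 := by
        have : q =ᶠ[𝓝 t] fun _ => 1 := by
          filter_upwards [Iio_mem_nhds ht1] with s hs using hq1 s (le_of_lt hs)
        rw [this.deriv_eq]; simp
      rw [this, hq1 t ht1.le]; norm_num
    · have hSd : HasDerivAt (fun t => S (t - 1)) (deriv (fun t => S (t - 1)) t) t :=
        (hS1.differentiable (by simp) t).hasDerivAt
      have hsqd : HasDerivAt (fun t => √t) (1 / (2 * √t)) t := Real.hasDerivAt_sqrt ht.ne'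
      have hdd := ((hsqd.inv hsq.ne').const_mul 4).sub_const 1
      have hqd : HasDerivAt q (deriv (fun t => S (t - 1)) t * (4 / √t - 1)
          + S (t - 1) * (4 * (-(1 / (2 * √t)) / √t ^ 2))) t := by
        have := (hSd.mul hdd).const_add 1
        exact this
      rw [hqd.deriv, hqeq]
      have hS' : 0 ≤ deriv (fun t => S (t - 1)) t := by
        refine Monotone.deriv_nonneg fun a b hab => Real.smoothTransition.monotone (by linarith)
      have key : (1 - S (t - 1)) + S (t - 1) * (4 / √t) + t * (deriv (fun t => S (t - 1)) t *
          (4 / √t - 1) + S (t - 1) * (4 * (-(1 / (2 * √t)) / √t ^ 2))) =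
          (1 - S (t - 1)) + S (t - 1) * (2 / √t) +
            t * (deriv (fun t => S (t - 1)) t * (4 / √t - 1)) := by
        have h2 : √t ^ 2 = t := Real.sq_sqrt ht.le
        rw [h2]
        field_simp
        ring
      rw [key]
      have h3 : 0 ≤ t * (deriv (fun t => S (t - 1)) t * (4 / √t - 1)) := by
        rcases le_or_gt t 16 with h16 | h16
        · have : √t ≤ 4 := by
            rw [show (4 : ℝ) = √16 by rw [show (16 : ℝ) = 4 ^ 2 by norm_num]; simp]
            exact Real.sqrt_le_sqrt h16
          have : 1 ≤ 4 / √t := (one_le_div hsq).2 this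
          have : 0 ≤ 4 / √t - 1 := by linarith
          positivity
        · have : deriv (fun t => S (t - 1)) t = 0 := by
            have : (fun t => S (t - 1)) =ᶠ[𝓝 t] fun _ => 1 := by
              filter_upwards [Ioi_mem_nhds h16] with s hs
              exact Real.smoothTransition.one_of_one_le (by
                have : (16 : ℝ) < s := hs
                linarith)
            rw [this.deriv_eq]; simp
          rw [this]; simp
      have h4 : 0 < (1 - S (t - 1)) + S (t - 1) * (2 / √t) := by
        have hdiv2 : 0 < 2 / √t := by positivity
        rcases eq_or_lt_of_le hS0 with h | h
        · rw [hS, ← h]; norm_num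
        · have := mul_pos h hdiv2
          rw [hS]; linarith
      linarith
  · rcases le_or_gt t 16 with h16 | h16
    · have : √t ≤ 4 := by
        rw [show (4 : ℝ) = √16 by rw [show (16 : ℝ) = 4 ^ 2 by norm_num]; simp]
        exact Real.sqrt_le_sqrt h16
      have h5 : 1 ≤ 4 / √t := (one_le_div hsq).2 this
      rw [hqeq]
      nlinarith
    · simp only [hq, hS]
      rw [Real.smoothTransition.one_of_one_le (by linarith)]
      linarith

/-- A function `h` of slow growth with `h(t) = t` near `0` such that `h(r²)` is strictly
plurisubharmonic on a Kähler cone. -/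
lemma exists_slow_potential {T m : ℝ} (hT : 0 < T) (hm : 0 < m) :
    ∃ h : ℝ → ℝ, ContDiff ℝ ∞ h ∧ (∃ ε > 0, ∀ t < ε, h t = t) ∧
      (∀ t, 0 < t → 0 < deriv h t ∧ 0 < deriv h t + t * deriv (deriv h) t) ∧
      ∀ t, 0 < t → t ≤ T → h t ≤ m := by
  obtain ⟨q, hqc, hq1, hq⟩ := exists_slow_density
  obtain ⟨hc, hd⟩ := contDiff_integral_primitive hqc 0
  set g : ℝ → ℝ := fun t => ∫ s in (0 : ℝ)..t, q s with hg
  have hg1 : ∀ t ≤ 1, g t = t := by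
    intro t ht
    have : ∫ s in (0 : ℝ)..t, q s = ∫ s in (0 : ℝ)..t, (1 : ℝ) := by
      refine intervalIntegral.integral_congr ?_
      intro s hs
      refine hq1 s ?_
      have := hs.2
      exact this.trans (by simp [ht])
    simp only [hg]
    rw [this]; simp
  have hg8 : ∀ t, 0 ≤ t → g t ≤ 8 * √t := by
    have hmono : MonotoneOn (fun t => 8 * √t - g t) (Ici 0) := by
      refine monotoneOn_of_deriv_nonneg (convex_Ici 0) ?_ ?_ ?_
      · exact ((continuous_const.mul Real.continuous_sqrt).sub hc.continuous).continuousOn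
      · intro t ht
        rw [interior_Ici] at ht
        have h0 : t ≠ 0 := ne_of_gt ht
        exact (((Real.hasDerivAt_sqrt h0).const_mul 8).sub
          (hd t)).differentiableAt.differentiableWithinAt
      · intro t ht
        rw [interior_Ici] at ht
        have h0 : t ≠ 0 := ne_of_gt ht
        have h1 := ((Real.hasDerivAt_sqrt h0).const_mul 8).sub (hd t)
        have h2 : deriv (fun t => 8 * √t - g t) t = 8 * (1 / (2 * √t)) - q t := h1.deriv
        rw [h2]
        have h3 := (hq t ht).2.2
        have : 8 * (1 / (2 * √t)) = 4 / √t := by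
          have : √t ≠ 0 := (Real.sqrt_pos.2 ht).ne'
          field_simp; norm_num
        rw [this]; linarith
    intro t ht
    have := hmono self_mem_Ici ht ht
    simp only [hg1 0 zero_le_one, Real.sqrt_zero] at this
    linarith
  -- The function is h(t) = ε g(t/ε), a rescaling that preserves the sign conditions on h' and h' +
  -- t h''. From g(t) ≤ 8√t one gets h(t) ≤ 8√(εt), and this ε makes the bound equal to m at t = T.
  set ε : ℝ := m ^ 2 / (64 * T) with hε
  have hεp : 0 < ε := by positivity
  have hgd : deriv g = q := funext fun t => (hd t).deriv
  have hhd : ∀ t, HasDerivAt (fun t => ε * g (t / ε)) (q (t / ε)) t := by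
    intro t
    have h1 : HasDerivAt (fun t : ℝ => t / ε) (1 / ε) t := (hasDerivAt_id t).div_const ε
    have h2 := ((hd (t / ε)).comp t h1).const_mul ε
    refine h2.congr_deriv ?_
    field_simp
  have hhd' : deriv (fun t => ε * g (t / ε)) = fun t => q (t / ε) := funext fun t => (hhd t).deriv
  refine ⟨fun t => ε * g (t / ε), contDiff_const.mul (hc.comp (contDiff_id.div_const ε)),
    ⟨ε, hεp, ?_⟩, ?_, ?_⟩
  · intro t ht
    simp only
    rw [hg1 _ ((div_le_one hεp).2 ht.le), mul_div_cancel₀ _ hεp.ne']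
  · intro t ht
    rw [hhd']
    have h1 : HasDerivAt (fun t : ℝ => t / ε) (1 / ε) t := (hasDerivAt_id t).div_const ε
    have h2 : HasDerivAt (fun t => q (t / ε)) (deriv q (t / ε) * (1 / ε)) t :=
      ((hqc.differentiable (by simp) _).hasDerivAt).comp t h1
    rw [h2.deriv]
    have h3 := hq (t / ε) (by positivity)
    refine ⟨h3.1, ?_⟩
    have : t * (deriv q (t / ε) * (1 / ε)) = t / ε * deriv q (t / ε) := by ring
    simp only
    rw [this]
    exact h3.2.1
  · intro t ht htT
    have h1 := hg8 (t / ε) (by positivity)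
    have h2 : ε * g (t / ε) ≤ ε * (8 * √(t / ε)) := by gcongr
    refine h2.trans ?_
    have h3 : ε * (8 * √(t / ε)) = 8 * √(ε * t) := by
      have : ε * √(t / ε) = √(ε * t) := by
        rw [← Real.sqrt_sq hεp.le, ← Real.sqrt_mul (by positivity), Real.sqrt_sq hεp.le]
        congr 1
        field_simp
      rw [← this]; ring
    rw [h3]
    have h4 : √(ε * t) ≤ m / 8 := by
      rw [Real.sqrt_le_left (by positivity)]
      calc ε * t ≤ ε * T := by gcongr
        _ = (m / 8) ^ 2 := by rw [hε]; field_simp; norm_num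
    linarith

end OneVariable

end ConicalKahler

namespace ConicalKahler

/-! ### Holomorphic charts, embeddings and biholomorphisms -/

section Charts

open Set

lemma analyticAt_cn_iff {m : ℕ} {E : Type*} [NormedAddCommGroup E] [NormedSpace ℂ E]
    {F : E → Cn m} {z : E} : AnalyticAt ℂ F z ↔ ∀ i, AnalyticAt ℂ (fun y => F y i) z := by
  constructor
  · intro h i
    exact (EuclideanSpace.proj i : Cn m →L[ℂ] ℂ).analyticAt _ |>.comp h
  · intro h
    have h1 : AnalyticAt ℂ (fun y => (EuclideanSpace.equiv (Fin m) ℂ) (F y)) z :=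
      AnalyticAt.pi h
    have h2 := ((EuclideanSpace.equiv (Fin m) ℂ).symm.toContinuousLinearMap.analyticAt _).comp h1
    exact h2

lemma eventually_chart_symm {X : Type u} [TopologicalSpace X] {n : ℕ}
    (e : OpenPartialHomeomorph X (Cn n)) {y : X} (hy : y ∈ e.source) :
    ∀ᶠ z in 𝓝 (e y), z ∈ e.target ∧ e (e.symm z) = z := by
  filter_upwards [e.open_target.mem_nhds (e.map_source hy)] with z hz
  exact ⟨hz, e.right_inv hz⟩

lemma tendsto_chart_symm {X : Type u} [TopologicalSpace X] {n : ℕ}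
    (e : OpenPartialHomeomorph X (Cn n)) {y : X} (hy : y ∈ e.source) :
    Filter.Tendsto e.symm (𝓝 (e y)) (𝓝 y) := by
  have := e.continuousAt_symm (e.map_source hy)
  rwa [ContinuousAt, e.left_inv hy] at this

variable {X : Type u} [TopologicalSpace X] [ComplexSpace X] {n : ℕ}

/-- `HolAt` is an abstract predicate. That it depends only on the germ is inherited from a local
model, where it is expressed through germs of ambient functions. -/
lemma holAt_congr {f g : X → ℂ} {x : X} (h : f =ᶠ[𝓝 x] g) :
    ComplexSpace.HolAt f x ↔ ComplexSpace.HolAt g x := by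
  obtain ⟨N, U, ι, Ω, hx, hU, -⟩ := ComplexSpace.exists_model x
  rw [hU.germ_iff x hx f, hU.germ_iff x hx g]
  constructor
  · rintro ⟨k, hk, hfk⟩; exact ⟨k, hk, h.symm.trans hfk⟩
  · rintro ⟨k, hk, hfk⟩; exact ⟨k, hk, h.trans hfk⟩

lemma IsHolChart.holAt_coord {e : OpenPartialHomeomorph X (Cn n)} (he : IsHolChart e) {y : X}
    (hy : y ∈ e.source) (i : Fin n) : ComplexSpace.HolAt (fun x => e x i) y := by
  rw [he y hy]
  have h : AnalyticAt ℂ (fun z : Cn n => z i) (e y) :=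
    (EuclideanSpace.proj i : Cn n →L[ℂ] ℂ).analyticAt _
  refine h.congr ?_
  filter_upwards [eventually_chart_symm e hy] with z hz
  simp [hz.2]

lemma IsHolChart.analyticAt_transition {e e' : OpenPartialHomeomorph X (Cn n)}
    (he : IsHolChart e) (he' : IsHolChart e') {y : X} (hy : y ∈ e.source) (hy' : y ∈ e'.source) :
    AnalyticAt ℂ (e' ∘ e.symm) (e y) := by
  rw [analyticAt_cn_iff]
  intro i
  exact (he y hy _).1 (he'.holAt_coord hy' i)

lemma IsHolEmbedding.analyticAt_chart {N : ℕ} {U : Set X} {ι : X → Cn N}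
    (hι : IsHolEmbedding U ι) {e : OpenPartialHomeomorph X (Cn n)} (he : IsHolChart e) {y : X}
    (hyU : y ∈ U) (hy : y ∈ e.source) : AnalyticAt ℂ (ι ∘ e.symm) (e y) := by
  rw [analyticAt_cn_iff]
  intro i
  refine (he y hy (fun x => ι x i)).1 ((hι.germ_iff y hyU _).2 ⟨fun z => z i, ?_, ?_⟩)
  · exact (EuclideanSpace.proj i : Cn N →L[ℂ] ℂ).analyticAt _
  · exact Filter.EventuallyEq.rfl

/-- In a chart, a holomorphic embedding has a holomorphic left inverse. -/
lemma IsHolEmbedding.exists_left_inverse {N : ℕ} {U : Set X} {ι : X → Cn N}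
    (hι : IsHolEmbedding U ι) {e : OpenPartialHomeomorph X (Cn n)} (he : IsHolChart e) {y : X}
    (hyU : y ∈ U) (hy : y ∈ e.source) :
    ∃ G : Cn N → Cn n, AnalyticAt ℂ G (ι y) ∧ ∀ᶠ z in 𝓝 (e y), G (ι (e.symm z)) = z := by
  have h : ∀ i, ∃ g : Cn N → ℂ, AnalyticAt ℂ g (ι y) ∧ (fun x => e x i) =ᶠ[𝓝 y] g ∘ ι :=
    fun i => (hι.germ_iff y hyU _).1 (he.holAt_coord hy i)
  choose g hg hge using h
  refine ⟨fun w => WithLp.toLp 2 fun i => g i w, analyticAt_cn_iff.2 fun i => hg i, ?_⟩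
  have hall : ∀ᶠ x in 𝓝 y, ∀ i, e x i = g i (ι x) := by
    rw [Filter.eventually_all]
    exact fun i => hge i
  filter_upwards [(tendsto_chart_symm e hy).eventually hall, eventually_chart_symm e hy]
    with z hz hz'
  ext i
  change g i (ι (e.symm z)) = z i
  rw [← hz i, hz'.2]

/-- The chain rule applied to a holomorphic left inverse. This immersion property makes the
restriction of the Fubini–Study form strictly positive. -/
lemma IsHolEmbedding.fderiv_injective {N : ℕ} {U : Set X} {ι : X → Cn N}
    (hι : IsHolEmbedding U ι) {e : OpenPartialHomeomorph X (Cn n)} (he : IsHolChart e) {y : X}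
    (hyU : y ∈ U) (hy : y ∈ e.source) :
    Function.Injective (fderiv ℝ (ι ∘ e.symm) (e y)) := by
  obtain ⟨G, hG, hGe⟩ := hι.exists_left_inverse he hyU hy
  have h1 : HasFDerivAt (ι ∘ e.symm) (fderiv ℝ (ι ∘ e.symm) (e y)) (e y) :=
    ((hι.analyticAt_chart he hyU hy).differentiableAt.restrictScalars ℝ).hasFDerivAt
  have hG' : AnalyticAt ℂ G ((ι ∘ e.symm) (e y)) := by
    simpa [e.left_inv hy] using hG
  have h2 : HasFDerivAt G (fderiv ℝ G ((ι ∘ e.symm) (e y))) ((ι ∘ e.symm) (e y)) :=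
    (hG'.differentiableAt.restrictScalars ℝ).hasFDerivAt
  have h3 := h2.comp (e y) h1
  have h4 : HasFDerivAt (G ∘ ι ∘ e.symm) (ContinuousLinearMap.id ℝ (Cn n)) (e y) := by
    refine (hasFDerivAt_id (e y)).congr_of_eventuallyEq ?_
    filter_upwards [hGe] with z hz using hz
  have h5 := h3.unique h4
  intro a b hab
  have := congrArg (fderiv ℝ G ((ι ∘ e.symm) (e y))) hab
  have ha := DFunLike.congr_fun h5 a
  have hb := DFunLike.congr_fun h5 b
  simp only [ContinuousLinearMap.comp_apply, ContinuousLinearMap.id_apply] at ha hb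
  rw [← ha, ← hb, this]

lemma isOpen_regularSet : IsOpen (regularSet n X) := by
  have : regularSet n X = ⋃ e ∈ {e : OpenPartialHomeomorph X (Cn n) | IsHolChart e}, e.source := by
    ext x; simp [regularSet]
  rw [this]
  exact isOpen_biUnion fun e _ => e.open_source

lemma IsHolChart.source_subset_regularSet {e : OpenPartialHomeomorph X (Cn n)}
    (he : IsHolChart e) : e.source ⊆ regularSet n X := fun _ hx => ⟨e, he, hx⟩

section Bihol

variable {Y : Type v} [TopologicalSpace Y] [ComplexSpace Y]

lemma IsBiholomorphism.symm_trans_chart {φ : OpenPartialHomeomorph Y X} (hφ : IsBiholomorphism φ)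
    {e : OpenPartialHomeomorph Y (Cn n)} (he : IsHolChart e) : IsHolChart (φ.symm.trans e) := by
  intro x hx f
  rw [OpenPartialHomeomorph.trans_source] at hx
  have hx1 : x ∈ φ.target := hx.1
  have hx2 : φ.symm x ∈ e.source := hx.2
  have h1 := hφ (φ.symm x) (φ.map_target hx1) f
  rw [φ.right_inv hx1] at h1
  rw [h1, he _ hx2]
  rfl

lemma IsBiholomorphism.trans_chart {φ : OpenPartialHomeomorph Y X} (hφ : IsBiholomorphism φ)
    {e : OpenPartialHomeomorph X (Cn n)} (he : IsHolChart e) : IsHolChart (φ.trans e) := by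
  intro y hy f
  rw [OpenPartialHomeomorph.trans_source] at hy
  have hy1 : y ∈ φ.source := hy.1
  have hy2 : φ y ∈ e.source := hy.2
  have h1 : f =ᶠ[𝓝 y] (f ∘ φ.symm) ∘ φ := by
    filter_upwards [φ.open_source.mem_nhds hy1] with x hx
    simp [φ.left_inv hx]
  rw [holAt_congr h1, ← hφ y hy1, he _ hy2]
  rfl

lemma IsBiholomorphism.map_regular {φ : OpenPartialHomeomorph Y X} (hφ : IsBiholomorphism φ)
    {y : Y} (hy : y ∈ φ.source) (hr : y ∈ regularSet n Y) : φ y ∈ regularSet n X := by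
  obtain ⟨e, he, hye⟩ := hr
  refine ⟨φ.symm.trans e, hφ.symm_trans_chart he, ?_⟩
  rw [OpenPartialHomeomorph.trans_source]
  exact ⟨φ.map_source hy, by simpa [φ.left_inv hy] using hye⟩

lemma IsBiholomorphism.restr {φ : OpenPartialHomeomorph Y X} (hφ : IsBiholomorphism φ)
    (s : Set Y) : IsBiholomorphism (φ.restr s) := by
  intro y hy f
  exact hφ y (by rw [OpenPartialHomeomorph.restr_source] at hy; exact hy.1) f

end Bihol

/-- `i∂∂̄` of a function transforms as a form under changes of charts. -/
lemma ddbar_chart_compat {f : X → ℝ} {e e' : OpenPartialHomeomorph X (Cn n)}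
    (he : IsHolChart e) (he' : IsHolChart e') {y : X} (hy : y ∈ e.source) (hy' : y ∈ e'.source)
    (hf : ContDiffAt ℝ ∞ (f ∘ e'.symm) (e' y)) :
    ddbar (f ∘ e.symm) (e y) = (ddbar (f ∘ e'.symm) (e' y)).compContinuousLinearMap
      (fderiv ℝ (e' ∘ e.symm) (e y)) := by
  have h1 : f ∘ e.symm =ᶠ[𝓝 (e y)] (f ∘ e'.symm) ∘ (e' ∘ e.symm) := by
    filter_upwards [(tendsto_chart_symm e hy).eventually (e'.open_source.mem_nhds hy')] with z hz
    simp [e'.left_inv hz]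
  have h2 : (e' ∘ e.symm) (e y) = e' y := by simp [e.left_inv hy]
  rw [ddbar_congr h1, ddbar_comp_holomorphic (he.analyticAt_transition he' hy hy')
    (by rw [h2]; exact hf.of_le two_le_infty), h2]

/-- Adding `i∂∂̄ f` to a Kähler form. -/
lemma IsKahlerOn.add_ddbar {W : Set X} {ω : FormFamily n X} (hω : IsKahlerOn W ω) {f : X → ℝ}
    (hf : ∀ e : OpenPartialHomeomorph X (Cn n), IsHolChart e → ∀ y ∈ W, y ∈ e.source →
      ContDiffAt ℝ ∞ (f ∘ e.symm) (e y))
    (hpos : ∀ e : OpenPartialHomeomorph X (Cn n), IsHolChart e → ∀ y ∈ W, y ∈ e.source →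
      ∀ a : Cn n, a ≠ 0 →
        0 < ω e (e y) ![a, Complex.I • a] + ddbar (f ∘ e.symm) (e y) ![a, Complex.I • a]) :
    IsKahlerOn W (fun e z => ω e z + ddbar (f ∘ e.symm) z) where
  compat e e' he he' y hyW hy hy' := by
    rw [hω.compat e e' he he' y hyW hy hy',
      ddbar_chart_compat he he' hy hy' (hf e' he' y hyW hy')]
    rfl
  kahler e he y hyW hy := by
    have hk := hω.kahler e he y hyW hy
    have hs := hf e he y hyW hy
    refine ⟨hk.smooth.add (ddbar_contDiffAt hs), ?_, ?_, hpos e he y hyW hy⟩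
    · rw [extDeriv_two_covector_add hk.smooth (ddbar_contDiffAt hs), hk.closed,
        extDeriv_ddbar hs, add_zero]
    · intro a b
      rw [ContinuousAlternatingMap.add_apply, ContinuousAlternatingMap.add_apply,
        hk.type_one_one, ddbar_type (hs.of_le two_le_infty)]

end Charts

end ConicalKahler

namespace ConicalKahler

/-! ### Geometry of the cone: the gradient of r and plurisubharmonic functions of r² -/

section Cone

open Set

attribute [local instance] CYCone.topL CYCone.t2L CYCone.compactL CYCone.nonemptyL
  CYCone.chartedL CYCone.manifoldL

variable {n : ℕ}

namespace CYCone

variable (C : CYCone.{v, w} n)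

/-- The cone coordinates `(t, x)` near a point, followed by a holomorphic chart. -/
noncomputable def localParam (e : OpenPartialHomeomorph C.Y (Cn n)) (x : C.L) :
    OpenPartialHomeomorph (ℝ × EuclideanSpace ℝ (Fin (2 * n - 1))) (Cn n) :=
  ((OpenPartialHomeomorph.refl ℝ).prod
    (chartAt (EuclideanSpace ℝ (Fin (2 * n - 1))) x).symm).trans (C.param.trans e)

/-- The passage from manifold calculus to normed spaces: smoothness and `mfderiv` of `e ∘ C.param`
become smoothness and the Fréchet derivative of `localParam`, to which the inverse function theorem
applies. -/
lemma writtenInExtChartAt_param (e : OpenPartialHomeomorph C.Y (Cn n)) (t : ℝ) (x : C.L) :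
    writtenInExtChartAt (𝓘(ℝ, ℝ).prod (𝓡 (2 * n - 1))) 𝓘(ℝ, Cn n) (t, x) (e ∘ C.param)
      = C.localParam e x := by
  funext p
  simp [writtenInExtChartAt, localParam, extChartAt]
  rfl

lemma mem_localParam_source {e : OpenPartialHomeomorph C.Y (Cn n)} {t : ℝ} {x : C.L} (ht : 0 < t)
    (hmem : C.param (t, x) ∈ e.source) :
    (t, chartAt (EuclideanSpace ℝ (Fin (2 * n - 1))) x x) ∈ (C.localParam e x).source := by
  simp [localParam, C.param_source, ht, hmem]

lemma localParam_apply {e : OpenPartialHomeomorph C.Y (Cn n)} {t : ℝ} {x : C.L} :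
    C.localParam e x (t, chartAt (EuclideanSpace ℝ (Fin (2 * n - 1))) x x)
      = e (C.param (t, x)) := by
  simp [localParam]

lemma r_localParam {e : OpenPartialHomeomorph C.Y (Cn n)} {x : C.L}
    {p : ℝ × EuclideanSpace ℝ (Fin (2 * n - 1))} (hp : p ∈ (C.localParam e x).source) :
    C.r (e.symm (C.localParam e x p)) = p.1 := by
  simp [localParam, C.param_source] at hp
  simp only [localParam, OpenPartialHomeomorph.coe_trans, Function.comp_apply]
  rw [e.left_inv (by simpa using hp.2.2)]
  exact C.r_param _ _ hp.2.1

lemma contDiffAt_localParam {e : OpenPartialHomeomorph C.Y (Cn n)} (he : IsHolChart e) {t : ℝ}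
    {x : C.L} (ht : 0 < t) (hmem : C.param (t, x) ∈ e.source) :
    ContDiffAt ℝ ∞ (C.localParam e x)
      (t, chartAt (EuclideanSpace ℝ (Fin (2 * n - 1))) x x) := by
  have h := (contMDiffAt_iff.1 (C.param_smooth e he t x ht hmem)).2
  have h2 := C.writtenInExtChartAt_param e t x
  rw [writtenInExtChartAt] at h2
  rw [h2] at h
  have hr : range (𝓘(ℝ, ℝ).prod (𝓡 (2 * n - 1))) = univ :=
    ModelWithCorners.range_eq_univ _
  rw [hr, contDiffWithinAt_univ] at h
  exact h

lemma hasFDerivAt_localParam {e : OpenPartialHomeomorph C.Y (Cn n)} (he : IsHolChart e) {t : ℝ}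
    {x : C.L} (ht : 0 < t) (hmem : C.param (t, x) ∈ e.source) :
    HasFDerivAt (C.localParam e x)
      (mfderiv (𝓘(ℝ, ℝ).prod (𝓡 (2 * n - 1))) 𝓘(ℝ, Cn n) (e ∘ C.param) (t, x) :
        ℝ × EuclideanSpace ℝ (Fin (2 * n - 1)) →L[ℝ] Cn n)
      (t, chartAt (EuclideanSpace ℝ (Fin (2 * n - 1))) x x) := by
  have hmd := (C.param_smooth e he t x ht hmem).mdifferentiableAt (by simp)
  have hr : range (𝓘(ℝ, ℝ).prod (𝓡 (2 * n - 1))) = univ :=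
    ModelWithCorners.range_eq_univ _
  have h := hmd.mfderiv
  rw [hr, fderivWithin_univ, C.writtenInExtChartAt_param e t x] at h
  rw [h]
  exact ((C.contDiffAt_localParam he ht hmem).differentiableAt (by simp)).hasFDerivAt

end CYCone

/-- Bessel's inequality for the pair `ν, Jν`. -/
lemma bessel_complex_line {η : TwoCovector n}
    (htype : ∀ a b : Cn n, η ![Complex.I • a, Complex.I • b] = η ![a, b])
    (hpos : ∀ a : Cn n, 0 ≤ η ![a, Complex.I • a]) {ν : Cn n}
    (hν : (1 / 2 : ℝ) * η ![ν, Complex.I • ν] = 1) (v : Cn n) :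
    ((1 / 2 : ℝ) * η ![ν, Complex.I • v]) ^ 2
      + ((1 / 2 : ℝ) * η ![ν, Complex.I • Complex.I • v]) ^ 2
      ≤ (1 / 2 : ℝ) * η ![v, Complex.I • v] := by
  set B := bilCLM n η with hB
  have hBη : ∀ a b, η ![a, b] = B a b := fun a b => (bilCLM_apply η a b).symm
  have hsw : ∀ a b, B a b = -B b a := fun a b => by
    rw [← hBη, ← hBη, twoCovector_swap]
  have hsm : ∀ (c : ℝ) (a : Cn n), Complex.I • (c • a) = c • (Complex.I • a) := fun c a =>
    smul_comm _ _ _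
  simp only [hBη, I_smul_I_smul] at *
  set α := (1 / 2 : ℝ) * B ν (Complex.I • v)
  set β := (1 / 2 : ℝ) * B ν (-v)
  -- With g = ½ η(·, J·), this vector is v minus its g-orthogonal projection to the span of ν and
  -- Jν. The coefficient along Jν is g(v, Jν) = -g(Jv, ν) = -β.
  have h0 := hpos (v - α • ν + β • (Complex.I • ν))
  simp only [smul_add, smul_sub, hsm, I_smul_I_smul, map_add, map_sub, map_smul, map_neg,
    add_apply, sub_apply, smul_apply, smul_eq_mul, smul_neg] at h0
  have e1 : B ν (Complex.I • v) = 2 * α := by simp [α]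
  have e2 : B ν v = -2 * β := by simp [β]
  have e3 : B v ν = 2 * β := by rw [hsw, e2]; ring
  have e4 : B v (Complex.I • ν) = 2 * α := by
    have := htype v (Complex.I • ν)
    rw [I_smul_I_smul, map_neg, hsw, neg_neg] at this
    rw [← this, e1]
  have e5 : B (Complex.I • ν) (Complex.I • v) = -2 * β := by rw [htype, e2]
  have e6 : B ν ν = 0 := by have := hsw ν ν; linarith
  have e7 : B (Complex.I • ν) (Complex.I • ν) = 0 := by rw [htype, e6]
  have e8 : B (Complex.I • ν) ν = -2 := by rw [hsw]; linarith
  have e9 : B ν (Complex.I • ν) = 2 := by linarith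
  simp only [e1, e3, e4, e5, e6, e7, e8, e9] at h0
  nlinarith

namespace CYCone

variable (C : CYCone.{v, w} n)

lemma exists_param {y : C.Y} (hy : y ≠ C.o) : ∃ t x, 0 < t ∧ C.param (t, x) = y := by
  have hy' : y ∈ C.param.target := by rw [C.param_target]; exact hy
  have h := C.param.map_target hy'
  rw [C.param_source] at h
  exact ⟨(C.param.symm y).1, (C.param.symm y).2, h.1, C.param.right_inv hy'⟩

lemma r_pos {y : C.Y} (hy : y ≠ C.o) : 0 < C.r y := by
  obtain ⟨t, x, ht, rfl⟩ := C.exists_param hy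
  rwa [C.r_param t x ht]

lemma r_nonneg (y : C.Y) : 0 ≤ C.r y := by
  by_cases hy : y = C.o
  · rw [hy, C.r_apex]
  · exact (C.r_pos hy).le

/-- The metric dt² + t² g_L is positive definite, so the differential D of the cone coordinates is
injective. By equality of dimensions it is invertible, and r is the first component of a smooth
local inverse. Its gradient is the unit vector N = D(1, 0), so dr(v) = g(N, v), and the inequality
is Bessel's for N and JN. -/
lemma smooth_and_gradient {e : OpenPartialHomeomorph C.Y (Cn n)} (he : IsHolChart e) {y : C.Y}
    (hy : y ∈ e.source) (hyo : y ≠ C.o) :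
    ContDiffAt ℝ ∞ (C.r ∘ e.symm) (e y) ∧ ∀ v : Cn n,
      (fderiv ℝ (C.r ∘ e.symm) (e y) v) ^ 2 + (fderiv ℝ (C.r ∘ e.symm) (e y) (Complex.I • v)) ^ 2
        ≤ (1 / 2 : ℝ) * C.ω e (e y) ![v, Complex.I • v] := by
  obtain ⟨t, x, ht, rfl⟩ := C.exists_param hyo
  have hk := C.kahler.kahler e he _ hyo hy
  set P := C.localParam e x with hP
  set q : ℝ × EuclideanSpace ℝ (Fin (2 * n - 1)) :=
    (t, chartAt (EuclideanSpace ℝ (Fin (2 * n - 1))) x x) with hq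
  set D : ℝ × EuclideanSpace ℝ (Fin (2 * n - 1)) →L[ℝ] Cn n :=
    mfderiv (𝓘(ℝ, ℝ).prod (𝓡 (2 * n - 1))) 𝓘(ℝ, Cn n) (e ∘ C.param) (t, x) with hD
  have hqs : q ∈ P.source := C.mem_localParam_source ht hy
  have hPq : P q = e (C.param (t, x)) := C.localParam_apply
  have hPc : ContDiffAt ℝ ∞ P q := C.contDiffAt_localParam he ht hy
  have hPd : HasFDerivAt P D q := C.hasFDerivAt_localParam he ht hy
  have hiso : ∀ (a b : ℝ) (ξ ζ : EuclideanSpace ℝ (Fin (2 * n - 1))),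
      (1 / 2 : ℝ) * C.ω e (e (C.param (t, x))) ![D (a, ξ), Complex.I • D (b, ζ)] =
        a * b + t ^ 2 * C.gL.inner x ξ ζ := fun a b ξ ζ => C.param_isometry e he t x ht hy a b ξ ζ
  have hinj : Function.Injective D := by
    rw [injective_iff_map_eq_zero]
    rintro ⟨a, ξ⟩ h
    have h1 := hiso a a ξ ξ
    rw [h] at h1
    have h2 : C.ω e (e (C.param (t, x))) ![(0 : Cn n), Complex.I • (0 : Cn n)] = 0 := by
      rw [← bilCLM_apply]; simp
    rw [h2, mul_zero] at h1
    have hξ : ξ = 0 := by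
      by_contra hne
      have h3 := C.gL.pos x ξ hne
      nlinarith [mul_pos (pow_pos ht 2) h3, mul_self_nonneg a]
    subst hξ
    have h4 : a = 0 := by
      have h5 : C.gL.inner x (0 : EuclideanSpace ℝ (Fin (2 * n - 1))) = 0 :=
        (C.gL.inner x).map_zero
      have h6 : C.gL.inner x (0 : EuclideanSpace ℝ (Fin (2 * n - 1)))
        (0 : EuclideanSpace ℝ (Fin (2 * n - 1))) = 0 := by rw [h5]; rfl
      rw [h6] at h1
      nlinarith
    rw [h4]; rfl
  have hfin : Module.finrank ℝ (ℝ × EuclideanSpace ℝ (Fin (2 * n - 1)))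
      = Module.finrank ℝ (Cn n) := by
    have h1 : Module.finrank ℝ (Cn n) = 2 * n := by
      have := Module.finrank_mul_finrank ℝ ℂ (Cn n)
      rw [← this]; simp
    rw [h1, Module.finrank_prod]
    -- With truncated subtraction, 1 + (2n - 1) = 2n requires n > 0.
    have := C.n_pos
    simp
    omega
  have hbij : Function.Bijective D :=
    ⟨hinj, (LinearMap.injective_iff_surjective_of_finrank_eq_finrank (f := D.toLinearMap) hfin).1
      hinj⟩
  let D' : (ℝ × EuclideanSpace ℝ (Fin (2 * n - 1))) ≃L[ℝ] Cn n :=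
    (LinearEquiv.ofBijective D.toLinearMap hbij).toContinuousLinearEquiv
  have hD' : (D' : ℝ × EuclideanSpace ℝ (Fin (2 * n - 1)) →L[ℝ] Cn n) = D := by
    ext v <;> rfl
  have hinv : P.symm (P q) = q := P.left_inv hqs
  have hsymm : ContDiffAt ℝ ∞ P.symm (P q) :=
    P.contDiffAt_symm (f₀' := D') (P.map_source hqs) (by rw [hinv, hD']; exact hPd)
      (by rw [hinv]; exact hPc)
  have hee : C.r ∘ e.symm =ᶠ[𝓝 (P q)] fun z => (P.symm z).1 := by
    filter_upwards [P.open_target.mem_nhds (P.map_source hqs)] with z hz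
    have := C.r_localParam (P.map_target hz)
    rw [← hP, P.right_inv hz] at this
    exact this
  have hsm : ContDiffAt ℝ ∞ (C.r ∘ e.symm) (P q) :=
    (contDiff_fst.contDiffAt.comp _ hsymm).congr_of_eventuallyEq hee
  have hdr : ∀ p, fderiv ℝ (C.r ∘ e.symm) (P q) (D p) = p.1 := by
    intro p
    have h1 := ((hsm.differentiableAt (by simp)).hasFDerivAt).comp q hPd
    have h2 : HasFDerivAt ((C.r ∘ e.symm) ∘ P)
        (ContinuousLinearMap.fst ℝ ℝ (EuclideanSpace ℝ (Fin (2 * n - 1)))) q := by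
      refine hasFDerivAt_fst.congr_of_eventuallyEq ?_
      filter_upwards [P.open_source.mem_nhds hqs] with p hp
      exact C.r_localParam hp
    exact DFunLike.congr_fun (h1.unique h2) p
  rw [← hPq]
  refine ⟨hsm, ?_⟩
  set N := D (1, 0) with hN
  have hN1 : (1 / 2 : ℝ) * C.ω e (P q) ![N, Complex.I • N] = 1 := by
    rw [hPq, hN, hiso]
    have h5 : C.gL.inner x (0 : EuclideanSpace ℝ (Fin (2 * n - 1))) = 0 :=
      (C.gL.inner x).map_zero
    have h6 : C.gL.inner x (0 : EuclideanSpace ℝ (Fin (2 * n - 1)))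
      (0 : EuclideanSpace ℝ (Fin (2 * n - 1))) = 0 := by rw [h5]; rfl
    rw [h6]; ring
  have hgrad : ∀ v, fderiv ℝ (C.r ∘ e.symm) (P q) v =
      (1 / 2 : ℝ) * C.ω e (P q) ![N, Complex.I • v] := by
    intro v
    obtain ⟨⟨b, ζ⟩, rfl⟩ := hbij.2 v
    rw [hdr, hPq, hN, hiso]
    have h5 : C.gL.inner x (0 : EuclideanSpace ℝ (Fin (2 * n - 1))) = 0 :=
      (C.gL.inner x).map_zero
    have h6 : C.gL.inner x (0 : EuclideanSpace ℝ (Fin (2 * n - 1))) ζ = 0 := by rw [h5]; rfl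
    rw [h6]; ring
  intro v
  rw [hgrad, hgrad]
  rw [← hPq] at hk
  refine bessel_complex_line hk.type_one_one ?_ hN1 v
  intro a
  by_cases ha : a = 0
  · rw [ha, ← bilCLM_apply]; simp
  · exact (hk.pos a ha).le

/-- Functions `h(r²)` with `h' > 0` and `h' + t h'' > 0` are strictly plurisubharmonic on a
Kähler cone. -/
lemma ddbar_comp_r_sq_pos {e : OpenPartialHomeomorph C.Y (Cn n)} (he : IsHolChart e) {y : C.Y}
    (hy : y ∈ e.source) (hyo : y ≠ C.o) {h : ℝ → ℝ} (hh : ContDiff ℝ ∞ h)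
    (h1 : ∀ t, 0 < t → 0 < deriv h t ∧ 0 < deriv h t + t * deriv (deriv h) t) {v : Cn n}
    (hv : v ≠ 0) :
    0 < ddbar (fun z => h (C.r (e.symm z) ^ 2)) (e y) ![v, Complex.I • v] := by
  obtain ⟨hsm, hgrad⟩ := C.smooth_and_gradient he hy hyo
  have hu : ContDiffAt ℝ ∞ (fun z => C.r (e.symm z) ^ 2) (e y) := hsm.pow 2
  have hd : ∀ w, fderiv ℝ (fun z => C.r (e.symm z) ^ 2) (e y) w
      = 2 * C.r y * fderiv ℝ (C.r ∘ e.symm) (e y) w := by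
    intro w
    have h2 : HasFDerivAt (fun z => C.r (e.symm z) ^ 2) _ (e y) :=
      (hsm.differentiableAt (by simp)).hasFDerivAt.pow 2
    rw [h2.fderiv]
    simp [e.left_inv hy]
  rw [ddbar_comp_real_apply_I (hu.of_le two_le_infty) (hh.contDiffAt.of_le two_le_infty),
    ← C.potential e he y hy hyo, hd, hd, e.left_inv hy]
  have hr : 0 < C.r y := C.r_pos hyo
  have hp := (C.kahler.kahler e he y hyo hy).pos v hv
  have hg := hgrad v
  obtain ⟨k1, k2⟩ := h1 (C.r y ^ 2) (by positivity)
  set A := fderiv ℝ (C.r ∘ e.symm) (e y) v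
  set A' := fderiv ℝ (C.r ∘ e.symm) (e y) (Complex.I • v)
  set G := C.ω e (e y) ![v, Complex.I • v]
  set d1 := deriv h (C.r y ^ 2)
  set d2 := deriv (deriv h) (C.r y ^ 2)
  -- The gradient bound A² + A'² ≤ G/2 matters only when h'' < 0. It then bounds the expression
  -- below by (h' + r² h'') G, which is positive.
  have hrw : d1 * G + 1 / 2 * d2 * ((2 * C.r y * A) ^ 2 + (2 * C.r y * A') ^ 2) =
      d1 * G + 2 * (C.r y ^ 2 * d2) * (A ^ 2 + A' ^ 2) := by ring
  rw [hrw]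
  rcases le_or_gt 0 d2 with h3 | h3
  · have := mul_pos k1 hp
    positivity
  · have h4 : C.r y ^ 2 * d2 ≤ 0 := mul_nonpos_of_nonneg_of_nonpos (by positivity) h3.le
    have h5 := mul_pos k2 hp
    nlinarith [mul_le_mul_of_nonpos_left hg h4]

end CYCone

end Cone

end ConicalKahler

namespace ConicalKahler

/-! ### Topology of the cone near its apex -/

section ConeTopology

open Set

attribute [local instance] CYCone.topL CYCone.t2L CYCone.compactL CYCone.nonemptyL
  CYCone.chartedL CYCone.manifoldL

variable {n : ℕ}

namespace CYCone

variable (C : CYCone.{v, w} n)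

lemma continuous_r : Continuous C.r := by
  rw [continuous_iff_continuousAt]
  intro y
  by_cases hy : y = C.o
  · subst hy
    rw [ContinuousAt, C.r_apex, Metric.tendsto_nhds]
    intro ε hε
    filter_upwards [C.apex_nhds.mem_of_mem hε] with y hy
    rw [Real.dist_eq, sub_zero, abs_of_nonneg (C.r_nonneg y)]
    exact hy
  · have hy' : y ∈ C.param.target := by rw [C.param_target]; exact hy
    have h1 : ContinuousAt (fun z => (C.param.symm z).1) y :=
      continuous_fst.continuousAt.comp (C.param.continuousAt_symm hy')
    refine h1.congr ?_
    filter_upwards [C.param.open_target.mem_nhds hy'] with z hz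
    have h2 := C.param.map_target hz
    rw [C.param_source] at h2
    have := C.r_param (C.param.symm z).1 (C.param.symm z).2 h2.1
    rw [← this]
    congr 1
    exact C.param.right_inv hz

/-- The closed ball is the image of the compact [0, δ] × L under the cone coordinates, extended by
collapsing {0} × L to the apex. The extension is continuous because the sets r < ε form a
neighbourhood basis of the apex. -/
lemma isCompact_r_le {δ : ℝ} (hδ : 0 < δ) : IsCompact {y : C.Y | C.r y ≤ δ} := by
  classical
  let Q : ℝ × C.L → C.Y := fun p => if 0 < p.1 then C.param p else C.o
  have hrQ : ∀ p : ℝ × C.L, 0 ≤ p.1 → C.r (Q p) = p.1 := by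
    intro p hp
    by_cases h : 0 < p.1
    · simp only [Q, if_pos h]; exact C.r_param p.1 p.2 h
    · simp only [Q, if_neg h, C.r_apex]; linarith
  have hQ : ContinuousOn Q (Icc 0 δ ×ˢ univ) := by
    rintro ⟨t, x⟩ ⟨⟨ht0, -⟩, -⟩
    rcases eq_or_lt_of_le ht0 with h | h
    · have ht : t = 0 := h.symm
      subst ht
      have hQ0 : Q ((0 : ℝ), x) = C.o := by simp [Q]
      rw [ContinuousWithinAt, hQ0, C.apex_nhds.tendsto_right_iff]
      intro ε hε
      have h1 : ∀ᶠ p : ℝ × C.L in 𝓝[Icc 0 δ ×ˢ univ] ((0 : ℝ), x), p.1 < ε := by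
        refine nhdsWithin_le_nhds ?_
        have h2 : ContinuousAt (Prod.fst : ℝ × C.L → ℝ) ((0 : ℝ), x) := continuousAt_fst
        exact h2.eventually (gt_mem_nhds hε)
      filter_upwards [h1, self_mem_nhdsWithin] with p hp hpm
      rw [hrQ p hpm.1.1]
      exact hp
    · have h1 : ContinuousAt C.param (t, x) := by
        refine C.param.continuousAt ?_
        rw [C.param_source]; exact ⟨h, trivial⟩
      refine ContinuousAt.continuousWithinAt (h1.congr ?_)
      have h2 : ContinuousAt (Prod.fst : ℝ × C.L → ℝ) (t, x) := continuousAt_fst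
      filter_upwards [h2.eventually (lt_mem_nhds h)] with p hp
      simp [Q, hp]
  have himg : {y : C.Y | C.r y ≤ δ} = Q '' (Icc 0 δ ×ˢ univ) := by
    ext y
    constructor
    · intro hy
      by_cases hyo : y = C.o
      · exact ⟨(0, Classical.arbitrary C.L), ⟨⟨le_rfl, hδ.le⟩, trivial⟩, by simp [Q, hyo]⟩
      · obtain ⟨t, x, ht, rfl⟩ := C.exists_param hyo
        rw [mem_ofPred_eq, C.r_param t x ht] at hy
        exact ⟨(t, x), ⟨⟨ht.le, hy⟩, trivial⟩, by simp [Q, ht]⟩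
    · rintro ⟨p, ⟨hp, -⟩, rfl⟩
      rw [mem_ofPred_eq, hrQ p hp.1]
      exact hp.2
  rw [himg]
  exact (isCompact_Icc.prod isCompact_univ).image_of_continuousOn hQ

end CYCone

end ConeTopology

/-! ### Gluing in the cone metric near one singular point -/

section Gluing

open Set

variable {X : Type u} [TopologicalSpace X] [ComplexSpace X] {n : ℕ}

lemma IsHolEmbedding.continuousAt {N : ℕ} {U : Set X} {ι : X → Cn N} (hι : IsHolEmbedding U ι)
    {x : X} (hx : x ∈ U) : ContinuousAt ι x := by
  have h : ContinuousOn ι U := continuousOn_iff_continuous_domRestrict.2 hι.isEmbedding.continuous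
  exact h.continuousAt (hι.isOpen.mem_nhds hx)

lemma IsHolEmbedding.injOn {N : ℕ} {U : Set X} {ι : X → Cn N} (hι : IsHolEmbedding U ι) :
    InjOn ι U := injOn_iff_injective.2 hι.isEmbedding.injective

/-- The pull-back of a form with potential `ϕ` has potential `ϕ ∘ ι`. -/
lemma IsRestrictionOn.eq_ddbar {N : ℕ} {U : Set X} {ι : X → Cn N} {η : Cn N → TwoCovector N}
    {ω : FormFamily n X} (hr : IsRestrictionOn U ι η ω) (hι : IsHolEmbedding U ι)
    {ϕ : Cn N → ℝ} {y : X} (hyU : y ∈ U) (hϕ : ContDiffAt ℝ ∞ ϕ (ι y))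
    (hη : ddbar ϕ (ι y) = η (ι y)) {e : OpenPartialHomeomorph X (Cn n)} (he : IsHolChart e)
    (hy : y ∈ e.source) :
    ContDiffAt ℝ ∞ (fun z => ϕ (ι (e.symm z))) (e y) ∧
      ω e (e y) = ddbar (fun z => ϕ (ι (e.symm z))) (e y) := by
  have han := hι.analyticAt_chart he hyU hy
  have hval : (ι ∘ e.symm) (e y) = ι y := by simp [e.left_inv hy]
  constructor
  · exact ContDiffAt.comp (e y) (f := ι ∘ e.symm) (by rw [hval]; exact hϕ)
      (analyticAt_contDiffAt_real han)
  · rw [hr e he y hyU hy, ← hη, ← hval]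
    exact (ddbar_comp_holomorphic han (by rw [hval]; exact hϕ.of_le two_le_infty)).symm

/-- Gluing a cone metric into a smoothly Kähler metric near one singular point. -/
lemma exists_local_modification [T2Space X] {ω : FormFamily n X} (hω : IsSmoothlyKahler ω)
    {p : X} (hp : p ∈ singularSet n X) {C : CYCone.{v, w} n} {φ : OpenPartialHomeomorph C.Y X}
    (hφ : IsConeChart C p φ) {V : Set X} (hV : V ∈ 𝓝 p) :
    ∃ (f : X → ℝ) (K : Set X), IsClosed K ∧ K ⊆ V ∧ (∀ x, x ∉ K → f x = 0) ∧
      (∀ e : OpenPartialHomeomorph X (Cn n), IsHolChart e → ∀ y ∈ e.source,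
        ContDiffAt ℝ ∞ (f ∘ e.symm) (e y) ∧ ∀ a : Cn n, a ≠ 0 →
          0 < ω e (e y) ![a, Complex.I • a] + ddbar (f ∘ e.symm) (e y) ![a, Complex.I • a]) ∧
      ∃ δ > 0, ∀ y : C.Y, y ≠ C.o → C.r y < δ → y ∈ φ.source ∧ φ y ∈ V ∧
        ∀ e : OpenPartialHomeomorph X (Cn n), IsHolChart e → φ y ∈ e.source →
          ω e (e (φ y)) + ddbar (f ∘ e.symm) (e (φ y)) = C.ω (φ.trans e) (e (φ y)) := by
  classical
  obtain ⟨N, U, ι, Ω, η, hpU, hι, hΩ, hmaps, hηΩ, hres⟩ := hω.local_restriction p hp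
  obtain ⟨ϕ, hϕ, hϕ0, hϕev⟩ := exists_local_potential (η := η) (z₀ := ι p) (by
    filter_upwards [hΩ.mem_nhds (hmaps hpU)] with z hz using hηΩ z hz)
  have hφo : φ C.o = p := hφ.map_apex
  have hφcont : Filter.Tendsto φ (𝓝 C.o) (𝓝 p) := by
    have := φ.continuousAt hφ.apex_mem
    rwa [ContinuousAt, hφo] at this
  -- a neighbourhood of the apex on which everything is defined
  have hgood : ∀ᶠ y in 𝓝 C.o, y ∈ φ.source ∧ φ y ∈ U ∧ φ y ∈ V ∧
      ddbar ϕ (ι (φ y)) = η (ι (φ y)) ∧ (ι (φ y) ≠ ι p → 0 < ϕ (ι (φ y))) := by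
    filter_upwards [φ.open_source.mem_nhds hφ.apex_mem,
      hφcont.eventually (hι.isOpen.mem_nhds hpU), hφcont.eventually hV,
      hφcont.eventually ((hι.continuousAt hpU).eventually hϕev)] with y h1 h2 h3 h4
    exact ⟨h1, h2, h3, h4.1, h4.2⟩
  obtain ⟨δ₀, hδ₀, hsub⟩ := C.apex_nhds.mem_iff.1 hgood
  set δ := δ₀ / 2 with hδ
  have hδp : 0 < δ := by positivity
  have hin : ∀ y : C.Y, C.r y ≤ δ → y ∈ φ.source ∧ φ y ∈ U ∧ φ y ∈ V ∧
      ddbar ϕ (ι (φ y)) = η (ι (φ y)) ∧ (y ≠ C.o → 0 < ϕ (ι (φ y))) := by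
    intro y hy
    obtain ⟨h1, h2, h3, h4, h5⟩ := hsub (show C.r y < δ₀ by linarith)
    refine ⟨h1, h2, h3, h4, fun hyo => h5 fun heq => hyo ?_⟩
    have := hι.injOn h2 hpU heq
    rw [← hφo] at this
    exact φ.injOn h1 hφ.apex_mem this
  have hcontψ : ∀ y : C.Y, C.r y ≤ δ → ContinuousAt (fun y => ϕ (ι (φ y))) y := by
    intro y hy
    obtain ⟨h1, h2, -⟩ := hin y hy
    exact (hϕ.continuous.continuousAt.comp (f := ι) (hι.continuousAt h2)).comp (f := φ)
      (φ.continuousAt h1)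
  -- a positive lower bound for the potential on an annulus
  obtain ⟨m, hm, hmle⟩ : ∃ m > 0, ∀ y : C.Y, δ / 2 ≤ C.r y → C.r y ≤ δ → m ≤ ϕ (ι (φ y)) := by
    have hcomp : IsCompact {y : C.Y | δ / 2 ≤ C.r y ∧ C.r y ≤ δ} := by
      have h1 := (C.isCompact_r_le hδp).inter_right
        (isClosed_le continuous_const C.continuous_r : IsClosed {y : C.Y | δ / 2 ≤ C.r y})
      convert h1 using 1
      ext y; simp [and_comm]
    rcases eq_empty_or_nonempty {y : C.Y | δ / 2 ≤ C.r y ∧ C.r y ≤ δ} with he | hne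
    · refine ⟨1, one_pos, fun y h1 h2 => ?_⟩
      have : y ∈ {y : C.Y | δ / 2 ≤ C.r y ∧ C.r y ≤ δ} := ⟨h1, h2⟩
      rw [he] at this
      exact this.elim
    · obtain ⟨y₀, hy₀, hmin⟩ := hcomp.exists_isMinOn hne
        (fun y hy => (hcontψ y hy.2).continuousWithinAt)
      refine ⟨ϕ (ι (φ y₀)), (hin y₀ hy₀.2).2.2.2.2 ?_, fun y h1 h2 => hmin ⟨h1, h2⟩⟩
      rintro rfl
      have := hy₀.1
      rw [C.r_apex] at this
      linarith
  -- The choice of quarters: with h ≤ m/4, on the annulus w ≥ m - m/4 - m/4 ≥ κ, so k(w) = 0. Near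
  -- the apex ϕ < m/4 and h(r²) = r² ≥ 0 give w ≤ 0, so k(w) = c - w.
  obtain ⟨k, hk, hk0, ⟨c, hkc⟩, hk1, hk2⟩ := exists_regularized_max (κ := m / 4) (by positivity)
  obtain ⟨h, hh, ⟨ε, hε, hhε⟩, hh1, hhT⟩ := exists_slow_potential (T := δ ^ 2) (m := m / 4)
    (by positivity) (by positivity)
  set w : X → ℝ := fun x => ϕ (ι x) - (h (C.r (φ.symm x) ^ 2) + m / 4) with hw
  set f : X → ℝ := fun x => if x ∈ φ.target ∧ C.r (φ.symm x) < δ then k (w x) else 0 with hf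
  -- K is compact, hence closed in the Hausdorff space X. Since f vanishes off K, the cut at r = δ
  -- in its definition creates no singularity.
  set K : Set X := φ '' {y : C.Y | C.r y ≤ δ / 2} with hK
  have hKsub : {y : C.Y | C.r y ≤ δ / 2} ⊆ φ.source := fun y hy =>
    (hin y (by have : C.r y ≤ δ / 2 := hy; linarith)).1
  have hKclosed : IsClosed K :=
    ((C.isCompact_r_le (by positivity)).image_of_continuousOn
      (φ.continuousOn.mono hKsub)).isClosed
  have hfK : ∀ x, x ∉ K → f x = 0 := by
    intro x hx
    by_cases hxB : x ∈ φ.target ∧ C.r (φ.symm x) < δ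
    · simp only [hf, if_pos hxB]
      have h1 : δ / 2 ≤ C.r (φ.symm x) := by
        by_contra hlt
        exact hx ⟨φ.symm x, (not_le.1 hlt).le, φ.right_inv hxB.1⟩
      have h2 := hmle _ h1 hxB.2.le
      rw [φ.right_inv hxB.1] at h2
      have hrpos : 0 < C.r (φ.symm x) := by linarith
      have h3 := hhT (C.r (φ.symm x) ^ 2) (by positivity) (by gcongr; exact hxB.2.le)
      refine hk0 _ ?_
      simp only [hw]
      linarith
    · simp only [hf, if_neg hxB]
  set Bset : Set X := {x | x ∈ φ.target ∧ C.r (φ.symm x) < δ} with hBset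
  have hBopen : IsOpen Bset := by
    have := φ.symm.isOpen_inter_preimage (s := {y : C.Y | C.r y < δ})
      (isOpen_lt C.continuous_r continuous_const)
    exact this
  -- smoothness and potentials at the points of the ball
  have hball : ∀ e : OpenPartialHomeomorph X (Cn n), IsHolChart e → ∀ y : C.Y, y ≠ C.o →
      C.r y < δ → φ y ∈ e.source →
      IsHolChart (φ.trans e) ∧ y ∈ (φ.trans e).source ∧
      ContDiffAt ℝ ∞ (fun z => C.r ((φ.trans e).symm z) ^ 2) (e (φ y)) ∧
      ContDiffAt ℝ ∞ (fun z => ϕ (ι (e.symm z))) (e (φ y)) ∧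
      ω e (e (φ y)) = ddbar (fun z => ϕ (ι (e.symm z))) (e (φ y)) := by
    intro e he y hyo hyδ hye
    obtain ⟨h1, h2, -, h4, -⟩ := hin y hyδ.le
    have hE : IsHolChart (φ.trans e) := hφ.biholomorphism.trans_chart he
    have hyE : y ∈ (φ.trans e).source := by
      rw [OpenPartialHomeomorph.trans_source]; exact ⟨h1, hye⟩
    obtain ⟨h5, h6⟩ := hres.eq_ddbar hι h2 hϕ.contDiffAt h4 he hye
    exact ⟨hE, hyE, (C.smooth_and_gradient hE hyE hyo).1.pow 2, h5, h6⟩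
  have hne : ∀ y : C.Y, φ y ∈ regularSet n X → y ≠ C.o := by
    rintro y hy rfl
    rw [hφo] at hy
    exact hp hy
  refine ⟨f, K, hKclosed, ?_, hfK, ?_, ?_⟩
  · rintro x ⟨y, hy, rfl⟩
    exact (hin y (by have : C.r y ≤ δ / 2 := hy; linarith)).2.2.1
  · intro e he x hx
    have hωpos : ∀ a : Cn n, a ≠ 0 → 0 < ω e (e x) ![a, Complex.I • a] :=
      (hω.kahler.kahler e he x (he.source_subset_regularSet hx) hx).pos
    by_cases hxB : x ∈ Bset
    · obtain ⟨y, hyS, rfl⟩ : ∃ y, y ∈ φ.source ∧ φ y = x :=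
        ⟨φ.symm x, φ.map_target hxB.1, φ.right_inv hxB.1⟩
      have hyo : y ≠ C.o := hne y (he.source_subset_regularSet hx)
      have hyδ : C.r y < δ := by
        have := hxB.2
        rwa [φ.left_inv hyS] at this
      obtain ⟨hE, hyE, hr2, hψ, hωψ⟩ := hball e he y hyo hyδ hx
      have hee : f ∘ e.symm =ᶠ[𝓝 (e (φ y))] fun z => k (ϕ (ι (e.symm z)) -
          (h (C.r ((φ.trans e).symm z) ^ 2) + m / 4)) := by
        filter_upwards [(tendsto_chart_symm e hx).eventually (hBopen.mem_nhds hxB)] with z hz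
        have hz' : e.symm z ∈ φ.target ∧ C.r (φ.symm (e.symm z)) < δ := hz
        simp only [hf, Function.comp_apply, if_pos hz', hw]
        rfl
      have hhr : ContDiffAt ℝ ∞ (fun z => h (C.r ((φ.trans e).symm z) ^ 2)) (e (φ y)) :=
        hh.contDiffAt.comp _ hr2
      have hy2 : ContDiffAt ℝ ∞ (fun z => h (C.r ((φ.trans e).symm z) ^ 2) + m / 4) (e (φ y)) :=
        hhr.add contDiffAt_const
      have hwd : ContDiffAt ℝ ∞ (fun z => ϕ (ι (e.symm z)) -
          (h (C.r ((φ.trans e).symm z) ^ 2) + m / 4)) (e (φ y)) := hψ.sub hy2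
      refine ⟨(hk.contDiffAt.comp _ hwd).congr_of_eventuallyEq hee, ?_⟩
      intro a ha
      have hω1 := hωpos a ha
      rw [ddbar_congr hee, ddbar_comp_real_apply_I (hwd.of_le two_le_infty)
        (hk.contDiffAt.of_le two_le_infty), ddbar_sub (hψ.of_le two_le_infty)
        (hy2.of_le two_le_infty), ddbar_add (hhr.of_le two_le_infty) contDiffAt_const,
        ddbar_const, ← hωψ, add_zero]
      have hcone := C.ddbar_comp_r_sq_pos hE hyE hyo hh hh1 ha
      change 0 < ddbar (fun z => h (C.r ((φ.trans e).symm z) ^ 2)) (e (φ y))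
        ![a, Complex.I • a] at hcone
      set t := ϕ (ι (e.symm (e (φ y)))) - (h (C.r ((φ.trans e).symm (e (φ y))) ^ 2) + m / 4)
      have hk1t := hk1 t
      have hk2t := hk2 t
      rw [ContinuousAlternatingMap.sub_apply]
      set P := ω e (e (φ y)) ![a, Complex.I • a]
      set Q := ddbar (fun z => h (C.r ((φ.trans e).symm z) ^ 2)) (e (φ y)) ![a, Complex.I • a]
      have hrest : ∀ A B : ℝ, 0 ≤ (1 / 2 : ℝ) * deriv (deriv k) t * (A ^ 2 + B ^ 2) :=
        fun A B => by positivity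
      -- The convex combination (1 + k')P + (-k')Q of the Levi forms of ϕ and h(r²), with P, Q > 0.
      -- The remaining k''-term is nonnegative by convexity of k.
      have hconv : 0 < P + deriv k t * (P - Q) := by
        have h7 : P + deriv k t * (P - Q) = (1 + deriv k t) * P + (-deriv k t) * Q := by ring
        rw [h7]
        rcases eq_or_lt_of_le hk1t.2 with h8 | h8
        · rw [h8]; linarith
        · have h9 := mul_pos (neg_pos.2 h8) hcone
          have h10 : 0 ≤ (1 + deriv k t) * P := mul_nonneg (by linarith [hk1t.1]) hω1.le
          linarith
      have := hrest (fderiv ℝ (fun z => ϕ (ι (e.symm z)) -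
          (h (C.r ((φ.trans e).symm z) ^ 2) + m / 4)) (e (φ y)) a)
        (fderiv ℝ (fun z => ϕ (ι (e.symm z)) -
          (h (C.r ((φ.trans e).symm z) ^ 2) + m / 4)) (e (φ y)) (Complex.I • a))
      linarith
    · have hxK : x ∈ Kᶜ := by
        rintro ⟨y, hy, rfl⟩
        have hy' : C.r y ≤ δ / 2 := hy
        have hyS := hKsub hy
        exact hxB ⟨φ.map_source hyS, by rw [φ.left_inv hyS]; linarith⟩
      have hee : f ∘ e.symm =ᶠ[𝓝 (e x)] fun _ => 0 := by
        filter_upwards [(tendsto_chart_symm e hx).eventually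
          (hKclosed.isOpen_compl.mem_nhds hxK)] with z hz
        exact hfK _ hz
      refine ⟨contDiffAt_const.congr_of_eventuallyEq hee, fun a ha => ?_⟩
      rw [ddbar_congr hee, ddbar_const]
      simpa using hωpos a ha
  · have hev : ∀ᶠ y in 𝓝 C.o, ϕ (ι (φ y)) < m / 4 ∧ C.r y < δ ∧ C.r y ^ 2 < ε := by
      have h1 := hcontψ C.o (by rw [C.r_apex]; exact hδp.le)
      have h2 := h1.eventually (gt_mem_nhds (show ϕ (ι (φ C.o)) < m / 4 by
        rw [hφo, hϕ0]; positivity))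
      have h3 := C.continuous_r.continuousAt.eventually (gt_mem_nhds (show C.r C.o < δ by
        rw [C.r_apex]; exact hδp))
      have h4 := (C.continuous_r.pow 2).continuousAt.eventually (gt_mem_nhds
        (show C.r C.o ^ 2 < ε by rw [C.r_apex]; simpa using hε))
      filter_upwards [h2, h3, h4] with y h5 h6 h7 using ⟨h5, h6, h7⟩
    obtain ⟨δ', hδ', hsub'⟩ := C.apex_nhds.mem_iff.1 hev
    refine ⟨δ', hδ', ?_⟩
    intro y hyo hyδ'
    obtain ⟨-, hyδ, -⟩ := hsub' hyδ'
    obtain ⟨hyS, -, hyV, -⟩ := hin y hyδ.le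
    refine ⟨hyS, hyV, ?_⟩
    intro e he hye
    obtain ⟨hE, hyE, hr2, hψ, hωψ⟩ := hball e he y hyo hyδ hye
    have hopen : IsOpen {x | x ∈ φ.target ∧ C.r (φ.symm x) < δ'} :=
      φ.symm.isOpen_inter_preimage (s := {y : C.Y | C.r y < δ'})
        (isOpen_lt C.continuous_r continuous_const)
    have hmem : φ y ∈ {x | x ∈ φ.target ∧ C.r (φ.symm x) < δ'} :=
      ⟨φ.map_source hyS, by rw [φ.left_inv hyS]; exact hyδ'⟩
    -- Near the apex f is r² - ϕ plus a constant. As ω = i∂∂̄ϕ there, ω + i∂∂̄f = i∂∂̄r², the cone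
    -- metric.
    have hee : f ∘ e.symm =ᶠ[𝓝 (e (φ y))] fun z => (C.r ((φ.trans e).symm z) ^ 2 + (c + m / 4))
        - ϕ (ι (e.symm z)) := by
      filter_upwards [(tendsto_chart_symm e hye).eventually (hopen.mem_nhds hmem)] with z hz
      obtain ⟨hz1, hz2⟩ := hz
      obtain ⟨h5, h6, h7⟩ := hsub' hz2
      rw [φ.right_inv hz1] at h5
      have hcond : e.symm z ∈ φ.target ∧ C.r (φ.symm (e.symm z)) < δ := ⟨hz1, h6⟩
      have hwz : w (e.symm z) = ϕ (ι (e.symm z)) - (C.r (φ.symm (e.symm z)) ^ 2 + m / 4) := by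
        simp only [hw]; rw [hhε _ h7]
      simp only [hf, Function.comp_apply, if_pos hcond]
      rw [hkc _ (by rw [hwz]; nlinarith [sq_nonneg (C.r (φ.symm (e.symm z)))]), hwz]
      change _ = (C.r (φ.symm (e.symm z)) ^ 2 + (c + m / 4)) - _
      ring
    have hpot := C.potential (φ.trans e) hE y hyE hyo
    change C.ω (φ.trans e) (e (φ y)) = ddbar (fun z => C.r ((φ.trans e).symm z) ^ 2) (e (φ y))
      at hpot
    rw [ddbar_congr hee, ddbar_sub ((hr2.add contDiffAt_const).of_le two_le_infty)
      (hψ.of_le two_le_infty), ddbar_add (hr2.of_le two_le_infty) contDiffAt_const, ddbar_const,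
      hpot, hωψ]
    abel

end Gluing

end ConicalKahler

namespace ConicalKahler

/-! ### Finiteness of the singular set and the global metric -/

section GlobalGluing

open Set

variable {X : Type u} [TopologicalSpace X] [CompactSpace X] [ComplexSpace X] {n : ℕ}

/-- A cone chart carries every point except the apex to a regular point, so singular points are
isolated. The singular set is also closed in a compact space. -/
lemma finite_singularSet (C : singularSet n X → CYCone.{v, w} n)
    (hC : ∀ p : singularSet n X, ∃ φ : OpenPartialHomeomorph (C p).Y X,
      IsConeChart (C p) (p : X) φ) : (singularSet n X).Finite := by
  have hclosed : IsClosed (singularSet n X) := isOpen_regularSet.isClosed_compl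
  refine hclosed.isCompact.finite ⟨?_⟩
  rw [discreteTopology_subtype_iff']
  intro p hp
  obtain ⟨φ, hφ⟩ := hC ⟨p, hp⟩
  refine ⟨φ.target, φ.open_target, ?_⟩
  ext x
  constructor
  · rintro ⟨hx, hxS⟩
    by_contra hne
    refine hxS ?_
    have hxo : φ.symm x ≠ (C ⟨p, hp⟩).o := by
      intro h
      apply hne
      have h2 := φ.right_inv hx
      rw [h, hφ.map_apex] at h2
      exact h2.symm
    have := hφ.biholomorphism.map_regular (φ.map_target hx) ((C ⟨p, hp⟩).regular _ hxo)
    rwa [φ.right_inv hx] at this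
  · intro hx
    have hx' : x = p := hx
    rw [hx']
    refine ⟨?_, hp⟩
    have := φ.map_source hφ.apex_mem
    rwa [hφ.map_apex] at this

/-- A smoothly Kähler metric can be changed within its class to be exactly conical near the
singular points. -/
theorem exists_conical_metric [T2Space X] (C : singularSet n X → CYCone.{v, w} n)
    (hC : ∀ p : singularSet n X, ∃ φ : OpenPartialHomeomorph (C p).Y X,
      IsConeChart (C p) (p : X) φ) (ω : FormFamily n X) (hω : IsSmoothlyKahler ω) :
    ∃ ω' : FormFamily n X, IsKahlerOn (regularSet n X) ω' ∧
      (∀ p : singularSet n X, IsConicalAt (C p) (p : X) ω') ∧ SameClass ω' ω := by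
  classical
  have hfin := finite_singularSet C hC
  choose φ hφ using hC
  obtain ⟨V, hV, hdisj⟩ := hfin.t2_separation
  have hloc := fun p : singularSet n X =>
    exists_local_modification hω p.2 (hφ p) ((hV p).2.mem_nhds (hV p).1)
  choose g K hKc hKV hgK hgsm δ hδ hgcone using hloc
  -- The neighbourhoods V p are disjoint, so the chosen p is the only one. Each g p vanishes off the
  -- closed set K p inside V p, and finitely many K p have closed union, so f is zero near any point
  -- outside all V p.
  set f : X → ℝ := fun x => if h : ∃ p : singularSet n X, x ∈ V p then g h.choose x else 0 with hf
  have hfV : ∀ (p : singularSet n X) (x : X), x ∈ V p → f x = g p x := by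
    intro p x hx
    have hex : ∃ p : singularSet n X, x ∈ V p := ⟨p, hx⟩
    have : hex.choose = p := by
      by_contra hne
      have h1 := hdisj hex.choose.2 p.2 (fun h => hne (Subtype.ext h))
      exact disjoint_left.1 h1 hex.choose_spec hx
    simp only [hf, dif_pos hex, this]
  have hnear : ∀ x, (∃ p : singularSet n X, x ∈ V p ∧ f =ᶠ[𝓝 x] g p) ∨
      f =ᶠ[𝓝 x] fun _ => 0 := by
    intro x
    by_cases hx : ∃ p : singularSet n X, x ∈ V p
    · obtain ⟨p, hp⟩ := hx
      left
      refine ⟨p, hp, ?_⟩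
      filter_upwards [(hV p).2.mem_nhds hp] with y hy using hfV p y hy
    · right
      have hcl : IsClosed (⋃ p : singularSet n X, K p) := by
        have : Finite (singularSet n X) := hfin
        exact isClosed_iUnion_of_finite hKc
      have hxm : x ∈ (⋃ p : singularSet n X, K p)ᶜ := by
        intro h
        obtain ⟨p, hp⟩ := mem_iUnion.1 h
        exact hx ⟨p, hKV p hp⟩
      filter_upwards [hcl.isOpen_compl.mem_nhds hxm] with y hy
      by_cases hyV : ∃ p : singularSet n X, y ∈ V p
      · obtain ⟨p, hp⟩ := hyV
        rw [hfV p y hp]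
        exact hgK p y fun h => hy (mem_iUnion.2 ⟨p, h⟩)
      · simp only [hf, dif_neg hyV]
  have hpull : ∀ {g₁ g₂ : X → ℝ} {e : OpenPartialHomeomorph X (Cn n)} {y : X}, y ∈ e.source →
      g₁ =ᶠ[𝓝 y] g₂ → g₁ ∘ e.symm =ᶠ[𝓝 (e y)] g₂ ∘ e.symm := by
    intro g₁ g₂ e y hy h
    exact (tendsto_chart_symm e hy).eventually h
  have hsm : ∀ e : OpenPartialHomeomorph X (Cn n), IsHolChart e → ∀ y ∈ e.source,
      ContDiffAt ℝ ∞ (f ∘ e.symm) (e y) ∧ ∀ a : Cn n, a ≠ 0 →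
        0 < ω e (e y) ![a, Complex.I • a] + ddbar (f ∘ e.symm) (e y) ![a, Complex.I • a] := by
    intro e he y hy
    rcases hnear y with ⟨p, -, hp⟩ | h0
    · have h1 := hpull hy hp
      refine ⟨(hgsm p e he y hy).1.congr_of_eventuallyEq h1, ?_⟩
      rw [ddbar_congr h1]
      exact (hgsm p e he y hy).2
    · have h1 : f ∘ e.symm =ᶠ[𝓝 (e y)] fun _ => 0 := hpull hy h0
      refine ⟨contDiffAt_const.congr_of_eventuallyEq h1, ?_⟩
      intro a ha
      rw [ddbar_congr h1, ddbar_const]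
      simpa using (hω.kahler.kahler e he y (he.source_subset_regularSet hy) hy).pos a ha
  refine ⟨fun e z => ω e z + ddbar (f ∘ e.symm) z,
    hω.kahler.add_ddbar (fun e he y _ hy => (hsm e he y hy).1)
      (fun e he y _ hy => (hsm e he y hy).2), ?_, ⟨f, ?_⟩⟩
  · intro p
    have hr : IsOpen {y : (C p).Y | (C p).r y < δ p} :=
      isOpen_lt (C p).continuous_r continuous_const
    refine ⟨(φ p).restr {y | (C p).r y < δ p}, ⟨(hφ p).biholomorphism.restr _, ?_, ?_⟩, ?_⟩
    · rw [OpenPartialHomeomorph.restr_source, hr.interior_eq]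
      exact ⟨(hφ p).apex_mem, by
        change (C p).r (C p).o < δ p
        rw [(C p).r_apex]; exact hδ p⟩
    · exact (hφ p).map_apex
    · intro e e' he he' y hyW hye hye'
      rw [OpenPartialHomeomorph.restr_source, hr.interior_eq] at hyW
      obtain ⟨⟨hyS, hyδ⟩, hyo⟩ := hyW
      have hyo' : y ≠ (C p).o := hyo
      have hye'' : φ p y ∈ e'.source := hye'
      obtain ⟨-, hyV, hcone⟩ := hgcone p y hyo' hyδ
      have h1 := hcone e' he' hye''
      have h2 : f =ᶠ[𝓝 (φ p y)] g p := by
        filter_upwards [(hV p).2.mem_nhds hyV] with x hx using hfV p x hx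
      have hE : IsHolChart ((φ p).trans e') := (hφ p).biholomorphism.trans_chart he'
      have hyE : y ∈ ((φ p).trans e').source := by
        rw [OpenPartialHomeomorph.trans_source]; exact ⟨hyS, hye''⟩
      -- The local construction identifies the new form with the cone metric only in charts of the
      -- cone pulled back from X. Compatibility of the cone's form carries this to an arbitrary
      -- chart e.
      have h3 := (C p).kahler.compat e ((φ p).trans e') he hE y hyo' hye hyE
      rw [h3]
      change ((C p).ω ((φ p).trans e') (e' (φ p y))).compContinuousLinearMap _ =
        (ω e' (e' (φ p y)) + ddbar (f ∘ e'.symm) (e' (φ p y))).compContinuousLinearMap _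
      rw [ddbar_congr (hpull hye'' h2), h1]
      rfl
  · intro e he z hz
    refine ⟨?_, rfl⟩
    have := (hsm e he (e.symm z) (e.map_target hz)).1
    rwa [e.right_inv hz] at this

end GlobalGluing

end ConicalKahler

namespace ConicalKahler

/-! ### The Fubini–Study form on a projective variety -/

section FubiniStudy

open Set

variable {n N : ℕ}

lemma contDiff_quadratic (T : Cn n →L[ℝ] Cn n →L[ℝ] ℝ) : ContDiff ℝ ∞ fun z => T z z :=
  T.contDiff.clm_apply contDiff_id

lemma fderiv_quadratic (T : Cn n →L[ℝ] Cn n →L[ℝ] ℝ) (hT : ∀ v w, T v w = T w v) :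
    fderiv ℝ (fun z => T z z) = fun z => (2 : ℝ) • T z := by
  funext z
  have h1 : HasFDerivAt (fun z => T z z) _ z :=
    (T.hasFDerivAt (x := z)).clm_apply (hasFDerivAt_id z)
  rw [h1.fderiv]
  ext v
  simp [hT v z]
  ring

lemma ddbar_quadratic (T : Cn n →L[ℝ] Cn n →L[ℝ] ℝ) (hT : ∀ v w, T v w = T w v) (z v : Cn n) :
    ddbar (fun z => T z z) z ![v, Complex.I • v]
      = T v v + T (Complex.I • v) (Complex.I • v) := by
  rw [ddbar_apply_I ((contDiff_quadratic T).contDiffAt.of_le two_le_infty),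
    fderiv_quadratic T hT]
  have h2 : fderiv ℝ (fun z => (2 : ℝ) • T z) z = (2 : ℝ) • T :=
    (T.hasFDerivAt.const_smul (2 : ℝ)).fderiv
  rw [h2]
  simp
  ring

lemma inner_real_eq_re (x y : Cn n) : inner ℝ x y = (inner ℂ x y).re := by
  simp [PiLp.inner_apply]

lemma norm_sq_eq_quadratic : (fun z : Cn n => ‖z‖ ^ 2) = fun z => innerSL ℝ z z := by
  funext z
  simp

lemma innerSL_real_apply (v w : Cn n) : (innerSL ℝ v : Cn n →L[ℝ] ℝ) w = inner ℝ v w := rfl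

lemma innerSL_real_comm (v w : Cn n) :
    (innerSL ℝ v : Cn n →L[ℝ] ℝ) w = (innerSL ℝ w : Cn n →L[ℝ] ℝ) v :=
  real_inner_comm w v

lemma ddbar_norm_sq (z v : Cn n) :
    ddbar (fun z : Cn n => ‖z‖ ^ 2) z ![v, Complex.I • v] = 2 * ‖v‖ ^ 2 := by
  rw [norm_sq_eq_quadratic, ddbar_quadratic (innerSL ℝ) innerSL_real_comm,
    innerSL_real_apply, innerSL_real_apply, real_inner_self_eq_norm_sq,
    real_inner_self_eq_norm_sq, norm_smul, Complex.norm_I]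
  ring

lemma contDiff_coord_norm_sq (i : Fin n) : ContDiff ℝ ∞ fun z : Cn n => ‖z i‖ ^ 2 :=
  (contDiff_norm_sq ℝ).comp (coordCLM i).contDiff

lemma ddbar_coord_norm_sq (i : Fin n) (z v : Cn n) :
    ddbar (fun z : Cn n => ‖z i‖ ^ 2) z ![v, Complex.I • v] = 2 * ‖v i‖ ^ 2 := by
  let T : Cn n →L[ℝ] Cn n →L[ℝ] ℝ :=
    ((ContinuousLinearMap.compL ℝ (Cn n) ℂ ℝ).flip (coordCLM i)).comp
      ((innerSL ℝ (E := ℂ)).comp (coordCLM i))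
  have hTv : ∀ v w, T v w = inner ℝ (v i) (w i) := fun v w => rfl
  have h1 : (fun z : Cn n => ‖z i‖ ^ 2) = fun z => T z z := by
    funext z
    rw [hTv, real_inner_self_eq_norm_sq]
  rw [h1, ddbar_quadratic T (fun v w => by rw [hTv, hTv]; exact real_inner_comm _ _), hTv, hTv,
    real_inner_self_eq_norm_sq, real_inner_self_eq_norm_sq]
  simp
  ring

lemma contDiffAt_log_norm_sq {Z : Cn n} (hZ : Z ≠ 0) :
    ContDiffAt ℝ ∞ (fun Z : Cn n => Real.log (‖Z‖ ^ 2)) Z :=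
  (contDiff_norm_sq ℝ).contDiffAt.log (by positivity)

/-- The Fubini–Study form in homogeneous coordinates. -/
lemma ddbar_log_norm_sq_apply {Z : Cn n} (hZ : Z ≠ 0) (W : Cn n) :
    ddbar (fun Z : Cn n => Real.log (‖Z‖ ^ 2)) Z ![W, Complex.I • W] =
      2 * ((‖Z‖ * ‖W‖) ^ 2 - ‖inner ℂ Z W‖ ^ 2) / ‖Z‖ ^ 4 := by
  have hZn : 0 < ‖Z‖ := norm_pos_iff.2 hZ
  have hne : ‖Z‖ ^ 2 ≠ 0 := by positivity
  have hd : ∀ v : Cn n, fderiv ℝ (fun Z : Cn n => ‖Z‖ ^ 2) Z v = 2 * inner ℝ Z v := by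
    intro v
    rw [norm_sq_eq_quadratic, fderiv_quadratic (innerSL ℝ) innerSL_real_comm]
    simp
    rfl
  rw [ddbar_comp_real_apply_I (u := fun Z : Cn n => ‖Z‖ ^ 2) (h := Real.log)
    ((contDiff_norm_sq ℝ).contDiffAt) (Real.contDiffAt_log.2 hne), ddbar_norm_sq, hd, hd,
    Real.deriv_log', deriv_inv, inner_real_eq_re, inner_real_eq_re, inner_smul_right]
  have h1 : ‖inner ℂ Z W‖ ^ 2 = (inner ℂ Z W).re ^ 2 + (inner ℂ Z W).im ^ 2 := by
    rw [← Complex.normSq_eq_norm_sq, Complex.normSq_apply]; ring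
  rw [h1]
  simp only [Complex.mul_re, Complex.I_re, Complex.I_im]
  field_simp
  ring

lemma ddbar_log_norm_sq_nonneg {Z : Cn n} (hZ : Z ≠ 0) (W : Cn n) :
    0 ≤ ddbar (fun Z : Cn n => Real.log (‖Z‖ ^ 2)) Z ![W, Complex.I • W] := by
  rw [ddbar_log_norm_sq_apply hZ]
  have h1 := norm_inner_le_norm (𝕜 := ℂ) Z W
  have h2 : ‖inner ℂ Z W‖ ^ 2 ≤ (‖Z‖ * ‖W‖) ^ 2 := by gcongr
  have h3 : 0 ≤ (‖Z‖ * ‖W‖) ^ 2 - ‖inner ℂ Z W‖ ^ 2 := by linarith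
  positivity

lemma ddbar_log_norm_sq_pos {Z W : Cn n} (hZ : Z ≠ 0) (hW : W ≠ 0)
    (hind : ∀ c : ℂ, c ≠ 0 → W ≠ c • Z) :
    0 < ddbar (fun Z : Cn n => Real.log (‖Z‖ ^ 2)) Z ![W, Complex.I • W] := by
  rw [ddbar_log_norm_sq_apply hZ]
  have hZn : 0 < ‖Z‖ := norm_pos_iff.2 hZ
  have h1 : ‖inner ℂ Z W‖ < ‖Z‖ * ‖W‖ := by
    refine lt_of_le_of_ne (norm_inner_le_norm (𝕜 := ℂ) Z W) ?_
    intro h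
    obtain ⟨c, hc, hcW⟩ := (norm_inner_eq_norm_iff hZ hW).1 h
    exact hind c hc hcW
  have h2 : ‖inner ℂ Z W‖ ^ 2 < (‖Z‖ * ‖W‖) ^ 2 := by gcongr
  have h3 : 0 < (‖Z‖ * ‖W‖) ^ 2 - ‖inner ℂ Z W‖ ^ 2 := by linarith
  positivity

/-- `log |g|²` is pluriharmonic for a holomorphic function `g` without zeros. -/
lemma ddbar_log_norm_sq_analytic {g : Cn n → ℂ} {z : Cn n} (hg : AnalyticAt ℂ g z)
    (hz : g z ≠ 0) :
    ContDiffAt ℝ ∞ (fun y => Real.log (‖g y‖ ^ 2)) z ∧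
      ddbar (fun y => Real.log (‖g y‖ ^ 2)) z = 0 := by
  -- Dividing by g z moves the value at z to 1, where the principal logarithm is holomorphic. The
  -- real constant restores log |g|² as the real part.
  set F : Cn n → ℂ := fun y => 2 * Complex.log (g y / g z) + 2 * (Real.log ‖g z‖ : ℝ) with hF
  have hFa : AnalyticAt ℂ F z := by
    have h1 : AnalyticAt ℂ (fun y => Complex.log (g y / g z)) z := by
      refine (hg.div analyticAt_const hz).clog ?_
      simp [div_self hz]
    exact (analyticAt_const.mul h1).add analyticAt_const
  have hee : (fun y => Real.log (‖g y‖ ^ 2)) =ᶠ[𝓝 z] fun y => (F y).re := by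
    filter_upwards [hg.continuousAt.eventually_ne hz] with y hy
    have h1 : (F y).re = 2 * Real.log ‖g y / g z‖ + 2 * Real.log ‖g z‖ := by
      simp [hF, Complex.log_re]
    rw [h1, norm_div, Real.log_div (norm_ne_zero_iff.2 hy) (norm_ne_zero_iff.2 hz), Real.log_pow]
    push_cast
    ring
  constructor
  · exact (Complex.reCLM.contDiff.contDiffAt.comp z
      (analyticAt_contDiffAt_real hFa)).congr_of_eventuallyEq hee
  · rw [ddbar_congr hee, ddbar_re_of_analyticAt hFa]

/-! Projective varieties. -/

lemma affineRep_self {i : Fin (N + 1)} {P : Projectivization ℂ (Cn (N + 1))} (h : P.rep i ≠ 0) :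
    affineRep i P i = 1 := by
  simp [affineRep, h]

lemma affineRep_ne_zero {i : Fin (N + 1)} {P : Projectivization ℂ (Cn (N + 1))}
    (h : P.rep i ≠ 0) : affineRep i P ≠ 0 := by
  intro h0
  have := affineRep_self h
  rw [h0] at this
  simp at this

lemma log_affineRep {i k : Fin (N + 1)} {P : Projectivization ℂ (Cn (N + 1))}
    (hi : P.rep i ≠ 0) (hk : P.rep k ≠ 0) :
    Real.log (‖affineRep k P‖ ^ 2) =
      Real.log (‖affineRep i P‖ ^ 2) - Real.log (‖affineRep i P k‖ ^ 2) := by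
  have hik : affineRep i P k ≠ 0 := by simp [affineRep, hi, hk]
  have h1 : affineRep k P = (affineRep i P k)⁻¹ • affineRep i P := by
    simp only [affineRep, PiLp.smul_apply, smul_eq_mul, smul_smul]
    congr 1
    field_simp
  rw [h1, norm_smul, mul_pow, norm_inv, inv_pow, Real.log_mul, Real.log_inv]
  · ring
  · exact inv_ne_zero (pow_ne_zero _ (norm_ne_zero_iff.2 hik))
  · exact pow_ne_zero _ (norm_ne_zero_iff.2 (affineRep_ne_zero hi))

lemma exists_rep_ne_zero (P : Projectivization ℂ (Cn (N + 1))) : ∃ i, P.rep i ≠ 0 := by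
  by_contra! h
  exact P.rep_nonzero (by ext i; exact h i)

/-- An index of a non-zero homogeneous coordinate. -/
noncomputable def affineIndex {X : Type u} (j : X → Projectivization ℂ (Cn (N + 1))) (x : X) :
    Fin (N + 1) :=
  (exists_rep_ne_zero (j x)).choose

lemma affineIndex_spec {X : Type u} (j : X → Projectivization ℂ (Cn (N + 1))) (x : X) :
    (j x).rep (affineIndex j x) ≠ 0 := (exists_rep_ne_zero (j x)).choose_spec

variable {X : Type u} [TopologicalSpace X] [ComplexSpace X]

/-- The Fubini–Study potential in the `i`-th affine chart. -/
noncomputable def fsPotential (j : X → Projectivization ℂ (Cn (N + 1))) (i : Fin (N + 1)) (x : X) :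
    ℝ := Real.log (‖affineRep i (j x)‖ ^ 2)

variable {j : X → Projectivization ℂ (Cn (N + 1))}

lemma fsPotential_smooth (hj : IsProjectiveVariety j) {i : Fin (N + 1)}
    {e : OpenPartialHomeomorph X (Cn n)} (he : IsHolChart e) {y : X} (hy : y ∈ e.source)
    (hi : (j y).rep i ≠ 0) : ContDiffAt ℝ ∞ (fsPotential j i ∘ e.symm) (e y) := by
  have han := (hj.embedding i).analyticAt_chart he hi hy
  refine ContDiffAt.comp (e y) (f := (fun x => affineRep i (j x)) ∘ e.symm)
    (contDiffAt_log_norm_sq ?_) (analyticAt_contDiffAt_real han)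
  simp only [Function.comp_apply, e.left_inv hy]
  exact affineRep_ne_zero hi

lemma ddbar_fsPotential_pullback (hj : IsProjectiveVariety j) {i : Fin (N + 1)}
    {e : OpenPartialHomeomorph X (Cn n)} (he : IsHolChart e) {y : X} (hy : y ∈ e.source)
    (hi : (j y).rep i ≠ 0) :
    ddbar (fsPotential j i ∘ e.symm) (e y) =
      (ddbar (fun Z => Real.log (‖Z‖ ^ 2)) (affineRep i (j y))).compContinuousLinearMap
        (fderiv ℝ ((fun x => affineRep i (j x)) ∘ e.symm) (e y)) := by
  have han := (hj.embedding i).analyticAt_chart he hi hy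
  have hval : ((fun x => affineRep i (j x)) ∘ e.symm) (e y) = affineRep i (j y) := by
    simp [e.left_inv hy]
  have h := ddbar_comp_holomorphic (φ := fun Z => Real.log (‖Z‖ ^ 2)) han (by
    rw [hval]; exact (contDiffAt_log_norm_sq (affineRep_ne_zero hi)).of_le two_le_infty)
  rw [hval] at h
  exact h

/-- The potentials of two affine charts differ by log |Z_k/Z_i|², which is pluriharmonic because
Z_k/Z_i is holomorphic without zeros on the overlap. -/
lemma ddbar_fsPotential_indep (hj : IsProjectiveVariety j) {i k : Fin (N + 1)}
    {e : OpenPartialHomeomorph X (Cn n)} (he : IsHolChart e) {y : X} (hy : y ∈ e.source)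
    (hi : (j y).rep i ≠ 0) (hk : (j y).rep k ≠ 0) :
    ddbar (fsPotential j k ∘ e.symm) (e y) = ddbar (fsPotential j i ∘ e.symm) (e y) := by
  have hsi := fsPotential_smooth hj he hy hi
  have han : AnalyticAt ℂ (fun z => affineRep i (j (e.symm z)) k) (e y) :=
    analyticAt_cn_iff.1 ((hj.embedding i).analyticAt_chart he hi hy) k
  have hne : affineRep i (j (e.symm (e y))) k ≠ 0 := by
    rw [e.left_inv hy]; simp [affineRep, hi, hk]
  obtain ⟨h1, h2⟩ := ddbar_log_norm_sq_analytic han hne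
  have hee : fsPotential j k ∘ e.symm =ᶠ[𝓝 (e y)] fun z => (fsPotential j i ∘ e.symm) z -
      Real.log (‖affineRep i (j (e.symm z)) k‖ ^ 2) := by
    filter_upwards [(tendsto_chart_symm e hy).eventually ((hj.embedding i).isOpen.mem_nhds hi),
      (tendsto_chart_symm e hy).eventually ((hj.embedding k).isOpen.mem_nhds hk)] with z hzi hzk
    exact log_affineRep hzi hzk
  rw [ddbar_congr hee, ddbar_sub (hsi.of_le two_le_infty) (h1.of_le two_le_infty), h2]
  exact sub_zero _

/-- The restriction of the Fubini–Study form. -/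
noncomputable def fubiniStudy (n : ℕ) (j : X → Projectivization ℂ (Cn (N + 1))) : FormFamily n X :=
  fun e z => ddbar (fsPotential j (affineIndex j (e.symm z)) ∘ e.symm) z

lemma fubiniStudy_eq (hj : IsProjectiveVariety j) {i : Fin (N + 1)}
    {e : OpenPartialHomeomorph X (Cn n)} (he : IsHolChart e) {y : X} (hy : y ∈ e.source)
    (hi : (j y).rep i ≠ 0) :
    fubiniStudy n j e (e y) = ddbar (fsPotential j i ∘ e.symm) (e y) := by
  rw [fubiniStudy, e.left_inv hy]
  exact ddbar_fsPotential_indep hj he hy hi (affineIndex_spec j y)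

/-- The index chosen in `fubiniStudy` may jump from point to point. Freezing it in a neighbourhood
is what permits differentiating the form. -/
lemma fubiniStudy_eventuallyEq (hj : IsProjectiveVariety j) {i : Fin (N + 1)}
    {e : OpenPartialHomeomorph X (Cn n)} (he : IsHolChart e) {y : X} (hy : y ∈ e.source)
    (hi : (j y).rep i ≠ 0) :
    fubiniStudy n j e =ᶠ[𝓝 (e y)] ddbar (fsPotential j i ∘ e.symm) := by
  filter_upwards [(tendsto_chart_symm e hy).eventually ((hj.embedding i).isOpen.mem_nhds hi),
    eventually_chart_symm e hy] with z hzi hz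
  have := fubiniStudy_eq hj he (e.map_target hz.1) hzi
  rwa [hz.2] at this

lemma isFubiniStudyRestriction_fubiniStudy (hj : IsProjectiveVariety j) :
    IsFubiniStudyRestriction j (fubiniStudy n j) := by
  intro i e he y hi hy
  rw [fubiniStudy_eq hj he hy hi, ddbar_fsPotential_pullback hj he hy hi]

lemma isKahlerOn_fubiniStudy (hj : IsProjectiveVariety j) :
    IsKahlerOn (regularSet n X) (fubiniStudy n j) where
  compat e e' he he' y _ hy hy' := by
    have hi := affineIndex_spec j y
    rw [fubiniStudy_eq hj he hy hi, fubiniStudy_eq hj he' hy' hi]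
    exact ddbar_chart_compat he he' hy hy' (fsPotential_smooth hj he' hy' hi)
  kahler e he y _ hy := by
    set i := affineIndex j y
    have hi : (j y).rep i ≠ 0 := affineIndex_spec j y
    have hsm := fsPotential_smooth hj he hy hi
    have hee := fubiniStudy_eventuallyEq hj he hy hi
    refine ⟨(ddbar_contDiffAt hsm).congr_of_eventuallyEq hee, ?_, ?_, ?_⟩
    · rw [hee.extDeriv_eq, extDeriv_ddbar hsm]
    · intro a b
      rw [hee.self_of_nhds, ddbar_type (hsm.of_le two_le_infty)]
    · intro a ha
      have han := (hj.embedding i).analyticAt_chart he hi hy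
      rw [hee.self_of_nhds, ddbar_fsPotential_pullback hj he hy hi,
        ContinuousAlternatingMap.compContinuousLinearMap_apply]
      set L := fderiv ℝ ((fun x => affineRep i (j x)) ∘ e.symm) (e y) with hL
      have hvec : (L ∘ ![a, Complex.I • a]) = ![L a, Complex.I • L a] := by
        funext l
        fin_cases l
        · rfl
        · exact fderiv_real_I_smul han.differentiableAt a
      rw [hvec]
      -- The image lies in the slice Z_i = 1, so tangent vectors have vanishing i-th coordinate.
      -- Such a vector is not a nonzero multiple of Z, and those multiples are the only nonzero
      -- vectors on which i∂∂̄ log |Z|² degenerates.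
      have hLi : L a i = 0 := by
        have h1 : HasFDerivAt ((fun x => affineRep i (j x)) ∘ e.symm) L (e y) :=
          (han.differentiableAt.restrictScalars ℝ).hasFDerivAt
        have h2 := (coordCLM i).hasFDerivAt.comp (e y) h1
        have h3 : HasFDerivAt (coordCLM i ∘ (fun x => affineRep i (j x)) ∘ e.symm)
            (0 : Cn n →L[ℝ] ℂ) (e y) := by
          refine (hasFDerivAt_const (1 : ℂ) (e y)).congr_of_eventuallyEq ?_
          filter_upwards [(tendsto_chart_symm e hy).eventually
            ((hj.embedding i).isOpen.mem_nhds hi)] with z hz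
          exact affineRep_self hz
        exact DFunLike.congr_fun (h2.unique h3) a
      have hLa : L a ≠ 0 := by
        intro h0
        apply ha
        apply (hj.embedding i).fderiv_injective he hi hy
        rw [← hL, h0, map_zero]
      refine ddbar_log_norm_sq_pos (affineRep_ne_zero hi) hLa ?_
      intro c hc hcW
      rw [hcW] at hLi
      simp [affineRep_self hi, hc] at hLi

/-- Near the affine cone over projective space, `i∂∂̄ (log |Z|² + |Z_i|²)` is a Kähler form. -/
lemma isKahlerAt_fs_ambient {i : Fin n} {Z : Cn n} (hZ : Z i ≠ 0) :
    IsKahlerAt (ddbar fun Z : Cn n => Real.log (‖Z‖ ^ 2) + ‖Z i‖ ^ 2) Z := by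
  have hZ0 : Z ≠ 0 := by rintro rfl; simp at hZ
  have h1 := contDiffAt_log_norm_sq hZ0
  have h2 : ContDiffAt ℝ ∞ (fun z : Cn n => ‖z i‖ ^ 2) Z := (contDiff_coord_norm_sq i).contDiffAt
  have hsm : ContDiffAt ℝ ∞ (fun Z : Cn n => Real.log (‖Z‖ ^ 2) + ‖Z i‖ ^ 2) Z := h1.add h2
  refine ⟨ddbar_contDiffAt hsm, extDeriv_ddbar hsm,
    fun a b => ddbar_type (hsm.of_le two_le_infty) a b, ?_⟩
  intro a ha
  rw [ddbar_add (h1.of_le two_le_infty) (h2.of_le two_le_infty),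
    ContinuousAlternatingMap.add_apply, ddbar_coord_norm_sq]
  -- Equality in Cauchy–Schwarz holds only for multiples of Z. On those the |Z_i|² term is positive,
  -- because Z_i ≠ 0.
  by_cases hind : ∀ c : ℂ, c ≠ 0 → a ≠ c • Z
  · have := ddbar_log_norm_sq_pos hZ0 ha hind
    positivity
  · push Not at hind
    obtain ⟨c, hc, rfl⟩ := hind
    have h3 := ddbar_log_norm_sq_nonneg hZ0 (c • Z)
    have h4 : 0 < ‖(c • Z) i‖ := by
      rw [PiLp.smul_apply, smul_eq_mul, norm_pos_iff]
      exact mul_ne_zero hc hZ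
    positivity

/-- The ambient Kähler potential is log |Z|² + |Z_i|². On the image of the i-th affine chart the
added term is identically 1, so the restriction is still the Fubini–Study form. -/
lemma isSmoothlyKahler_fubiniStudy (hj : IsProjectiveVariety j) :
    IsSmoothlyKahler (fubiniStudy n j) where
  kahler := isKahlerOn_fubiniStudy hj
  local_restriction p _ := by
    set i := affineIndex j p
    have hi : (j p).rep i ≠ 0 := affineIndex_spec j p
    refine ⟨N + 1, {x | (j x).rep i ≠ 0}, fun x => affineRep i (j x), {Z | Z i ≠ 0},
      ddbar fun Z => Real.log (‖Z‖ ^ 2) + ‖Z i‖ ^ 2, hi, hj.embedding i, ?_, ?_, ?_, ?_⟩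
    · exact isOpen_ne_fun (coordCLM i).continuous continuous_const
    · intro x hx
      have h1 : affineRep i (j x) i = 1 := affineRep_self hx
      change affineRep i (j x) i ≠ 0
      rw [h1]; exact one_ne_zero
    · intro Z hZ
      exact isKahlerAt_fs_ambient hZ
    · intro e he y hy hye
      have hy' : (j y).rep i ≠ 0 := hy
      have han := (hj.embedding i).analyticAt_chart he hy' hye
      have hval : ((fun x => affineRep i (j x)) ∘ e.symm) (e y) = affineRep i (j y) := by
        simp [e.left_inv hye]
      have hG : ContDiffAt ℝ 2 (fun Z : Cn (N + 1) => Real.log (‖Z‖ ^ 2) + ‖Z i‖ ^ 2)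
          (affineRep i (j y)) :=
        ((contDiffAt_log_norm_sq (affineRep_ne_zero hy')).add
          (contDiff_coord_norm_sq i).contDiffAt).of_le two_le_infty
      have h1 := ddbar_comp_holomorphic
        (φ := fun Z : Cn (N + 1) => Real.log (‖Z‖ ^ 2) + ‖Z i‖ ^ 2) han (by rw [hval]; exact hG)
      rw [hval] at h1
      rw [← h1, fubiniStudy_eq hj he hye hy']
      have hee : (fun Z : Cn (N + 1) => Real.log (‖Z‖ ^ 2) + ‖Z i‖ ^ 2) ∘
          ((fun x => affineRep i (j x)) ∘ e.symm) =ᶠ[𝓝 (e y)]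
          fun z => (fsPotential j i ∘ e.symm) z + 1 := by
        filter_upwards [(tendsto_chart_symm e hye).eventually
          ((hj.embedding i).isOpen.mem_nhds hy')] with z hz
        have h2 : affineRep i (j (e.symm z)) i = 1 := affineRep_self hz
        simp [fsPotential, h2]
      rw [ddbar_congr hee, ddbar_add ((fsPotential_smooth hj he hye hy').of_le two_le_infty)
        contDiffAt_const, ddbar_const, add_zero]

end FubiniStudy

end ConicalKahler

theorem proposition2p3 {X : Type u} [TopologicalSpace X] [T2Space X] [CompactSpace X]
    [ComplexSpace X] (n : ℕ) (C : singularSet n X → CYCone.{v, w} n)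
    (hC : ∀ p : singularSet n X, ∃ φ : OpenPartialHomeomorph (C p).Y X,
      IsConeChart (C p) (p : X) φ) :
    (∀ ω : FormFamily n X, IsSmoothlyKahler ω →
      ∃ ω' : FormFamily n X, IsKahlerOn (regularSet n X) ω' ∧
        (∀ p : singularSet n X, IsConicalAt (C p) (p : X) ω') ∧ SameClass ω' ω) ∧
    (∀ (N : ℕ) (j : X → Projectivization ℂ (Cn (N + 1))), IsProjectiveVariety j →
      ∃ ω : FormFamily n X, IsFubiniStudyRestriction j ω ∧ IsSmoothlyKahler ω ∧
      ∃ ω' : FormFamily n X, IsKahlerOn (regularSet n X) ω' ∧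
        (∀ p : singularSet n X, IsConicalAt (C p) (p : X) ω') ∧ SameClass ω' ω) := by
  refine ⟨exists_conical_metric C hC, fun N j hj => ?_⟩
  exact ⟨fubiniStudy n j, isFubiniStudyRestriction_fubiniStudy hj, isSmoothlyKahler_fubiniStudy hj,
    exists_conical_metric C hC _ (isSmoothlyKahler_fubiniStudy hj)⟩
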